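/- Let $P_k=\mathbb F_2[x_1,\dots,x_k]$ with $|x_i|=1$, regarded as a module over the mod-2 Steenrod algebra $\mathcal A$, let $QP_k=\mathbb F_2\otimes_{\mathcal A}P_k=P_k/\mathcal A^+P_k$, and let $(QP_k)_n$ be the subspace of classes $[f]$ of homogeneous polynomials $f$ of degree $n$, with the action of $GL_k=GL_k(\mathbb F_2)$ induced by linear substitution of the variables. Let $\psi:P_3\to P_3$ be the $\mathbb F_2$-linear map with $\psi(y)=x_1x_2x_3y^2$ for every monomial $y$, let $\psi^u$ be its $u$-th iterate, and put $$\bar p_0=x_1x_2x_3^6+x_1x_2^6x_3+x_1^3x_2x_3^4+x_1^3x_2^4x_3 .$$ Let $(P_k)^*_n$ be the dual of the space of homogeneous polynomials of degree $n$, let $P((P_k)^*_n)$ be the subspace of the functionals annihilated by all Steenrod operations of positive degree, and let $\langle f,b\rangle$ denote the pairing of $f\in P_k$ with $b\in (P_k)^*_n$. The Singer transfer $$Tr_k:P((P_k)^*_n)\to \mathrm{Ext}_{\mathcal A}^{k,k+n}(\mathbb F_2,\mathbb F_2),\qquad Tr_k(b)=b_*(e_k),$$ is the dual of $\mathrm{Tor}^{\mathcal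 A}_{k,k+n}(\mathbb F_2,\mathbb F_2)\to (QP_k)_n$, $z\mapsto e_k\cap z$. Here $e_k\in\mathrm{Ext}^k_{\mathcal A}(\Sigma^{-k}\mathbb F_2,P_k)$ is Singer's class, the iterated product of the classes of the extensions $0\to P_1\otimes P_j\to \widehat P_1\otimes P_j\to\Sigma^{-1}P_j\to 0$ for $0\le j<k$, where $\widehat P_1\subset\mathbb F_2[x,x^{-1}]$ is spanned by the $x^i$ with $i\ge -1$. Identify $\mathrm{Ext}_{\mathcal A}^{k,k+n}(\mathbb F_2,\mathbb F_2)$ with the homology $H^{k,n}(\Lambda,\delta)$ of the lambda algebra, which has generators $\lambda_i$ ($i\ge 0$), relations $\lambda_j\lambda_{2j+1+m}=\sum_{\nu\ge0}\binom{m-\nu-1}{\nu}\lambda_{j+m-\nu}\lambda_{2j+1+\nu}$ ($j,m\ge0$) and differential $\delta(\lambda_i)=\sum_{\nu\ge0}\binom{i-\nu-1}{\nu+1}\lambda_{i-\nu-1}\lambda_\nu$ (binomial coefficients with a negative upper entry are $0$), through the map which sends the class of a bar cocycle $f$ to the class of $\sum f(Sq^{i_1+1},\dots,Sq^{i_k+1})\,\lambda_{i_k}\cdots\lambda_{i_1}$,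 summed over all $i_1,\dots,i_k\ge 0$ with $i_1+\dots+i_k=n$. Let $Sq^0$ be the endomorphism of $H(\Lambda,\delta)$ induced by the algebra homomorphism $\lambda_i\mapsto\lambda_{2i+1}$, and put $c_0=[\lambda_2\lambda_3^2]$ and $c_u=(Sq^0)^u(c_0)$. **Proposition.** Let $s>0$ and $u\ge 0$ be integers and $n=2^{s+u+1}+2^{u+1}+2^u-3$. Then $$(QP_3)_n^{GL_3}=\begin{cases}\langle[\psi^u(\bar p_0)]\rangle,&\text{if } s=2,\\ 0,&\text{if } s\ne 2.\end{cases}$$ Moreover, if $s=2$, there is $b\in P((P_3)^*_n)$ with $\langle\psi^u(\bar p_0),b\rangle=1$, and for every such $b$ (that is, for every representative of the class in $\mathbb F_2\otimes_{GL_3}P((P_3)^*_n)$ dual to $[\psi^u(\bar p_0)]$) one has $Tr_3(b)=c_u$. -/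

import Mathlib

noncomputable section

namespace Singer

/-! ### The hit problem -/

/-- `P k = F_2[x_1, …, x_k]`; the variable `x_{i+1}` is `X i`, `i : Fin k`. -/
abbrev P (k : ℕ) : Type := MvPolynomial (Fin k) (ZMod 2)

/-- The total Steenrod square `f ↦ ∑_j Sq^j(f) t^j`: the ring homomorphism
`P_k → P_k⟦t⟧` with `x_i ↦ x_i + x_i^2 t` (Cartan formula, `Sq^0 x_i = x_i`, `Sq^1 x_i = x_i^2`). -/
def totalSq (k : ℕ) : P k →ₐ[ZMod 2] PowerSeries (P k) :=
  MvPolynomial.aeval fun i =>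
    PowerSeries.C (MvPolynomial.X i) + PowerSeries.X * PowerSeries.C (MvPolynomial.X i ^ 2)

/-- The Steenrod square `Sq^j : P_k → P_k`. -/
def Sq {k : ℕ} (j : ℕ) : P k →ₗ[ZMod 2] P k :=
  ((PowerSeries.coeff (R := P k) j).restrictScalars (ZMod 2)).comp (totalSq k).toLinearMap

/-- The hit polynomials `𝒜⁺ P_k = ∑_{j > 0} Sq^j(P_k)`. -/
def hit (k : ℕ) : Submodule (ZMod 2) (P k) := ⨆ j : ℕ, LinearMap.range (Sq (k := k) (j + 1))

/-- `QP_k = F_2 ⊗_𝒜 P_k = P_k / 𝒜⁺ P_k`. -/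
abbrev QP (k : ℕ) : Type := P k ⧸ hit k

/-- `(QP_k)_d`: the classes represented by homogeneous polynomials of degree `d`. -/
def QPdeg (k d : ℕ) : Submodule (ZMod 2) (QP k) :=
  (MvPolynomial.homogeneousSubmodule (Fin k) (ZMod 2) d).map (hit k).mkQ

/-- The action of a matrix `g ∈ GL_k(F_2)` on `P_k` by the linear substitution
`x_j ↦ ∑_i g_{ij} x_i`. -/
def subst {k : ℕ} (g : GL (Fin k) (ZMod 2)) : P k →ₐ[ZMod 2] P k :=
  MvPolynomial.aeval fun j => ∑ i, MvPolynomial.C (g.1 i j) * MvPolynomial.X i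

theorem coeff_mapAlgHom {R S : Type} [CommRing R] [CommRing S] [Algebra (ZMod 2) R]
    [Algebra (ZMod 2) S] (φ : R →ₐ[ZMod 2] S) (j : ℕ) (F : PowerSeries R) :
    PowerSeries.coeff j (PowerSeries.mapAlgHom φ F) = φ (PowerSeries.coeff j F) :=
  PowerSeries.coeff_map (φ : R →+* S) j F

theorem mapAlgHom_C {R S : Type} [CommRing R] [CommRing S] [Algebra (ZMod 2) R]
    [Algebra (ZMod 2) S] (φ : R →ₐ[ZMod 2] S) (r : R) :
    PowerSeries.mapAlgHom φ (PowerSeries.C r) = PowerSeries.C (φ r) :=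
  PowerSeries.map_C (φ : R →+* S) r

theorem mapAlgHom_X {R S : Type} [CommRing R] [CommRing S] [Algebra (ZMod 2) R]
    [Algebra (ZMod 2) S] (φ : R →ₐ[ZMod 2] S) :
    PowerSeries.mapAlgHom φ PowerSeries.X = PowerSeries.X :=
  PowerSeries.map_X (φ : R →+* S)

theorem subst_Sq {k : ℕ} (g : GL (Fin k) (ZMod 2)) (j : ℕ) (f : P k) :
    subst g (Sq j f) = Sq j (subst g f) := by
  have key : (PowerSeries.mapAlgHom (subst g)).comp (totalSq k) = (totalSq k).comp (subst g) := by
    apply MvPolynomial.algHom_ext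
    intro i
    have hC : ∀ c : ZMod 2, totalSq k (MvPolynomial.C c) = PowerSeries.C (MvPolynomial.C c) :=
      fun c => ((totalSq k).commutes c).trans PowerSeries.algebraMap_apply
    have hX : ∀ i, totalSq k (MvPolynomial.X i) =
        PowerSeries.C (MvPolynomial.X i) + PowerSeries.X * PowerSeries.C (MvPolynomial.X i ^ 2) :=
      fun i => by simp [totalSq]
    have hg : subst g (MvPolynomial.X i) = ∑ m, MvPolynomial.C (g.1 m i) * MvPolynomial.X m := by
      simp [subst]
    have hc : ∀ c : ZMod 2, c ^ 2 = c := by decide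
    have hsq : (∑ m, (MvPolynomial.C (g.1 m i) * MvPolynomial.X m : P k)) ^ 2 =
        ∑ m, MvPolynomial.C (g.1 m i) * MvPolynomial.X m ^ 2 := by
      rw [sum_pow_char]
      refine Finset.sum_congr rfl fun m _ => ?_
      rw [mul_pow, ← map_pow, hc]
    rw [AlgHom.comp_apply, AlgHom.comp_apply, hX, hg, map_add, map_mul, mapAlgHom_C, mapAlgHom_X,
      mapAlgHom_C, map_pow, hg, hsq, map_sum, map_sum, map_sum, Finset.mul_sum,
      ← Finset.sum_add_distrib]
    refine Finset.sum_congr rfl fun m _ => ?_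
    rw [map_mul (totalSq k), hC, hX, map_mul, map_mul]
    ring
  have := congrArg (fun F => PowerSeries.coeff j (F f)) key
  simp only [AlgHom.comp_apply, coeff_mapAlgHom] at this
  exact this

theorem hit_le_comap {k : ℕ} (g : GL (Fin k) (ZMod 2)) :
    hit k ≤ (hit k).comap (subst g).toLinearMap := by
  refine iSup_le fun j => ?_
  rintro _ ⟨f, rfl⟩
  refine Submodule.mem_iSup_of_mem j ⟨subst g f, ?_⟩
  exact (subst_Sq g (j + 1) f).symm

/-- The action of `GL_k` induced on `QP_k`. -/
def QPact {k : ℕ} (g : GL (Fin k) (ZMod 2)) : QP k →ₗ[ZMod 2] QP k :=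
  (hit k).mapQ (hit k) (subst g).toLinearMap (hit_le_comap g)

/-- The invariant space `(QP_k)_d^{GL_k}`. -/
def invariants (k d : ℕ) : Submodule (ZMod 2) (QP k) :=
  QPdeg k d ⊓ ⨅ g : GL (Fin k) (ZMod 2), LinearMap.eqLocus (QPact g) LinearMap.id

/-! ### Laurent polynomials as a module over the Steenrod algebra -/

/-- Laurent polynomials `L k = F_2[x_1^{±1}, …, x_k^{±1}]`, with basis the monomials `x^e`, `e ∈ ℤ^k`. -/
abbrev L (k : ℕ) : Type := AddMonoidAlgebra (ZMod 2) (Fin k → ℤ)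

/-- The Laurent monomial `x^e`. -/
def lmon {k : ℕ} (e : Fin k → ℤ) : L k := AddMonoidAlgebra.single e 1

theorem lmon_add {k : ℕ} (e f : Fin k → ℤ) : lmon (e + f) = lmon e * lmon f := by
  simp [lmon, AddMonoidAlgebra.single_mul_single]

theorem lmon_zero {k : ℕ} : lmon (0 : Fin k → ℤ) = 1 := rfl

/-- `x_i + x_i^2 t = x_i (1 + x_i t)`, a unit of `L_k⟦t⟧`. -/
def totalUnit {k : ℕ} (i : Fin k) : (PowerSeries (L k))ˣ :=
  IsUnit.unit (a := PowerSeries.C (lmon (Pi.single i 1)) + PowerSeries.X * PowerSeries.C (lmon (Pi.single i 1) ^ 2)) (by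
    rw [PowerSeries.isUnit_iff_constantCoeff]
    simp only [map_add, map_mul, PowerSeries.constantCoeff_C, PowerSeries.constantCoeff_X, zero_mul, add_zero]
    refine IsUnit.of_mul_eq_one (lmon (Pi.single i (-1))) ?_
    rw [← lmon_add, ← Pi.single_add]; simp [lmon_zero])

/-- The extension of the total Steenrod square to Laurent polynomials: the ring homomorphism
`L_k → L_k⟦t⟧` with `x_i ↦ x_i + x_i^2 t` (so `Sq^j(x^m) = binom(m, j) x^{m+j}` for `m ∈ ℤ`). -/
def totalSqL (k : ℕ) : L k →ₐ[ZMod 2] PowerSeries (L k) :=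
  AddMonoidAlgebra.lift (ZMod 2) (PowerSeries (L k)) (Fin k → ℤ)
    { toFun := fun e => ((∏ i, totalUnit i ^ (e.toAdd i) : (PowerSeries (L k))ˣ) : PowerSeries (L k))
      map_one' := by simp
      map_mul' := fun e f => by
        simp [zpow_add, Finset.prod_mul_distrib] }

/-- The Steenrod square `Sq^j` on Laurent polynomials. -/
def SqL {k : ℕ} (j : ℕ) : L k →ₗ[ZMod 2] L k :=
  ((PowerSeries.coeff (R := L k) j).restrictScalars (ZMod 2)).comp (totalSqL k).toLinearMap

/-- The inclusion `P_k ⊆ L_k`. -/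
def toLaurent (k : ℕ) : P k →ₐ[ZMod 2] L k := MvPolynomial.aeval fun i => lmon (Pi.single i 1)

theorem totalSqL_var {k : ℕ} (i : Fin k) : totalSqL k (lmon (Pi.single i 1)) =
    PowerSeries.C (lmon (Pi.single i 1)) + PowerSeries.X * PowerSeries.C (lmon (Pi.single i 1) ^ 2) := by
  have : (∏ j, totalUnit j ^ ((Pi.single i 1 : Fin k → ℤ) j) : (PowerSeries (L k))ˣ) = totalUnit i := by
    rw [Finset.prod_eq_single i]
    · simp
    · intro b _ hb; simp [hb]
    · simp
  unfold totalSqL lmon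
  rw [AddMonoidAlgebra.lift_single, one_smul]
  exact (congrArg Units.val this).trans (IsUnit.unit_spec _)

theorem SqL_toLaurent {k : ℕ} (j : ℕ) (f : P k) : SqL j (toLaurent k f) = toLaurent k (Sq j f) := by
  have key : (totalSqL k).comp (toLaurent k) = (PowerSeries.mapAlgHom (toLaurent k)).comp (totalSq k) := by
    apply MvPolynomial.algHom_ext
    intro i
    have hX : totalSq k (MvPolynomial.X i) =
        PowerSeries.C (MvPolynomial.X i) + PowerSeries.X * PowerSeries.C (MvPolynomial.X i ^ 2) := by
      simp [totalSq]
    have hl : toLaurent k (MvPolynomial.X i) = lmon (Pi.single i 1) := by simp [toLaurent]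
    rw [AlgHom.comp_apply, AlgHom.comp_apply, hX, map_add, map_mul, mapAlgHom_C, mapAlgHom_X,
      mapAlgHom_C, map_pow, hl, totalSqL_var]
  have := congrArg (fun F => PowerSeries.coeff j (F f)) key
  simp only [AlgHom.comp_apply, coeff_mapAlgHom] at this
  exact this

theorem SqL_var_mul_zero {k : ℕ} (i : Fin k) (f : L k) :
    SqL 0 (lmon (Pi.single i 1) * f) = lmon (Pi.single i 1) * SqL 0 f := by
  simp only [SqL, LinearMap.comp_apply, AlgHom.toLinearMap_apply, map_mul, totalSqL_var, add_mul,
    map_add, LinearMap.coe_restrictScalars, PowerSeries.coeff_C_mul, mul_assoc,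
    PowerSeries.coeff_zero_X_mul, add_zero]

theorem exponent_induction {k : ℕ} {p : (Fin k → ℤ) → Prop} (h0 : p 0)
    (hmul : ∀ i e, p e → p (Pi.single i 1 + e))
    (hdiv : ∀ i e, p (Pi.single i 1 + e) → p e) (e : Fin k → ℤ) : p e := by
  have hz : ∀ (i : Fin k) (m : ℤ) (e : Fin k → ℤ), p e → p (Pi.single i m + e) := by
    intro i m e he
    induction m using Int.induction_on with
    | zero => simpa using he
    | succ n ih =>
      have := hmul i _ ih
      rwa [← add_assoc, ← Pi.single_add, add_comm (1 : ℤ)] at this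
    | pred n ih =>
      refine hdiv i _ ?_
      rwa [← add_assoc, ← Pi.single_add, show (1 : ℤ) + (-(n : ℤ) - 1) = -n by ring]
  have : ∀ s : Finset (Fin k), p (∑ i ∈ s, Pi.single i (e i)) := by
    intro s
    induction s using Finset.induction_on with
    | empty => simpa using h0
    | insert a s ha ih =>
      rw [Finset.sum_insert ha]
      exact hz _ _ _ ih
  have h := this Finset.univ
  rwa [Finset.univ_sum_single] at h

theorem laurent_induction {k : ℕ} {p : L k → Prop} (h0 : p 0) (h1 : p 1)
    (hadd : ∀ f g, p f → p g → p (f + g))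
    (hmul : ∀ i f, p f → p (lmon (Pi.single i 1) * f))
    (hdiv : ∀ i f, p (lmon (Pi.single i 1) * f) → p f) (f : L k) : p f := by
  have hmon : ∀ e : Fin k → ℤ, p (lmon e) := by
    intro e
    induction e using exponent_induction with
    | h0 => exact h1
    | hmul i e he => rw [lmon_add]; exact hmul i _ he
    | hdiv i e he => rw [lmon_add] at he; exact hdiv i _ he
  induction f using AddMonoidAlgebra.induction_linear with
  | zero => exact h0
  | add f g hf hg => exact hadd f g hf hg
  | single e c =>
    have hc : c = 0 ∨ c = 1 := by revert c; decide
    rcases hc with rfl | rfl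
    · simpa using h0
    · exact hmon e

theorem lmon_mul_cancel {k : ℕ} (i : Fin k) {f g : L k}
    (h : lmon (Pi.single i 1) * f = lmon (Pi.single i 1) * g) : f = g := by
  have := congrArg (fun z => lmon (Pi.single i (-1)) * z) h
  simpa only [← mul_assoc, ← lmon_add, ← Pi.single_add, neg_add_cancel, Pi.single_zero, lmon_zero,
    one_mul] using this

theorem SqL_zero {k : ℕ} (f : L k) : SqL 0 f = f := by
  induction f using laurent_induction with
  | h0 => simp
  | h1 => simp [SqL]
  | hadd f g hf hg => rw [map_add, hf, hg]
  | hmul i f hf => rw [SqL_var_mul_zero, hf]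
  | hdiv i f hf => 
    rw [SqL_var_mul_zero] at hf
    exact lmon_mul_cancel i hf

theorem SqL_one_pos {k : ℕ} (j : ℕ) (hj : 0 < j) : SqL j (1 : L k) = 0 := by
  simp [SqL, PowerSeries.coeff_one, hj.ne']

theorem SqL_var_mul {k : ℕ} (i : Fin k) (j : ℕ) (f : L k) : SqL (j + 1) (lmon (Pi.single i 1) * f) =
    lmon (Pi.single i 1) * SqL (j + 1) f + lmon (Pi.single i 1) ^ 2 * SqL j f := by
  simp only [SqL, LinearMap.comp_apply, AlgHom.toLinearMap_apply, map_mul, totalSqL_var, add_mul, map_add,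
    LinearMap.coe_restrictScalars, PowerSeries.coeff_C_mul, mul_assoc, PowerSeries.coeff_succ_X_mul]

/-- `Sq^j` on Laurent polynomials for `j ∈ ℤ`, zero for `j < 0`. -/
def qZ {k : ℕ} (j : ℤ) : L k →ₗ[ZMod 2] L k := if 0 ≤ j then SqL j.toNat else 0

theorem qZ_natCast {k : ℕ} (j : ℕ) : (qZ (j : ℤ) : L k →ₗ[ZMod 2] L k) = SqL j := by simp [qZ]

theorem qZ_of_neg {k : ℕ} {j : ℤ} (hj : j < 0) (f : L k) : qZ j f = 0 := by
  simp [qZ, not_le.mpr hj]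

theorem qZ_mul {k : ℕ} (i : Fin k) (j : ℤ) (f : L k) : qZ j (lmon (Pi.single i 1) * f) =
    lmon (Pi.single i 1) * qZ j f + lmon (Pi.single i 1) ^ 2 * qZ (j - 1) f := by
  rcases lt_or_ge j 0 with hj | hj
  · simp [qZ_of_neg hj, qZ_of_neg (show j - 1 < 0 by omega)]
  · obtain ⟨n, rfl⟩ := Int.eq_ofNat_of_zero_le hj
    cases n with
    | zero => simp [qZ, SqL_var_mul_zero]
    | succ n =>
      rw [show ((n + 1 : ℕ) : ℤ) - 1 = (n : ℕ) by push_cast; ring, qZ_natCast, qZ_natCast]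
      exact SqL_var_mul i n f

theorem qZ_sq_mul {k : ℕ} (i : Fin k) (j : ℤ) (f : L k) : qZ j (lmon (Pi.single i 1) ^ 2 * f) =
    lmon (Pi.single i 1) ^ 2 * qZ j f + lmon (Pi.single i 1) ^ 4 * qZ (j - 2) f := by
  rw [pow_two, mul_assoc, qZ_mul, qZ_mul, qZ_mul, show j - 1 - 1 = j - 2 by ring]
  have := ZModModule.add_self (lmon (Pi.single i 1) ^ 3 * qZ (j - 1) f)
  linear_combination this

/-- The binomial coefficients in the Adem relations. -/
def ademK (a b j : ℤ) : ZMod 2 :=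
  if 0 ≤ a - 2 * j then ((Ring.choose (b - 1 - j) (a - 2 * j).toNat : ℤ) : ZMod 2) else 0

theorem ademK_zero {a b j : ℤ} (h : a < 2 * j) : ademK a b j = 0 := by
  unfold ademK
  rw [if_neg (by omega)]

theorem ademK_shift (a b j : ℤ) : ademK a b (j + 1) = ademK (a - 2) (b - 1) j := by
  unfold ademK
  rw [show a - 2 * (j + 1) = a - 2 - 2 * j by ring, show b - 1 - (j + 1) = b - 1 - 1 - j by ring]

theorem ademK_pascal (a b j : ℤ) :
    ademK a b j + ademK (a - 2) (b - 1) j = ademK (a - 1) b j + ademK a (b - 1) j := by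
  rcases lt_or_ge (a - 2 * j) 0 with h | h
  · rw [ademK_zero, ademK_zero, ademK_zero, ademK_zero] <;> omega
  · obtain ⟨r, hr⟩ := Int.eq_ofNat_of_zero_le h
    obtain ⟨m, hm⟩ : ∃ m : ℤ, m = b - 2 - j := ⟨_, rfl⟩
    unfold ademK
    rw [show b - 1 - 1 - j = m by omega, show b - 1 - j = m + 1 by omega, hr]
    rcases r with _ | _ | r
    · rw [if_pos (by simp), if_neg (by omega), if_neg (by omega), if_pos (by simp)]
      simp
    · rw [if_pos (by simp), if_neg (by omega), if_pos (by omega), if_pos (by simp)]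
      rw [show (a - 1 - 2 * j).toNat = 0 by omega]
      simp [add_comm]
    · rw [if_pos (by omega), if_pos (by omega), if_pos (by omega), if_pos (by omega)]
      rw [show (a - 1 - 2 * j).toNat = r + 1 by omega, show (a - 2 - 2 * j).toNat = r by omega,
        show ((r + 1 + 1 : ℕ) : ℤ).toNat = r + 1 + 1 from rfl, Ring.choose_succ_succ,
        Ring.choose_succ_succ]
      push_cast
      generalize ((Ring.choose m r : ℤ) : ZMod 2) = u
      generalize ((Ring.choose m (r + 1) : ℤ) : ZMod 2) = v
      generalize ((Ring.choose m (r + 1 + 1) : ℤ) : ZMod 2) = w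
      revert u v w; decide

/-- The right hand side of the Adem relation, with integral indices. -/
def ademR {k : ℕ} (M : ℕ) (a b : ℤ) (f : L k) : L k :=
  ∑ j ∈ Finset.range M, ademK a b j • qZ (a + b - j) (qZ j f)

theorem ademL_mul {k : ℕ} (i : Fin k) (a b : ℤ) (f : L k) :
    qZ a (qZ b (lmon (Pi.single i 1) * f)) =
      lmon (Pi.single i 1) * qZ a (qZ b f) +
      lmon (Pi.single i 1) ^ 2 * (qZ (a - 1) (qZ b f) + qZ a (qZ (b - 1) f)) +
      lmon (Pi.single i 1) ^ 4 * qZ (a - 2) (qZ (b - 1) f) := by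
  rw [qZ_mul, map_add, qZ_mul, qZ_sq_mul]; ring

theorem ademR_mul {k : ℕ} (i : Fin k) (M : ℕ) (a b : ℤ) (hab : a < 2 * b) (hM : b < M) (f : L k) :
    ademR M a b (lmon (Pi.single i 1) * f) =
      lmon (Pi.single i 1) * ademR M a b f +
      lmon (Pi.single i 1) ^ 2 * (ademR M (a - 1) b f + ademR M a (b - 1) f) +
      lmon (Pi.single i 1) ^ 4 * ademR M (a - 2) (b - 1) f := by
  have hshift : ∀ c : ℤ, ∑ j ∈ Finset.range M, ademK a b j • qZ (c - j) (qZ ((j : ℤ) - 1) f) =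
      ∑ j ∈ Finset.range M, ademK (a - 2) (b - 1) j • qZ (c - 1 - j) (qZ j f) := by
    intro c
    rcases M with _ | M
    · simp
    rw [Finset.sum_range_succ', Finset.sum_range_succ]
    rw [qZ_of_neg (j := ((0 : ℕ) : ℤ) - 1) (by simp), map_zero, smul_zero,
      ademK_zero (j := (M : ℤ)) (by push_cast at hM; omega), zero_smul]
    congr 1
    refine Finset.sum_congr rfl fun j _ => ?_
    rw [← ademK_shift]
    push_cast
    rw [show c - (↑j + 1) = c - 1 - j by ring, show (j : ℤ) + 1 - 1 = j by ring]
  have h2 : ademR M (a - 1) b f + ademR M a (b - 1) f =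
      ∑ j ∈ Finset.range M, ademK a b j • qZ (a + b - 1 - j) (qZ j f) +
      ∑ j ∈ Finset.range M, ademK a b j • qZ (a + b - j) (qZ ((j : ℤ) - 1) f) := by
    rw [hshift, ← Finset.sum_add_distrib]
    unfold ademR
    rw [← Finset.sum_add_distrib]
    refine Finset.sum_congr rfl fun j _ => ?_
    rw [← add_smul, ademK_pascal, add_smul, show a - 1 + b - j = a + b - 1 - j by ring,
      show a + (b - 1) - j = a + b - 1 - j by ring]
  have h4 : ademR M (a - 2) (b - 1) f =
      ∑ j ∈ Finset.range M, ademK a b j • qZ (a + b - 2 - j) (qZ ((j : ℤ) - 1) f) := by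
    rw [hshift]
    unfold ademR
    refine Finset.sum_congr rfl fun j _ => ?_
    rw [show a - 2 + (b - 1) - j = a + b - 2 - 1 - (j : ℤ) by ring]
  rw [h2, h4]
  unfold ademR
  rw [mul_add, Finset.mul_sum, Finset.mul_sum, Finset.mul_sum, Finset.mul_sum,
    ← Finset.sum_add_distrib, ← Finset.sum_add_distrib, ← Finset.sum_add_distrib]
  refine Finset.sum_congr rfl fun j _ => ?_
  rw [ademL_mul]
  rw [show a + b - (j : ℤ) - 1 = a + b - 1 - j by ring, show a + b - (j : ℤ) - 2 = a + b - 2 - j by ring]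
  simp only [smul_add, mul_add, mul_smul_comm]

theorem adem_taut {k : ℕ} (M : ℕ) (a b : ℤ) (hb : 0 ≤ b) (h1 : 2 * b ≤ a) (h2 : a ≤ 2 * b + 1)
    (hM : b < M) (f : L k) : qZ a (qZ b f) = ademR M a b f := by
  obtain ⟨b, rfl⟩ := Int.eq_ofNat_of_zero_le hb
  unfold ademR
  rw [Finset.sum_eq_single b]
  · rw [show a + b - (b : ℤ) = a by ring]
    have : ademK a b b = 1 := by
      unfold ademK
      rw [if_pos (by omega), show (b : ℤ) - 1 - b = -1 by ring]
      rcases (show a = 2 * b ∨ a = 2 * b + 1 by omega) with h | h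
      · rw [show (a - 2 * (b : ℤ)).toNat = 0 by omega]; simp
      · rw [show (a - 2 * (b : ℤ)).toNat = 1 by omega]; simp
    rw [this, one_smul]
  · intro j _ hj
    rcases lt_or_gt_of_ne hj with h | h
    · have : ademK a b j = 0 := by
        unfold ademK
        rw [if_pos (by omega), show (b : ℤ) - 1 - j = ((b - 1 - j : ℕ) : ℤ) by omega]
        rw [Ring.choose_natCast, Nat.choose_eq_zero_of_lt (by omega)]
        simp
      rw [this, zero_smul]
    · rw [ademK_zero (by omega), zero_smul]
  · intro h
    simp at h; omega

theorem adem_int {k : ℕ} (M : ℕ) (f : L k) : ∀ a b : ℤ, 0 ≤ b → a ≤ 2 * b + 1 → b < M →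
    qZ a (qZ b f) = ademR M a b f := by
  have hneg : ∀ (f : L k) (a b : ℤ), a < 0 → qZ a (qZ b f) = ademR M a b f := by
    intro f a b ha
    rw [qZ_of_neg ha]
    symm
    refine Finset.sum_eq_zero fun j _ => ?_
    rw [ademK_zero (by omega), zero_smul]
  induction f using laurent_induction with
  | h0 => intro a b _ _ _; simp [ademR]
  | h1 =>
    intro a b hb hab hM
    rcases lt_or_ge a 0 with ha | ha
    · exact hneg _ _ _ ha
    have hq : ∀ j : ℤ, 0 < j → qZ j (1 : L k) = 0 := by
      intro j hj
      obtain ⟨j, rfl⟩ := Int.eq_ofNat_of_zero_le hj.le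
      rw [qZ_natCast]; exact SqL_one_pos j (by exact_mod_cast hj)
    rcases le_or_gt (2 * b) a with h | h
    · exact adem_taut M a b hb h hab hM 1
    rw [hq b (by omega), map_zero]
    symm
    refine Finset.sum_eq_zero fun j _ => ?_
    rcases Nat.eq_zero_or_pos j with rfl | hj
    · have : (qZ ((0 : ℕ) : ℤ) (1 : L k)) = 1 := by rw [qZ_natCast, SqL_zero]
      rw [this, hq _ (by push_cast; omega), smul_zero]
    · rw [hq j (by exact_mod_cast hj), map_zero, smul_zero]
  | hadd f g hf hg =>
    intro a b hb hab hM
    rw [map_add, map_add, hf a b hb hab hM, hg a b hb hab hM]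
    simp [ademR, Finset.sum_add_distrib]
  | hmul i f hf =>
    intro a b hb hab hM
    rcases le_or_gt (2 * b) a with h | h
    · exact adem_taut M a b hb h hab hM _
    rcases lt_or_ge a 0 with ha | ha
    · exact hneg _ _ _ ha
    rw [ademL_mul, ademR_mul i M a b h hM, hf a b hb hab hM, hf (a - 1) b hb (by omega) hM,
      hf a (b - 1) (by omega) (by omega) (by omega),
      hf (a - 2) (b - 1) (by omega) (by omega) (by omega)]
  | hdiv i f hf =>
    have key : ∀ N : ℕ, ∀ a b : ℤ, 0 ≤ b → a ≤ 2 * b + 1 → b < M → a + b < N →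
        qZ a (qZ b f) = ademR M a b f := by
      intro N
      induction N with
      | zero => intro a b hb _ _ h; exact hneg _ _ _ (by simp at h; omega)
      | succ N ih =>
        intro a b hb hab hM hN
        rcases le_or_gt (2 * b) a with h | h
        · exact adem_taut M a b hb h hab hM _
        rcases lt_or_ge a 0 with ha | ha
        · exact hneg _ _ _ ha
        have := hf a b hb hab hM
        push_cast at hN
        rw [ademL_mul, ademR_mul i M a b h hM, ih (a - 1) b hb (by omega) hM (by omega),
          ih a (b - 1) (by omega) (by omega) (by omega) (by omega),
          ih (a - 2) (b - 1) (by omega) (by omega) (by omega) (by omega)] at this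
        exact lmon_mul_cancel i (add_right_cancel (add_right_cancel this))
    intro a b hb hab hM
    exact key ((a + b).toNat + 1) a b hb hab hM (by push_cast; omega)

/-- The Adem relations hold on Laurent polynomials. -/
theorem SqL_adem {k : ℕ} (a b : ℕ) (hab : a < 2 * b) (f : L k) :
    SqL a (SqL b f) = ∑ j ∈ Finset.range (a / 2 + 1),
      ((b - 1 - j).choose (a - 2 * j) : ZMod 2) • SqL (a + b - j) (SqL j f) := by
  have := adem_int (b + 1) f a b (by simp) (by omega) (by push_cast; omega)
  rw [qZ_natCast, qZ_natCast] at this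
  rw [this]
  unfold ademR
  symm
  rw [← Finset.sum_subset (Finset.range_subset_range.mpr (show a / 2 + 1 ≤ b + 1 by omega))]
  · refine Finset.sum_congr rfl fun j hj => ?_
    have hj' : 2 * j ≤ a := by simp at hj; omega
    unfold ademK
    rw [if_pos (by omega), show (b : ℤ) - 1 - j = ((b - 1 - j : ℕ) : ℤ) by omega,
      show ((a : ℤ) - 2 * j).toNat = a - 2 * j by omega, Ring.choose_natCast, qZ_natCast,
      show (a : ℤ) + b - j = ((a + b - j : ℕ) : ℤ) by omega, qZ_natCast]
    simp
  · intro j _ hj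
    simp at hj
    rw [ademK_zero (by omega), zero_smul]


/-! ### The Steenrod algebra -/

/-- The defining relations of the mod 2 Steenrod algebra: `Sq^0 = 1` and the Adem relations
`Sq^a Sq^b = ∑_j binom(b-1-j, a-2j) Sq^{a+b-j} Sq^j` for `0 < a < 2b`. -/
inductive AdemRel : FreeAlgebra (ZMod 2) ℕ → FreeAlgebra (ZMod 2) ℕ → Prop
  | sq_zero : AdemRel (FreeAlgebra.ι (ZMod 2) 0) 1
  | adem (a b : ℕ) (ha : 0 < a) (hab : a < 2 * b) :
      AdemRel (FreeAlgebra.ι (ZMod 2) a * FreeAlgebra.ι (ZMod 2) b)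
        (∑ j ∈ Finset.range (a / 2 + 1), ((b - 1 - j).choose (a - 2 * j) : ZMod 2) •
          (FreeAlgebra.ι (ZMod 2) (a + b - j) * FreeAlgebra.ι (ZMod 2) j))

/-- The mod 2 Steenrod algebra `𝒜`: generators `Sq^i` subject to the Adem relations. -/
abbrev A : Type := RingQuot AdemRel

/-- The generator `Sq^i ∈ 𝒜`. -/
def sqA (i : ℕ) : A := RingQuot.mkAlgHom (ZMod 2) AdemRel (FreeAlgebra.ι (ZMod 2) i)

/-- The augmentation `ε : 𝒜 → F_2`. -/
def aug : A →ₐ[ZMod 2] ZMod 2 :=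
  RingQuot.liftAlgHom (ZMod 2)
    ⟨FreeAlgebra.lift (ZMod 2) (fun i : ℕ => if i = 0 then (1 : ZMod 2) else 0), by
      intro x y h
      cases h with
      | sq_zero => simp
      | adem a b ha hab =>
        simp only [map_mul, FreeAlgebra.lift_ι_apply, map_sum, map_smul, if_neg ha.ne', zero_mul]
        symm
        refine Finset.sum_eq_zero fun j hj => ?_
        simp only [Finset.mem_range] at hj
        rw [if_neg (by omega), zero_mul, smul_zero]⟩

/-- The action of `𝒜` on Laurent polynomials. -/
def lact (k : ℕ) : A →ₐ[ZMod 2] Module.End (ZMod 2) (L k) :=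
  RingQuot.liftAlgHom (ZMod 2)
    ⟨FreeAlgebra.lift (ZMod 2) (fun i : ℕ => (SqL i : Module.End (ZMod 2) (L k))), by
      intro x y h
      cases h with
      | sq_zero =>
        rw [FreeAlgebra.lift_ι_apply, map_one]
        exact LinearMap.ext fun f => SqL_zero f
      | adem a b ha hab =>
        simp only [map_mul, FreeAlgebra.lift_ι_apply, map_sum, map_smul]
        refine LinearMap.ext fun f => ?_
        rw [LinearMap.sum_apply]
        exact SqL_adem a b hab f⟩

theorem lact_sqA {k : ℕ} (i : ℕ) : lact k (sqA i) = SqL i := by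
  simp [lact, sqA, RingQuot.liftAlgHom_mkAlgHom_apply]

theorem aug_sqA (i : ℕ) : aug (sqA i) = if i = 0 then 1 else 0 := by
  simp [aug, sqA, RingQuot.liftAlgHom_mkAlgHom_apply]

theorem sqA_adem (a b : ℕ) (ha : 0 < a) (hab : a < 2 * b) : sqA a * sqA b =
    ∑ j ∈ Finset.range (a / 2 + 1),
      ((b - 1 - j).choose (a - 2 * j) : ZMod 2) • (sqA (a + b - j) * sqA j) := by
  have := RingQuot.mkAlgHom_rel (ZMod 2) (AdemRel.adem a b ha hab)
  simpa [sqA] using this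

theorem sqA_zero : sqA 0 = 1 := by
  have := RingQuot.mkAlgHom_rel (ZMod 2) AdemRel.sq_zero
  simpa [sqA] using this

theorem A_induction {p : A → Prop} (h0 : p 0) (h1 : p 1) (hsq : ∀ i, p (sqA i))
    (hadd : ∀ a b, p a → p b → p (a + b)) (hmul : ∀ a b, p a → p b → p (a * b)) (a : A) : p a := by
  obtain ⟨x, rfl⟩ := RingQuot.mkAlgHom_surjective (ZMod 2) AdemRel a
  induction x using FreeAlgebra.induction with
  | grade0 r =>
    have hr : r = 0 ∨ r = 1 := by revert r; decide
    rcases hr with rfl | rfl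
    · simpa using h0
    · simpa using h1
  | grade1 i => exact hsq i
  | mul a b ha hb => rw [map_mul]; exact hmul _ _ ha hb
  | add a b ha hb => rw [map_add]; exact hadd _ _ ha hb

/-- The homogeneous elements of degree `d` of `𝒜`. -/
def Adeg (d : ℕ) : Submodule (ZMod 2) A :=
  Submodule.span (ZMod 2) {a | ∃ l : List ℕ, l.sum = d ∧ a = (l.map sqA).prod}

theorem Adeg_mul {i j : ℕ} {a b : A} (ha : a ∈ Adeg i) (hb : b ∈ Adeg j) : a * b ∈ Adeg (i + j) := by
  induction ha using Submodule.span_induction with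
  | mem a ha =>
    obtain ⟨l, hl, rfl⟩ := ha
    induction hb using Submodule.span_induction with
    | mem b hb =>
      obtain ⟨m, hm, rfl⟩ := hb
      exact Submodule.subset_span ⟨l ++ m, by simp [hl, hm], by simp⟩
    | zero => simp
    | add x y _ _ hx hy => rw [mul_add]; exact add_mem hx hy
    | smul c x _ hx => rw [mul_smul_comm]; exact Submodule.smul_mem _ _ hx
  | zero => simp
  | add x y _ _ hx hy => rw [add_mul]; exact add_mem hx hy
  | smul c x _ hx => rw [smul_mul_assoc]; exact Submodule.smul_mem _ _ hx

theorem aug_Adeg {d : ℕ} (hd : d ≠ 0) {a : A} (ha : a ∈ Adeg d) : aug a = 0 := by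
  induction ha using Submodule.span_induction with
  | mem a ha =>
    obtain ⟨l, hl, rfl⟩ := ha
    induction l generalizing d with
    | nil => simp at hl; omega
    | cons i l ih =>
      rw [List.map_cons, List.prod_cons, map_mul, aug_sqA]
      rcases Nat.eq_zero_or_pos i with rfl | hi
      · rw [ih hd (by simpa using hl), mul_zero]
      · rw [if_neg hi.ne', zero_mul]
  | zero => simp
  | add x y _ _ hx hy => rw [map_add, hx, hy, add_zero]
  | smul c x _ hx => rw [map_smul, hx, smul_zero]

/-! ### The bar complex -/

/-- The part `∑_i f(a_1, …, a_i a_{i+1}, …, a_n) + f(a_1, …, a_{n-1}) ε(a_n)` of the bar differential.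
A bar cochain is a function of finite sequences `(a_1, …, a_n)` of elements of `𝒜`. -/
def barAux {M : Type} [AddCommGroup M] [Module (ZMod 2) M] : (List A → M) → List A → M
  | _, [] => 0
  | f, [a] => aug a • f []
  | f, a :: b :: l => f ((a * b) :: l) + barAux (fun m => f (a :: m)) (b :: l)

/-- The differential of the bar complex computing `Ext_𝒜(F_2, M)`:
`(d f)(a_1, …, a_n) = a_1 f(a_2, …, a_n) + ∑_i f(a_1, …, a_i a_{i+1}, …, a_n)
  + f(a_1, …, a_{n-1}) ε(a_n)`. -/
def barD {M : Type} [AddCommGroup M] [Module (ZMod 2) M] (ρ : A →ₐ[ZMod 2] Module.End (ZMod 2) M)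
    (f : List A → M) : List A → M
  | [] => 0
  | a :: l => ρ a (f l) + barAux f (a :: l)

/-- Additivity in each argument; over `F_2` this is multilinearity. -/
def MultiAdd {M : Type} [AddCommGroup M] (f : List A → M) : Prop :=
  ∀ (l₁ l₂ : List A) (a b : A), f (l₁ ++ (a + b) :: l₂) = f (l₁ ++ a :: l₂) + f (l₁ ++ b :: l₂)

theorem MultiAdd.cons {M : Type} [AddCommGroup M] {f : List A → M} (hf : MultiAdd f) (a : A) : MultiAdd (fun m => f (a :: m)) :=
  fun l₁ l₂ x y => hf (a :: l₁) l₂ x y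

section bar
variable {M N : Type} [AddCommGroup M] [Module (ZMod 2) M] [AddCommGroup N] [Module (ZMod 2) N]

theorem barAux_add (f g : List A → M) (l : List A) :
    barAux (fun m => f m + g m) l = barAux f l + barAux g l := by
  induction l generalizing f g with
  | nil => simp [barAux]
  | cons a l ih =>
    cases l with
    | nil => simp [barAux]
    | cons b l => simp only [barAux, ih]; abel

theorem barAux_map (φ : M →ₗ[ZMod 2] N) (f : List A → M) (l : List A) :
    barAux (fun m => φ (f m)) l = φ (barAux f l) := by
  induction l generalizing f with
  | nil => simp [barAux]
  | cons a l ih =>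
    cases l with
    | nil => simp [barAux]
    | cons b l => simp only [barAux, ih, map_add]

theorem barAux_zero (l : List A) : barAux (fun _ => (0 : M)) l = 0 := by
  induction l with
  | nil => simp [barAux]
  | cons a l ih =>
    cases l with
    | nil => simp [barAux]
    | cons b l => simp only [barAux, ih, add_zero]

theorem barD_add (ρ : A →ₐ[ZMod 2] Module.End (ZMod 2) M) (f g : List A → M) :
    barD ρ (f + g) = barD ρ f + barD ρ g := by
  funext l
  cases l with
  | nil => simp [barD]
  | cons a l =>
    have := barAux_add f g (a :: l)
    simp only [barD, Pi.add_apply, map_add]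
    rw [show (f + g : List A → M) = fun m => f m + g m from rfl, this]; abel

theorem barD_smul (ρ : A →ₐ[ZMod 2] Module.End (ZMod 2) M) (c : ZMod 2) (f : List A → M) :
    barD ρ (c • f) = c • barD ρ f := by
  have hc : c = 0 ∨ c = 1 := by revert c; decide
  rcases hc with rfl | rfl
  · rw [zero_smul, zero_smul]
    funext l
    cases l with
    | nil => simp [barD]
    | cons a l =>
      have := barAux_zero (M := M) (a :: l)
      simp only [barD, Pi.zero_apply, map_zero, zero_add]
      exact this
  · rw [one_smul, one_smul]

theorem barAux_barAux (f : List A → M) (l : List A) : barAux (barAux f) l = 0 := by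
  induction l generalizing f with
  | nil => simp [barAux]
  | cons a l ih =>
    cases l with
    | nil => simp [barAux]
    | cons b l =>
      cases l with
      | nil =>
        simp only [barAux, map_mul]
        rw [mul_comm, mul_smul]
        exact ZModModule.add_self (aug b • aug a • f [])
      | cons c l =>
        have e1 : (fun m => barAux f (a :: m)) =
            fun m => (match m with | [] => aug a • f [] | c :: m => f ((a * c) :: m)) +
              barAux (fun m => f (a :: m)) m := by
          funext m
          cases m <;> simp [barAux]
        rw [barAux, e1, barAux_add, ih (fun m => f (a :: m))]
        simp only [barAux, mul_assoc, add_zero]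
        exact ZModModule.add_self _

theorem barD_barD (ρ : A →ₐ[ZMod 2] Module.End (ZMod 2) M) (f : List A → M) :
    barD ρ (barD ρ f) = 0 := by
  funext l
  cases l with
  | nil => simp [barD]
  | cons a l =>
    have e1 : barD ρ f = fun m => (match m with | [] => 0 | c :: m => ρ c (f m)) + barAux f m := by
      funext m
      cases m <;> simp [barD, barAux]
    rw [barD, e1, barAux_add, barAux_barAux, add_zero, ← e1]
    cases l with
    | nil => simp [barAux, barD]
    | cons b l =>
      have := barAux_map (ρ a) f (b :: l)
      simp only [barAux, barD, this, map_add, map_mul, Module.End.mul_apply, Pi.zero_apply]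
      have h := ZModModule.add_self (ρ a (ρ b (f l)))
      have h' := ZModModule.add_self (ρ a (barAux f (b :: l)))
      calc _ = (ρ a (ρ b (f l)) + ρ a (ρ b (f l))) + (ρ a (barAux f (b :: l)) + ρ a (barAux f (b :: l))) := by abel
        _ = 0 := by rw [h, h', add_zero]

theorem MultiAdd.barAux {f : List A → M} (hf : MultiAdd f) : MultiAdd (barAux f) := by
  intro l₁
  induction l₁ generalizing f with
  | nil =>
    intro l₂ a b
    cases l₂ with
    | nil => simp [Singer.barAux, add_smul]
    | cons c l =>
      have h1 := hf [] l (a * c) (b * c)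
      have h2 : (fun m => f ((a + b) :: m)) = fun m => f (a :: m) + f (b :: m) :=
        funext fun m => hf [] m a b
      simp only [List.nil_append] at h1 ⊢
      rw [Singer.barAux, add_mul, h1, h2, barAux_add, Singer.barAux, Singer.barAux]
      abel
  | cons c l₁ ih =>
    intro l₂ a b
    have := ih (hf.cons c) l₂ a b
    cases l₁ with
    | nil =>
      have h1 := hf [] l₂ (c * a) (c * b)
      simp only [List.nil_append, List.cons_append] at h1 this ⊢
      rw [Singer.barAux, this, mul_add, h1, Singer.barAux, Singer.barAux]
      abel
    | cons d l₁ =>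
      have h1 := hf ((c * d) :: l₁) l₂ a b
      simp only [List.cons_append] at h1 this ⊢
      rw [Singer.barAux, this, h1, Singer.barAux, Singer.barAux]
      abel

theorem MultiAdd.barD {f : List A → M} (hf : MultiAdd f)
    (ρ : A →ₐ[ZMod 2] Module.End (ZMod 2) M) : MultiAdd (barD ρ f) := by
  intro l₁ l₂ a b
  have h := hf.barAux l₁ l₂ a b
  cases l₁ with
  | nil =>
    simp only [List.nil_append, Singer.barD] at h ⊢
    rw [h, map_add, LinearMap.add_apply]; abel
  | cons c l₁ =>
    have h1 := hf l₁ l₂ a b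
    simp only [List.cons_append, Singer.barD] at h ⊢
    rw [h, h1, map_add]; abel

theorem barAux_length {f : List A → M} {n : ℕ} (hf : ∀ l, l.length ≠ n → f l = 0) (l : List A)
    (hl : l.length ≠ n + 1) : barAux f l = 0 := by
  induction l generalizing f n with
  | nil => rfl
  | cons a l ih =>
    cases l with
    | nil => rw [barAux, hf [] (by simpa [eq_comm] using hl), smul_zero]
    | cons b l =>
      rw [barAux, hf _ (by simpa using hl), zero_add]
      rcases n with _ | n
      · have : (fun m => f (a :: m)) = fun _ => 0 := funext fun m => hf _ (by simp)
        rw [this, barAux_zero]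
      · exact ih (n := n) (fun m hm => hf _ (by simpa using hm)) (by simpa using hl)

theorem barD_length (ρ : A →ₐ[ZMod 2] Module.End (ZMod 2) M) {f : List A → M} {n : ℕ}
    (hf : ∀ l, l.length ≠ n → f l = 0) (l : List A) (hl : l.length ≠ n + 1) : barD ρ f l = 0 := by
  cases l with
  | nil => rfl
  | cons a l => rw [barD, barAux_length hf _ hl, hf l (by simpa using hl), map_zero, add_zero]

/-- `Homog [a_1, …, a_n] [d_1, …, d_n]` : each `a_i` is homogeneous of degree `d_i`. -/
def Homog (l : List A) (ds : List ℕ) : Prop := List.Forall₂ (fun a d => a ∈ Adeg d) l ds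

theorem barAux_degree (G : ℤ → Submodule (ZMod 2) M) {f : List A → M} {c : ℤ}
    (hf : ∀ l ds, Homog l ds → f l ∈ G (ds.sum + c)) (l : List A) (ds : List ℕ)
    (h : Homog l ds) : barAux f l ∈ G (ds.sum + c) := by
  induction l generalizing f c ds with
  | nil => exact zero_mem _
  | cons a l ih =>
    cases h with
    | cons ha hl =>
    rename_i d ds
    cases l with
    | nil =>
      cases hl
      rw [barAux]
      by_cases hd : d = 0
      · subst hd
        exact Submodule.smul_mem _ _ (by simpa using hf [] [] List.Forall₂.nil)
      · rw [aug_Adeg hd ha, zero_smul]; exact zero_mem _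
    | cons b l =>
      rw [barAux]
      refine add_mem ?_ ?_
      · cases hl with
        | cons hb hl =>
        rename_i d' ds
        have := hf ((a * b) :: l) ((d + d') :: ds) (List.Forall₂.cons (Adeg_mul ha hb) hl)
        simpa [add_assoc] using this
      · have := ih (f := fun m => f (a :: m)) (c := d + c) (fun m es hm => by
          have := hf (a :: m) (d :: es) (List.Forall₂.cons ha hm)
          rw [List.sum_cons] at this
          rwa [show (es.sum : ℤ) + (d + c) = ((d + es.sum : ℕ) : ℤ) + c by push_cast; ring]) ds hl
        rw [List.sum_cons]
        rwa [show ((d + ds.sum : ℕ) : ℤ) + c = (ds.sum : ℤ) + (d + c) by push_cast; ring]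

end bar

/-! ### Singer's transfer -/

/-- Extension of exponents by `0`. -/
def snocHom (k : ℕ) : (Fin k → ℤ) →+ (Fin (k + 1) → ℤ) where
  toFun e := Fin.snoc (α := fun _ => ℤ) e 0
  map_zero' := by
    funext i
    refine Fin.lastCases ?_ (fun i => ?_) i <;> simp
  map_add' e f := by
    funext i
    refine Fin.lastCases ?_ (fun i => ?_) i <;> simp

/-- The inclusion `L_k ⊆ L_{k+1}`. -/
def incl (k : ℕ) : L k →ₐ[ZMod 2] L (k + 1) :=
  AddMonoidAlgebra.mapDomainAlgHom (ZMod 2) (ZMod 2) (snocHom k)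

/-- The `F_2`-linear map `f ↦ x_{k+1}^{-1} f`, `L_k → L_{k+1}`. Restricted to `P_k` it is the linear
section of `P̂_1 ⊗ P_k → Σ^{-1} P_k`, where `P̂_1 ⊆ F_2[x, x^{-1}]` is spanned by `x^i`, `i ≥ -1`. -/
def lift (k : ℕ) : L k →ₗ[ZMod 2] L (k + 1) :=
  (LinearMap.mulLeft (ZMod 2) (lmon (Pi.single (Fin.last k) (-1)))).comp (incl k).toLinearMap

/-- The bar cocycle representing Singer's class `e_k ∈ Ext^k_𝒜(Σ^{-k} F_2, P_k)`. One has `e_0 = 1`,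
and `e_{k+1}` is the image of `e_k` under the connecting homomorphism (the product with `e_1`) of
`0 → P_1 ⊗ P_k → P̂_1 ⊗ P_k → Σ^{-1} P_k → 0`: lift the cocycle to `P̂_1 ⊗ P_k`, then apply the bar
differential. The values are polynomials, see `singerClass_polys`. -/
def singerClass : (k : ℕ) → List A → L k
  | 0 => fun l => match l with
    | [] => 1
    | _ :: _ => 0
  | k + 1 => barD (lact (k + 1)) (fun l => lift k (singerClass k l))

/-- The linear projection `L_k → P_k` which is the identity on `P_k` and kills the monomials with a
negative exponent. -/
def fromLaurent (k : ℕ) : L k →ₗ[ZMod 2] P k :=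
  (Finsupp.linearCombination (ZMod 2) (fun e : Fin k → ℤ =>
    if ∀ i, 0 ≤ e i then
      (MvPolynomial.monomial (Finsupp.equivFunOnFinite.symm fun i => (e i).toNat) 1 : P k)
    else 0)).comp (AddMonoidAlgebra.coeffLinearEquiv (R := ZMod 2) (S := ZMod 2)
      (M := Fin k → ℤ)).toLinearMap

theorem fromLaurent_lmon {k : ℕ} (e : Fin k → ℤ) : fromLaurent k (lmon e) =
    if ∀ i, 0 ≤ e i then
      (MvPolynomial.monomial (Finsupp.equivFunOnFinite.symm fun i => (e i).toNat) 1 : P k)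
    else 0 := by
  simp [fromLaurent, lmon, AddMonoidAlgebra.coeffLinearEquiv]

theorem toLaurent_monomial {k : ℕ} (m : Fin k →₀ ℕ) :
    toLaurent k (MvPolynomial.monomial m 1) = lmon fun i => (m i : ℤ) := by
  induction m using Finsupp.induction_linear with
  | zero => exact map_one _
  | add a b ha hb =>
    rw [show (MvPolynomial.monomial (a + b) 1 : P k) =
      MvPolynomial.monomial a 1 * MvPolynomial.monomial b 1 by simp [MvPolynomial.monomial_mul],
      map_mul, ha, hb, ← lmon_add]
    rfl
  | single i n =>
    rw [← MvPolynomial.X_pow_eq_monomial, map_pow]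
    have hx : toLaurent k (MvPolynomial.X i) = lmon (Pi.single i 1) := by simp [toLaurent]
    rw [hx]
    induction n with
    | zero =>
      rw [pow_zero, ← lmon_zero]; congr 1; funext j; simp
    | succ n ih =>
      rw [pow_succ, ih, ← lmon_add]
      congr 1
      funext j
      by_cases hj : j = i
      · subst hj; simp
      · simp [hj, Finsupp.single_apply, Ne.symm hj]

theorem fromLaurent_toLaurent {k : ℕ} (p : P k) : fromLaurent k (toLaurent k p) = p := by
  induction p using MvPolynomial.induction_on' with
  | monomial m c =>
    have hc : c = 0 ∨ c = 1 := by revert c; decide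
    rcases hc with rfl | rfl
    · simp
    · rw [toLaurent_monomial, fromLaurent_lmon, if_pos (by simp)]
      congr 1
      ext i
      simp
  | add p q hp hq => rw [map_add, map_add, hp, hq]

theorem incl_var {k : ℕ} (i : Fin k) :
    incl k (lmon (Pi.single i 1)) = lmon (Pi.single i.castSucc 1) := by
  have : snocHom k (Pi.single i 1) = Pi.single i.castSucc 1 := by
    funext j
    refine Fin.lastCases ?_ (fun j => ?_) j
    · have : i.castSucc ≠ Fin.last k := (Fin.castSucc_lt_last i).ne
      simp [snocHom, this.symm]
    · simp [snocHom, Pi.single_apply]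
  rw [← this]
  simp [incl, lmon]

theorem incl_lmon {k : ℕ} (e : Fin k → ℤ) : incl k (lmon e) = lmon (snocHom k e) := by
  simp [incl, lmon]

theorem SqL_incl {k : ℕ} (j : ℕ) (f : L k) : SqL j (incl k f) = incl k (SqL j f) := by
  induction f using laurent_induction generalizing j with
  | h0 => simp
  | h1 =>
    rw [map_one]
    rcases Nat.eq_zero_or_pos j with rfl | hj
    · simp [SqL_zero]
    · rw [SqL_one_pos j hj, SqL_one_pos j hj, map_zero]
  | hadd f g hf hg => simp only [map_add, hf, hg]
  | hmul i f hf =>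
    rw [map_mul, incl_var]
    cases j with
    | zero => rw [SqL_zero, SqL_zero, map_mul, incl_var]
    | succ j => rw [SqL_var_mul, SqL_var_mul, map_add, map_mul, map_mul, map_pow, incl_var, hf, hf]
  | hdiv i f hf =>
    induction j with
    | zero => rw [SqL_zero, SqL_zero]
    | succ j ih =>
      have := hf (j + 1)
      rw [map_mul, incl_var, SqL_var_mul, SqL_var_mul, map_add, map_mul, map_mul, map_pow, incl_var,
        ih] at this
      exact lmon_mul_cancel _ (add_right_cancel this)

/-- `P_k` as a subspace of `L_k`. -/
def polys (k : ℕ) : Submodule (ZMod 2) (L k) := LinearMap.range (toLaurent k).toLinearMap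

theorem lact_polys {k : ℕ} (a : A) {f : L k} (hf : f ∈ polys k) : lact k a f ∈ polys k := by
  induction a using A_induction generalizing f with
  | h0 => rw [map_zero]; exact zero_mem _
  | h1 => rw [map_one]; exact hf
  | hsq i =>
    obtain ⟨p, rfl⟩ := hf
    rw [lact_sqA]
    exact ⟨Sq i p, (SqL_toLaurent i p).symm⟩
  | hadd a b ha hb => rw [map_add]; exact add_mem (ha hf) (hb hf)
  | hmul a b ha hb => rw [map_mul]; exact ha (hb hf)

theorem incl_polys {k : ℕ} {f : L k} (hf : f ∈ polys k) : incl k f ∈ polys (k + 1) := by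
  obtain ⟨p, rfl⟩ := hf
  have : (incl k).comp (toLaurent k) =
      (toLaurent (k + 1)).comp (MvPolynomial.rename (R := ZMod 2) Fin.castSucc) := by
    apply MvPolynomial.algHom_ext
    intro i
    simp [toLaurent, incl_var]
  exact ⟨MvPolynomial.rename Fin.castSucc p, (congrArg (fun F => F p) this).symm⟩

theorem var_mul_polys {k : ℕ} (i : Fin k) {f : L k} (hf : f ∈ polys k) :
    lmon (Pi.single i 1) * f ∈ polys k := by
  obtain ⟨p, rfl⟩ := hf
  exact ⟨MvPolynomial.X i * p, by simp [toLaurent]⟩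

theorem var_mul_lift {k : ℕ} (f : L k) :
    lmon (Pi.single (Fin.last k) 1) * lift k f = incl k f := by
  simp only [lift, LinearMap.comp_apply, LinearMap.mulLeft_apply, AlgHom.toLinearMap_apply]
  rw [← mul_assoc, ← lmon_add, ← Pi.single_add, add_neg_cancel, Pi.single_zero, lmon_zero, one_mul]

theorem SqL_lift_polys {k : ℕ} (j : ℕ) {f : L k} (hf : f ∈ polys k) :
    SqL j (lift k f) + lift k (SqL j f) ∈ polys (k + 1) := by
  induction j with
  | zero =>
    rw [SqL_zero, SqL_zero, ZModModule.add_self]; exact zero_mem _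
  | succ j ih =>
    have h1 := SqL_var_mul (Fin.last k) j (lift k f)
    rw [var_mul_lift, SqL_incl, ← var_mul_lift] at h1
    have h2 : SqL (j + 1) (lift k f) + lift k (SqL (j + 1) f) =
        lmon (Pi.single (Fin.last k) 1) * SqL j (lift k f) := by
      apply lmon_mul_cancel (Fin.last k)
      rw [mul_add, h1, ← mul_assoc, ← pow_two, ← add_assoc, ZModModule.add_self, zero_add]
    rw [h2]
    have h3 : lmon (Pi.single (Fin.last k) 1) * SqL j (lift k f) =
        lmon (Pi.single (Fin.last k) 1) * (SqL j (lift k f) + lift k (SqL j f)) +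
          incl k (SqL j f) := by
      rw [mul_add, var_mul_lift, add_assoc, ZModModule.add_self, add_zero]
    rw [h3]
    refine add_mem (var_mul_polys _ ih) (incl_polys ?_)
    have := lact_polys (sqA j) hf
    rwa [lact_sqA] at this

theorem lact_lift_polys {k : ℕ} (a : A) {f : L k} (hf : f ∈ polys k) :
    lact (k + 1) a (lift k f) + lift k (lact k a f) ∈ polys (k + 1) := by
  induction a using A_induction generalizing f with
  | h0 => simp
  | h1 => simp only [map_one, Module.End.one_apply]; rw [ZModModule.add_self]; exact zero_mem _
  | hsq i => rw [lact_sqA, lact_sqA]; exact SqL_lift_polys i hf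
  | hadd a b ha hb =>
    have := add_mem (ha hf) (hb hf)
    simp only [map_add, LinearMap.add_apply]
    convert this using 1
    abel
  | hmul a b ha hb =>
    have h1 := lact_polys a (hb hf)
    have h2 := ha (lact_polys b hf)
    have := add_mem h1 h2
    simp only [map_mul, Module.End.mul_apply]
    convert this using 1
    rw [map_add, add_assoc, ← add_assoc (lact (k + 1) a (lift k (lact k b f))), ZModModule.add_self,
      zero_add]

theorem lact_one {k : ℕ} (hk : k = 0) (a : A) (f : L k) : lact k a f = aug a • f := by
  subst hk
  have hf : f = 0 ∨ f = 1 := by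
    induction f using laurent_induction with
    | h0 => simp
    | h1 => simp
    | hadd f g hf hg =>
      rcases hf with rfl | rfl <;> rcases hg with rfl | rfl
      · simp
      · simp
      · simp
      · left; exact ZModModule.add_self _
    | hmul i => exact i.elim0
    | hdiv i => exact i.elim0
  rcases hf with rfl | rfl
  · simp
  · induction a using A_induction with
    | h0 => simp
    | h1 => simp
    | hsq i =>
      rw [lact_sqA, aug_sqA]
      rcases Nat.eq_zero_or_pos i with rfl | hi
      · simp [SqL_zero]
      · rw [SqL_one_pos i hi, if_neg hi.ne', zero_smul]
    | hadd a b ha hb => rw [map_add, map_add, LinearMap.add_apply, ha, hb, add_smul]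
    | hmul a b ha hb =>
      rw [map_mul, map_mul, Module.End.mul_apply, hb, map_smul, ha, smul_smul, mul_comm]

theorem singerClass_cocycle (k : ℕ) : barD (lact k) (singerClass k) = 0 := by
  cases k with
  | succ k => exact barD_barD _ _
  | zero =>
    funext l
    match l with
    | [] => rfl
    | [a] =>
      simp only [barD, barAux, singerClass, Pi.zero_apply]
      rw [lact_one rfl]
      exact ZModModule.add_self _
    | a :: b :: l =>
      have := barAux_zero (M := L 0) (b :: l)
      simp only [barD, barAux, singerClass, map_zero, Pi.zero_apply, zero_add]
      exact this

theorem singerClass_length (k : ℕ) (l : List A) (hl : l.length ≠ k) : singerClass k l = 0 := by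
  induction k generalizing l with
  | zero => cases l with
    | nil => simp at hl
    | cons a l => rfl
  | succ k ih => exact barD_length _ (fun m hm => by rw [ih m hm, map_zero]) l hl

theorem singerClass_multiAdd (k : ℕ) : MultiAdd (singerClass k) := by
  induction k with
  | zero =>
    intro l₁ l₂ a b
    cases l₁ <;> simp [singerClass]
  | succ k ih =>
    refine MultiAdd.barD (fun l₁ l₂ a b => ?_) _
    rw [ih, map_add]

theorem singerClass_polys (k : ℕ) (l : List A) : singerClass k l ∈ polys k := by
  induction k generalizing l with
  | zero =>
    cases l with
    | nil => exact ⟨1, map_one (toLaurent 0)⟩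
    | cons a l => exact zero_mem _
  | succ k ih =>
    cases l with
    | nil => exact zero_mem _
    | cons a l =>
      have h := congrFun (singerClass_cocycle k) (a :: l)
      have h' : lact k a (singerClass k l) = barAux (singerClass k) (a :: l) := by
        rw [← add_zero (barAux _ _), ← ZModModule.add_self (lact k a (singerClass k l)), ← add_assoc,
          add_comm (barAux _ _)]
        simp only [barD, Pi.zero_apply] at h
        rw [h, zero_add]
      simp only [singerClass, barD]
      rw [barAux_map, ← h']
      exact lact_lift_polys a (ih l)

/-- Laurent polynomials that are homogeneous of degree `m`. -/
def Ldeg (k : ℕ) (m : ℤ) : Submodule (ZMod 2) (L k) :=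
  Submodule.span (ZMod 2) {f | ∃ e : Fin k → ℤ, ∑ i, e i = m ∧ f = lmon e}

theorem Ldeg_cast {k : ℕ} {m n : ℤ} (h : m = n) {f : L k} (hf : f ∈ Ldeg k m) : f ∈ Ldeg k n :=
  h ▸ hf

theorem Ldeg_mul {k : ℕ} {m n : ℤ} {f g : L k} (hf : f ∈ Ldeg k m) (hg : g ∈ Ldeg k n) :
    f * g ∈ Ldeg k (m + n) := by
  induction hf using Submodule.span_induction with
  | mem a ha =>
    obtain ⟨e, he, rfl⟩ := ha
    induction hg using Submodule.span_induction with
    | mem b hb =>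
      obtain ⟨e', he', rfl⟩ := hb
      exact Submodule.subset_span ⟨e + e', by simp [Finset.sum_add_distrib, he, he'], (lmon_add _ _).symm⟩
    | zero => simp
    | add x y _ _ hx hy => rw [mul_add]; exact add_mem hx hy
    | smul c x _ hx => rw [mul_smul_comm]; exact Submodule.smul_mem _ _ hx
  | zero => simp
  | add x y _ _ hx hy => rw [add_mul]; exact add_mem hx hy
  | smul c x _ hx => rw [smul_mul_assoc]; exact Submodule.smul_mem _ _ hx

theorem var_Ldeg {k : ℕ} (i : Fin k) (m : ℤ) : lmon (Pi.single i m) ∈ Ldeg k m :=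
  Submodule.subset_span ⟨_, by simp, rfl⟩

theorem Ldeg_of_var_mul {k : ℕ} (i : Fin k) {m : ℤ} {f : L k}
    (h : lmon (Pi.single i 1) * f ∈ Ldeg k (m + 1)) : f ∈ Ldeg k m := by
  have := Ldeg_mul (var_Ldeg i (-1)) h
  rwa [← mul_assoc, ← lmon_add, ← Pi.single_add, neg_add_cancel, Pi.single_zero, lmon_zero, one_mul,
    show -1 + (m + 1) = m by ring] at this

theorem SqL_Ldeg {k : ℕ} (j : ℕ) {m : ℤ} {f : L k} (hf : f ∈ Ldeg k m) :
    SqL j f ∈ Ldeg k (m + j) := by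
  induction hf using Submodule.span_induction with
  | mem a ha =>
    obtain ⟨e, rfl, rfl⟩ := ha
    induction e using exponent_induction generalizing j with
    | h0 =>
      rw [lmon_zero]
      rcases Nat.eq_zero_or_pos j with rfl | hj
      · rw [SqL_zero]; exact Submodule.subset_span ⟨0, by simp, rfl⟩
      · rw [SqL_one_pos j hj]; exact zero_mem _
    | hmul i e he =>
      have hs : ∑ t, (Pi.single i 1 + e : Fin k → ℤ) t = 1 + ∑ t, e t := by
        simp [Finset.sum_add_distrib]
      rw [lmon_add, hs]
      cases j with
      | zero =>
        have := Ldeg_mul (var_Ldeg i 1) (he 0)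
        rw [SqL_zero] at this ⊢
        simpa using this
      | succ j =>
        rw [SqL_var_mul]
        have h1 := Ldeg_mul (var_Ldeg i 1) (he (j + 1))
        have h2 := Ldeg_mul (Ldeg_mul (var_Ldeg i 1) (var_Ldeg i 1)) (he j)
        rw [← pow_two] at h2
        refine add_mem ?_ ?_
        · exact Ldeg_cast (by push_cast; ring) h1
        · exact Ldeg_cast (by push_cast; ring) h2
    | hdiv i e he =>
      have hs : ∑ t, (Pi.single i 1 + e : Fin k → ℤ) t = 1 + ∑ t, e t := by
        simp [Finset.sum_add_distrib]
      rw [lmon_add, hs] at he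
      induction j with
      | zero =>
        rw [SqL_zero]; exact Submodule.subset_span ⟨e, by simp, rfl⟩
      | succ j ih =>
        have h1 := he (j + 1)
        have h2 := Ldeg_mul (Ldeg_mul (var_Ldeg i 1) (var_Ldeg i 1)) ih
        rw [← pow_two] at h2
        rw [SqL_var_mul] at h1
        apply Ldeg_of_var_mul i
        have h3 := sub_mem h1 (by exact Ldeg_cast (by push_cast; ring) h2)
        rw [add_sub_cancel_right] at h3
        exact Ldeg_cast (by push_cast; ring) h3
  | zero => simp
  | add x y _ _ hx hy => rw [map_add]; exact add_mem hx hy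
  | smul c x _ hx => rw [map_smul]; exact Submodule.smul_mem _ _ hx

theorem lact_Ldeg {k d : ℕ} {a : A} (ha : a ∈ Adeg d) {m : ℤ} {f : L k} (hf : f ∈ Ldeg k m) :
    lact k a f ∈ Ldeg k (d + m) := by
  induction ha using Submodule.span_induction with
  | mem a ha =>
    obtain ⟨l, rfl, rfl⟩ := ha
    induction l with
    | nil => simpa using hf
    | cons i l ih =>
      rw [List.map_cons, List.prod_cons, map_mul, lact_sqA, List.sum_cons]
      have := SqL_Ldeg i ih
      exact Ldeg_cast (by push_cast; ring) this
  | zero => simp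
  | add x y _ _ hx hy => rw [map_add]; exact add_mem hx hy
  | smul c x _ hx => rw [map_smul]; exact Submodule.smul_mem _ _ hx

theorem lift_Ldeg {k : ℕ} {m : ℤ} {f : L k} (hf : f ∈ Ldeg k m) : lift k f ∈ Ldeg (k + 1) (m - 1) := by
  have : incl k f ∈ Ldeg (k + 1) m := by
    induction hf using Submodule.span_induction with
    | mem a ha =>
      obtain ⟨e, rfl, rfl⟩ := ha
      rw [incl_lmon]
      exact Submodule.subset_span ⟨_, by simp [Fin.sum_univ_castSucc, snocHom], rfl⟩
    | zero => simp
    | add x y _ _ hx hy => rw [map_add]; exact add_mem hx hy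
    | smul c x _ hx => rw [map_smul]; exact Submodule.smul_mem _ _ hx
  have h := Ldeg_mul (var_Ldeg (Fin.last k) (-1)) this
  rw [show (-1 : ℤ) + m = m - 1 by ring] at h
  exact h

theorem singerClass_degree (k : ℕ) (l : List A) (ds : List ℕ) (h : Homog l ds) :
    singerClass k l ∈ Ldeg k (ds.sum + (-k : ℤ)) := by
  induction k generalizing l ds with
  | zero =>
    cases h with
    | nil => exact Submodule.subset_span ⟨0, by simp, rfl⟩
    | cons _ _ => exact zero_mem _
  | succ k ih =>
    have ih' : ∀ l ds, Homog l ds →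
        lift k (singerClass k l) ∈ Ldeg (k + 1) (ds.sum + (-(k + 1 : ℕ) : ℤ)) := by
      intro l ds h
      have := lift_Ldeg (ih l ds h)
      exact Ldeg_cast (by push_cast; ring) this
    have h2 := barAux_degree (Ldeg (k + 1)) ih' l ds h
    cases h with
    | nil => exact zero_mem _
    | cons ha hl =>
      refine add_mem ?_ h2
      have := lact_Ldeg ha (ih' _ _ hl)
      exact Ldeg_cast (by rw [List.sum_cons]; push_cast; ring) this

/-- The trivial `𝒜`-module `F_2`. -/
def trivRep : A →ₐ[ZMod 2] Module.End (ZMod 2) (ZMod 2) :=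
  (Algebra.ofId (ZMod 2) (Module.End (ZMod 2) (ZMod 2))).comp aug

/-- Bar cochains `𝒜^{⊗ n} → F_2` of internal degree `t`. -/
def cochains (n t : ℕ) : Submodule (ZMod 2) (List A → ZMod 2) where
  carrier := {f | (∀ l, l.length ≠ n → f l = 0) ∧ MultiAdd f ∧
    ∀ l ds, Homog l ds → ds.sum ≠ t → f l = 0}
  zero_mem' := ⟨fun _ _ => rfl, fun _ _ _ _ => (add_zero 0).symm, fun _ _ _ _ => rfl⟩
  add_mem' := by
    rintro f g ⟨hf, hf', hf''⟩ ⟨hg, hg', hg''⟩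
    refine ⟨fun l hl => ?_, fun l₁ l₂ a b => ?_, fun l ds h hd => ?_⟩
    · simp [hf l hl, hg l hl]
    · simp only [Pi.add_apply, hf' l₁ l₂ a b, hg' l₁ l₂ a b]; abel
    · simp [hf'' l ds h hd, hg'' l ds h hd]
  smul_mem' := by
    rintro c f ⟨hf, hf', hf''⟩
    refine ⟨fun l hl => ?_, fun l₁ l₂ a b => ?_, fun l ds h hd => ?_⟩
    · simp [hf l hl]
    · simp only [Pi.smul_apply, hf' l₁ l₂ a b, smul_add]
    · simp [hf'' l ds h hd]

/-- The bar differential with trivial coefficients. -/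
def extD : (List A → ZMod 2) →ₗ[ZMod 2] (List A → ZMod 2) where
  toFun := barD trivRep
  map_add' := barD_add trivRep
  map_smul' := barD_smul trivRep

/-- Cocycles of the bar complex in bidegree `(n, t)`. -/
def cocycles (n t : ℕ) : Submodule (ZMod 2) (List A → ZMod 2) :=
  cochains n t ⊓ LinearMap.ker extD

/-- Coboundaries of the bar complex in bidegree `(n, t)`. -/
def coboundaries : (n t : ℕ) → Submodule (ZMod 2) (List A → ZMod 2)
  | 0, _ => ⊥
  | n + 1, t => (cochains n t).map extD

/-- `Ext_𝒜^{n,t}(F_2, F_2)`, the cohomology of the bar complex. -/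
abbrev Ext (n t : ℕ) : Type := cocycles n t ⧸ (coboundaries n t).submoduleOf (cocycles n t)

/-- `P((P_k)^*)_d`: the linear functionals on `P_k` of degree `d` (elements of `(P_k)^*_d`, the dual of
`(P_k)_d`) that are annihilated by the Steenrod operations of positive degree. -/
def Prim (k d : ℕ) : Submodule (ZMod 2) (Module.Dual (ZMod 2) (P k)) where
  carrier := {b | (∀ m, m ≠ d → ∀ f ∈ MvPolynomial.homogeneousSubmodule (Fin k) (ZMod 2) m, b f = 0) ∧
    ∀ j f, b (Sq (j + 1) f) = 0}
  zero_mem' := ⟨fun _ _ _ _ => rfl, fun _ _ => rfl⟩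
  add_mem' := by
    rintro f g ⟨hf, hf'⟩ ⟨hg, hg'⟩
    exact ⟨fun m hm p hp => by simp [hf m hm p hp, hg m hm p hp], fun j p => by simp [hf', hg']⟩
  smul_mem' := by
    rintro c f ⟨hf, hf'⟩
    exact ⟨fun m hm p hp => by simp [hf m hm p hp], fun j p => by simp [hf']⟩

theorem prim_lact {k d : ℕ} {b : Module.Dual (ZMod 2) (P k)} (hb : b ∈ Prim k d) (a : A) {f : L k}
    (hf : f ∈ polys k) : b (fromLaurent k (lact k a f)) = aug a • b (fromLaurent k f) := by
  induction a using A_induction generalizing f with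
  | h0 => simp
  | h1 => simp
  | hsq i =>
    obtain ⟨p, rfl⟩ := hf
    rw [lact_sqA, AlgHom.toLinearMap_apply, SqL_toLaurent, fromLaurent_toLaurent,
      fromLaurent_toLaurent, aug_sqA]
    cases i with
    | zero =>
      have h := SqL_toLaurent 0 p
      rw [SqL_zero] at h
      have := congrArg (fromLaurent k) h
      rw [fromLaurent_toLaurent, fromLaurent_toLaurent] at this
      rw [← this, if_pos rfl, one_smul]
    | succ i => rw [hb.2, if_neg (by omega), zero_smul]
  | hadd a c ha hc => simp only [map_add, LinearMap.add_apply, ha hf, hc hf, add_smul]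
  | hmul a c ha hc =>
    rw [map_mul, Module.End.mul_apply, ha (lact_polys c hf), hc hf, map_mul, smul_smul]

theorem prim_Ldeg {k d : ℕ} {b : Module.Dual (ZMod 2) (P k)} (hb : b ∈ Prim k d) {m : ℤ}
    (hm : m ≠ d) {f : L k} (hf : f ∈ Ldeg k m) : b (fromLaurent k f) = 0 := by
  induction hf using Submodule.span_induction with
  | mem a ha =>
    obtain ⟨e, rfl, rfl⟩ := ha
    rw [fromLaurent_lmon]
    split_ifs with h
    · refine hb.1 (∑ i, (e i).toNat) ?_ _ ?_
      · intro h'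
        apply hm
        rw [← h']
        push_cast
        exact Finset.sum_congr rfl fun i _ => (Int.toNat_of_nonneg (h i)).symm
      · refine MvPolynomial.isHomogeneous_monomial _ ?_
        rw [Finsupp.degree_eq_sum]
        simp
    · simp
  | zero => simp
  | add x y _ _ hx hy => rw [map_add, map_add, hx, hy, add_zero]
  | smul c x _ hx => rw [map_smul, map_smul, hx, smul_zero]

/-- The cochain `b ∘ e_k`. -/
def transferCochain (k : ℕ) (b : Module.Dual (ZMod 2) (P k)) : List A → ZMod 2 :=
  fun l => b (fromLaurent k (singerClass k l))

theorem transferCochain_mem {k d : ℕ} {b : Module.Dual (ZMod 2) (P k)} (hb : b ∈ Prim k d) :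
    transferCochain k b ∈ cocycles k (k + d) := by
  refine ⟨⟨fun l hl => ?_, fun l₁ l₂ x y => ?_, fun l ds h hd => ?_⟩, ?_⟩
  · rw [transferCochain, singerClass_length k l hl, map_zero, map_zero]
  · simp only [transferCochain]
    rw [singerClass_multiAdd, map_add, map_add]
  · exact prim_Ldeg hb (by omega) (singerClass_degree k l ds h)
  · refine LinearMap.mem_ker.mpr ?_
    funext l
    cases l with
    | nil => rfl
    | cons a l =>
      have h := congrFun (singerClass_cocycle k) (a :: l)
      have h1 := barAux_map (b.comp (fromLaurent k)) (singerClass k) (a :: l)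
      have h2 := congrArg (fun x => b (fromLaurent k x)) h
      simp only [barD, map_add, Pi.zero_apply, map_zero, prim_lact hb a (singerClass_polys k l)] at h2
      exact (congrArg (fun x => aug a • b (fromLaurent k (singerClass k l)) + x) h1).trans h2

/-- The Singer transfer `Tr_k : P((P_k)^*)_d → Ext_𝒜^{k,k+d}(F_2, F_2)`, `b ↦ b_*(e_k)`. It is the dual of
`φ_k : Tor^𝒜_{k,k+d}(F_2, F_2) → (QP_k)_d`, `z ↦ e_k ∩ z`, since `⟨b, e_k ∩ z⟩ = ⟨b_* e_k, z⟩`. -/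
def transfer (k d : ℕ) : Prim k d →ₗ[ZMod 2] Ext k (k + d) :=
  (Submodule.mkQ _).comp
    ({ toFun := fun b => ⟨transferCochain k b, transferCochain_mem b.2⟩
       map_add' := fun _ _ => rfl
       map_smul' := fun _ _ => rfl } : Prim k d →ₗ[ZMod 2] cocycles k (k + d))

/-! ### The lambda algebra -/

/-- The free associative algebra on `λ_0, λ_1, …`. -/
abbrev T : Type := FreeAlgebra (ZMod 2) ℕ

/-- The generator `λ_i`. -/
def lam (i : ℕ) : T := FreeAlgebra.ι (ZMod 2) i

/-- The relator `λ_j λ_{2j+1+m} + ∑_ν binom(m-ν-1, ν) λ_{j+m-ν} λ_{2j+1+ν}`. -/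
def lamRel (j m : ℕ) : T :=
  lam j * lam (2 * j + 1 + m) + ∑ ν ∈ Finset.range m,
    ((m - ν - 1).choose ν : ZMod 2) • (lam (j + m - ν) * lam (2 * j + 1 + ν))

/-- The two-sided ideal of relations; the lambda algebra is `Λ = T / lamIdeal`. -/
def lamIdeal : Submodule (ZMod 2) T :=
  Submodule.span (ZMod 2) {z | ∃ (x y : T) (j m : ℕ), z = x * lamRel j m * y}

/-- `δ(λ_i) = ∑_ν binom(i-ν-1, ν+1) λ_{i-ν-1} λ_ν`. -/
def lamD (i : ℕ) : T :=
  ∑ ν ∈ Finset.range i, ((i - ν - 1).choose (ν + 1) : ZMod 2) • (lam (i - ν - 1) * lam ν)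

/-- The derivation `δ` with these values on the generators, see `lamDer_lam`, `lamDer_mul`. -/
def lamDer : T →ₗ[ZMod 2] T :=
  (TrivSqZeroExt.sndHom T T |>.restrictScalars (ZMod 2)).comp
    (FreeAlgebra.lift (ZMod 2) (fun i : ℕ =>
      (TrivSqZeroExt.inl (lam i) + TrivSqZeroExt.inr (lamD i) : TrivSqZeroExt T T))).toLinearMap

theorem lamDer_lam (i : ℕ) : lamDer (lam i) = lamD i := by
  simp [lamDer, lam]

theorem lamDer_mul (x y : T) : lamDer (x * y) = lamDer x * y + x * lamDer y := by
  have hfst : ∀ x : T, (FreeAlgebra.lift (ZMod 2) (fun i : ℕ =>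
      (TrivSqZeroExt.inl (lam i) + TrivSqZeroExt.inr (lamD i) : TrivSqZeroExt T T)) x).fst = x := by
    intro x
    have : (TrivSqZeroExt.fstHom (ZMod 2) T T).comp (FreeAlgebra.lift (ZMod 2) (fun i : ℕ =>
      (TrivSqZeroExt.inl (lam i) + TrivSqZeroExt.inr (lamD i) : TrivSqZeroExt T T))) =
        AlgHom.id (ZMod 2) T := by
      apply FreeAlgebra.hom_ext
      funext i
      simp [lam]
    exact congrArg (fun F => F x) this
  simp only [lamDer, LinearMap.comp_apply, AlgHom.toLinearMap_apply, map_mul,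
    LinearMap.coe_restrictScalars, TrivSqZeroExt.sndHom_apply, TrivSqZeroExt.snd_mul, hfst,
    smul_eq_mul, MulOpposite.smul_eq_mul_unop, MulOpposite.unop_op]
  exact add_comm _ _

/-- Representatives in `T` of the cycles of `(Λ, δ)`. -/
def lamCycles : Submodule (ZMod 2) T := lamIdeal.comap lamDer

/-- Representatives in `T` of the boundaries of `(Λ, δ)`. -/
def lamBoundaries : Submodule (ZMod 2) T := LinearMap.range lamDer ⊔ lamIdeal

/-- The homology `H(Λ, δ)` of the lambda algebra. -/
abbrev HLambda : Type := lamCycles ⧸ lamBoundaries.submoduleOf lamCycles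

/-- The algebra map `λ_i ↦ λ_{2i+1}`. -/
def sqZero : T →ₐ[ZMod 2] T := FreeAlgebra.lift (ZMod 2) fun i => lam (2 * i + 1)

/-! ### Comparison of the bar complex with the lambda algebra -/

/-- The comparison of the bar complex with the lambda algebra in stem `d`:
`f ↦ ∑ f(Sq^{i_1+1}, …, Sq^{i_n+1}) λ_{i_n} ⋯ λ_{i_1}`, the sum over `i_1 + ⋯ + i_n = d`. -/
def kap : (n d : ℕ) → (List A → ZMod 2) →ₗ[ZMod 2] T
  | 0, d => if d = 0 then (Algebra.linearMap (ZMod 2) T).comp (LinearMap.proj []) else 0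
  | n + 1, d => ∑ p ∈ Finset.HasAntidiagonal.antidiagonal d,
      (LinearMap.mulRight (ZMod 2) (lam p.1)).comp
        ((kap n p.2).comp (LinearMap.funLeft (ZMod 2) (ZMod 2) (fun l => sqA (p.1 + 1) :: l)))

theorem kap_succ (n d : ℕ) (f : List A → ZMod 2) : kap (n + 1) d f =
    ∑ p ∈ Finset.HasAntidiagonal.antidiagonal d, kap n p.2 (fun l => f (sqA (p.1 + 1) :: l)) * lam p.1 := by
  rw [kap, LinearMap.sum_apply]
  rfl

theorem lamDer_algebraMap (c : ZMod 2) : lamDer (algebraMap (ZMod 2) T c) = 0 := by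
  have h1 : lamDer 1 = 0 := by
    have := lamDer_mul 1 1
    rw [one_mul, one_mul, mul_one] at this
    exact left_eq_add.mp this
  rw [Algebra.algebraMap_eq_smul_one, map_smul, h1, smul_zero]

theorem lamDer_kap_zero (n : ℕ) (f : List A → ZMod 2) : lamDer (kap n 0 f) = 0 := by
  induction n generalizing f with
  | zero => simp [kap, lamDer_algebraMap]
  | succ n ih =>
    rw [kap_succ]
    simp [lamDer_mul, ih, lamDer_lam, lamD]

theorem lamIdeal_mul {x z y : T} (hz : z ∈ lamIdeal) : x * z * y ∈ lamIdeal := by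
  induction hz using Submodule.span_induction with
  | mem z hz =>
    obtain ⟨x', y', j, m, rfl⟩ := hz
    exact Submodule.subset_span ⟨x * x', y' * y, j, m, by noncomm_ring⟩
  | zero => simp
  | add z w _ _ hz hw => rw [mul_add, add_mul]; exact add_mem hz hw
  | smul c z _ hz => rw [mul_smul_comm, smul_mul_assoc]; exact Submodule.smul_mem _ _ hz

/-- The Adem relations and the relations of `Λ` are dual to each other. -/
theorem adem_lam_duality (h : A →+ T) (N : ℕ) (hN : 1 ≤ N) :
    ∑ a ∈ Finset.Ico 1 N, h (sqA a * sqA (N - a)) * (lam (N - a - 1) * lam (a - 1)) +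
      h (sqA N) * lamD (N - 1) ∈ lamIdeal := by
  let t : ℕ → ℕ → T := fun a B =>
    if 1 ≤ B ∧ 2 * B ≤ a ∧ a + B < N then
      ((N - 1 - a - B).choose (a - 2 * B) : ZMod 2) •
        (h (sqA (N - B) * sqA B) * (lam (N - a - 1) * lam (a - 1)))
    else 0
  have hsmul : ∀ (c : ZMod 2) (x : A), h (c • x) = c • h x := by
    intro c x
    have hc : c = 0 ∨ c = 1 := by revert c; decide
    rcases hc with rfl | rfl <;> simp
  -- inadmissible products of squares
  have h1 : ∀ a ∈ Finset.Ico 1 N, a < 2 * (N - a) →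
      h (sqA a * sqA (N - a)) * (lam (N - a - 1) * lam (a - 1)) =
        ((N - a - 1).choose a : ZMod 2) • (h (sqA N) * (lam (N - a - 1) * lam (a - 1))) +
          ∑ B ∈ Finset.range N, t a B := by
    intro a ha hlt
    simp only [Finset.mem_Ico] at ha
    rw [sqA_adem a (N - a) (by omega) hlt, map_sum, Finset.sum_mul, Finset.sum_range_succ']
    rw [add_comm]
    congr 1
    · rw [hsmul, smul_mul_assoc, sqA_zero, mul_one]
      rw [show a + (N - a) - 0 = N by omega, show N - a - 1 - 0 = N - a - 1 by omega,
        show a - 2 * 0 = a by omega]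
    · obtain ⟨N', rfl⟩ : ∃ N', N = N' + 1 := ⟨N - 1, by omega⟩
      rw [Finset.sum_range_succ' (fun B => t a B)]
      have ht0 : t a 0 = 0 := by simp [t]
      rw [ht0, add_zero]
      symm
      rw [← Finset.sum_subset (Finset.range_subset_range.mpr (show a / 2 ≤ N' by omega))]
      · refine Finset.sum_congr rfl fun j hj => ?_
        simp only [Finset.mem_range] at hj
        simp only [t]
        rw [if_pos (by omega), hsmul, smul_mul_assoc]
        rw [show a + (N' + 1 - a) - (j + 1) = N' + 1 - (j + 1) by omega,
          show N' + 1 - 1 - a - (j + 1) = N' + 1 - a - 1 - (j + 1) by omega]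
      · intro j _ hj
        simp only [Finset.mem_range] at hj
        simp only [t]
        rw [if_neg (by omega)]
  have h1' : ∀ a ∈ Finset.Ico 1 N, ¬ a < 2 * (N - a) →
      ((N - a - 1).choose a : ZMod 2) • (h (sqA N) * (lam (N - a - 1) * lam (a - 1))) +
          ∑ B ∈ Finset.range N, t a B = 0 := by
    intro a ha hge
    simp only [Finset.mem_Ico] at ha
    rw [Nat.choose_eq_zero_of_lt (by omega), Nat.cast_zero, zero_smul, zero_add]
    refine Finset.sum_eq_zero fun B _ => ?_
    simp only [t]
    split_ifs with hc
    · rw [Nat.choose_eq_zero_of_lt (by omega), Nat.cast_zero, zero_smul]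
    · rfl
  have hD : ∑ a ∈ Finset.Ico 1 N,
      ((N - a - 1).choose a : ZMod 2) • (h (sqA N) * (lam (N - a - 1) * lam (a - 1))) =
        h (sqA N) * lamD (N - 1) := by
    rw [lamD, Finset.mul_sum, Finset.sum_Ico_eq_sum_range]
    refine Finset.sum_congr rfl fun ν _ => ?_
    rw [mul_smul_comm, show N - (1 + ν) - 1 = N - 1 - ν - 1 by omega, show 1 + ν - 1 = ν by omega,
      add_comm 1 ν]
  -- inadmissible products of lambdas
  have h2 : ∀ B ∈ Finset.Ico 1 N, (2 * B ≤ N - B) →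
      h (sqA (N - B) * sqA B) * (lam (B - 1) * lam (N - B - 1)) +
        ∑ a ∈ Finset.Ico 1 N, t a B ∈ lamIdeal := by
    intro B hB hle
    simp only [Finset.mem_Ico] at hB
    have hmem : h (sqA (N - B) * sqA B) * lamRel (B - 1) (N - 3 * B) * 1 ∈ lamIdeal :=
      Submodule.subset_span ⟨_, _, _, _, rfl⟩
    convert hmem using 1
    rw [mul_one, lamRel, mul_add]
    congr 1
    · congr 3
      omega
    · rw [Finset.mul_sum]
      symm
      refine Finset.sum_bij_ne_zero (fun ν _ _ => 2 * B + ν) ?_ ?_ ?_ ?_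
      · intro ν hν _
        simp only [Finset.mem_range] at hν
        simp only [Finset.mem_Ico]; omega
      · intro ν _ _ ν' _ _ heq
        omega
      · intro a ha hne
        simp only [Finset.mem_Ico] at ha
        simp only [t] at hne
        split_ifs at hne with hc
        · refine ⟨a - 2 * B, by simp only [Finset.mem_range]; omega, ?_, by omega⟩
          rw [mul_smul_comm, show N - 3 * B - (a - 2 * B) - 1 = N - 1 - a - B by omega,
            show B - 1 + (N - 3 * B) - (a - 2 * B) = N - a - 1 by omega,
            show 2 * (B - 1) + 1 + (a - 2 * B) = a - 1 by omega]
          exact hne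
        · exact absurd rfl hne
      · intro ν hν _
        simp only [Finset.mem_range] at hν
        simp only [t]
        rw [if_pos (by omega), mul_smul_comm]
        rw [show N - 1 - (2 * B + ν) - B = N - 3 * B - ν - 1 by omega,
          show 2 * B + ν - 2 * B = ν by omega,
          show N - (2 * B + ν) - 1 = B - 1 + (N - 3 * B) - ν by omega,
          show 2 * B + ν - 1 = 2 * (B - 1) + 1 + ν by omega]
  have h2' : ∀ B ∈ Finset.Ico 1 N, ¬ (2 * B ≤ N - B) → ∑ a ∈ Finset.Ico 1 N, t a B = 0 := by
    intro B hB hlt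
    refine Finset.sum_eq_zero fun a ha => ?_
    simp only [t]
    rw [if_neg (by omega)]
  have hcomm : ∑ a ∈ Finset.Ico 1 N, ∑ B ∈ Finset.range N, t a B =
      ∑ B ∈ Finset.Ico 1 N, ∑ a ∈ Finset.Ico 1 N, t a B := by
    rw [Finset.sum_comm]
    symm
    refine Finset.sum_subset (fun x hx => ?_) (fun B _ hB => ?_)
    · simp only [Finset.mem_Ico, Finset.mem_range] at hx ⊢; omega
    · refine Finset.sum_eq_zero fun a _ => ?_
      simp only [t]
      rw [if_neg]
      intro hc
      apply hB
      simp only [Finset.mem_Ico]; omega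
  -- assemble
  have hsplit : ∀ a ∈ Finset.Ico 1 N,
      h (sqA a * sqA (N - a)) * (lam (N - a - 1) * lam (a - 1)) =
        (((N - a - 1).choose a : ZMod 2) • (h (sqA N) * (lam (N - a - 1) * lam (a - 1))) +
          ∑ B ∈ Finset.range N, t a B) +
        (if a < 2 * (N - a) then 0 else
          h (sqA a * sqA (N - a)) * (lam (N - a - 1) * lam (a - 1))) := by
    intro a ha
    split_ifs with hc
    · rw [add_zero]; exact h1 a ha hc
    · rw [h1' a ha hc, zero_add]
  have hrefl : ∑ a ∈ Finset.Ico 1 N, (if a < 2 * (N - a) then 0 else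
          h (sqA a * sqA (N - a)) * (lam (N - a - 1) * lam (a - 1))) =
      ∑ B ∈ Finset.Ico 1 N, (if 2 * B ≤ N - B then
          h (sqA (N - B) * sqA B) * (lam (B - 1) * lam (N - B - 1)) else 0) := by
    refine Finset.sum_bij' (fun a _ => N - a) (fun a _ => N - a) ?_ ?_ ?_ ?_ ?_
    · intro a ha; simp only [Finset.mem_Ico] at ha ⊢; omega
    · intro a ha; simp only [Finset.mem_Ico] at ha ⊢; omega
    · intro a ha; simp only [Finset.mem_Ico] at ha; omega
    · intro a ha; simp only [Finset.mem_Ico] at ha; omega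
    · intro a ha
      simp only [Finset.mem_Ico] at ha
      rw [show N - (N - a) = a by omega]
      by_cases hc : a < 2 * (N - a)
      · rw [if_pos hc, if_neg (by omega)]
      · rw [if_neg hc, if_pos (by omega)]
  rw [Finset.sum_congr rfl hsplit, Finset.sum_add_distrib, Finset.sum_add_distrib, hD, hcomm, hrefl]
  have hfin : ∑ B ∈ Finset.Ico 1 N, ((if 2 * B ≤ N - B then
          h (sqA (N - B) * sqA B) * (lam (B - 1) * lam (N - B - 1)) else 0) +
            ∑ a ∈ Finset.Ico 1 N, t a B) ∈ lamIdeal := by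
    refine Submodule.sum_mem _ fun B hB => ?_
    split_ifs with hc
    · exact h2 B hB hc
    · rw [h2' B hB hc, add_zero]; exact zero_mem _
  rw [Finset.sum_add_distrib] at hfin
  convert hfin using 1
  have := ZModModule.add_self (h (sqA N) * lamD (N - 1))
  calc _ = (h (sqA N) * lamD (N - 1) + h (sqA N) * lamD (N - 1)) +
        (∑ B ∈ Finset.Ico 1 N, (if 2 * B ≤ N - B then
          h (sqA (N - B) * sqA B) * (lam (B - 1) * lam (N - B - 1)) else 0) +
        ∑ B ∈ Finset.Ico 1 N, ∑ a ∈ Finset.Ico 1 N, t a B) := by abel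
    _ = _ := by rw [this, zero_add]

theorem kap_head {n d : ℕ} {f : List A → ZMod 2} (hf : MultiAdd f) :
    ∃ h : A →+ T, ∀ a, h a = kap n d (fun l => f (a :: l)) := by
  refine ⟨AddMonoidHom.mk' (fun a => kap n d (fun l => f (a :: l))) fun a b => ?_, fun _ => rfl⟩
  rw [← map_add]
  congr 1
  funext l
  exact hf [] l a b

theorem adem_lam_duality_succ (n w e : ℕ) {f : List A → ZMod 2} (hf : MultiAdd f) :
    ∑ p ∈ Finset.HasAntidiagonal.antidiagonal w,
        kap n e (fun l => f ((sqA (p.1 + 1) * sqA (p.2 + 1)) :: l)) * lam p.2 * lam p.1 +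
      kap n e (fun l => f (sqA (w + 2) :: l)) * lamD (w + 1) ∈ lamIdeal := by
  obtain ⟨h, hh⟩ := kap_head (n := n) (d := e) hf
  have := adem_lam_duality h (w + 2) (by omega)
  simp only [hh] at this
  rw [show w + 2 - 1 = w + 1 by omega] at this
  convert this using 2
  rw [Finset.sum_Ico_eq_sum_range, Finset.Nat.sum_antidiagonal_eq_sum_range_succ_mk]
  refine Finset.sum_congr (by congr 1) fun i hi => ?_
  simp only [Finset.mem_range] at hi
  rw [mul_assoc, add_comm 1 i, show w + 2 - (i + 1) = w - i + 1 by omega]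
  rfl

theorem sum_triple (d : ℕ) (G : ℕ → ℕ → ℕ → T) :
    ∑ p ∈ Finset.HasAntidiagonal.antidiagonal d,
      ∑ q ∈ Finset.HasAntidiagonal.antidiagonal p.2, G p.1 q.1 q.2 =
    ∑ p ∈ Finset.HasAntidiagonal.antidiagonal d,
      ∑ q ∈ Finset.HasAntidiagonal.antidiagonal p.1, G q.1 q.2 p.2 := by
  rw [Finset.sum_sigma', Finset.sum_sigma']
  refine Finset.sum_bij' (fun x _ => ⟨(x.1.1 + x.2.1, x.2.2), (x.1.1, x.2.1)⟩)
    (fun x _ => ⟨(x.2.1, x.2.2 + x.1.2), (x.2.2, x.1.2)⟩) ?_ ?_ ?_ ?_ ?_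
  · rintro ⟨⟨a, b⟩, ⟨c, e⟩⟩ h
    simp at h ⊢; omega
  · rintro ⟨⟨a, b⟩, ⟨c, e⟩⟩ h
    simp at h ⊢; omega
  · rintro ⟨⟨a, b⟩, ⟨c, e⟩⟩ h
    simp at h ⊢; omega
  · rintro ⟨⟨a, b⟩, ⟨c, e⟩⟩ h
    simp at h ⊢; omega
  · rintro ⟨⟨a, b⟩, ⟨c, e⟩⟩ h
    rfl

/-- The comparison map commutes with the differentials modulo the relations of `Λ`. -/
theorem kap_barAux (n d : ℕ) {f : List A → ZMod 2} (hf : MultiAdd f) :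
    kap (n + 1) d (barAux f) + lamDer (kap n (d + 1) f) ∈ lamIdeal := by
  induction n generalizing d f with
  | zero =>
    have h1 : kap 1 d (barAux f) = 0 := by
      rw [kap_succ]
      refine Finset.sum_eq_zero fun p _ => ?_
      by_cases hp : p.2 = 0 <;> simp [kap, hp, barAux, aug_sqA]
    rw [h1]
    simp [kap]
  | succ n ih =>
    have hX : kap (n + 2) d (barAux f) =
        (∑ p ∈ Finset.HasAntidiagonal.antidiagonal d,
          ∑ q ∈ Finset.HasAntidiagonal.antidiagonal p.1,
            kap n p.2 (fun l => f ((sqA (q.1 + 1) * sqA (q.2 + 1)) :: l)) * lam q.2 * lam q.1) +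
        ∑ p ∈ Finset.HasAntidiagonal.antidiagonal d,
          kap (n + 1) p.2 (barAux fun l => f (sqA (p.1 + 1) :: l)) * lam p.1 := by
      rw [← sum_triple d (fun i j e =>
        kap n e (fun l => f ((sqA (i + 1) * sqA (j + 1)) :: l)) * lam j * lam i),
        ← Finset.sum_add_distrib, kap_succ]
      refine Finset.sum_congr rfl fun p _ => ?_
      rw [← Finset.sum_mul, ← add_mul, kap_succ, kap_succ, ← Finset.sum_add_distrib]
      congr 1
      refine Finset.sum_congr rfl fun q _ => ?_
      rw [← add_mul, ← map_add]
      rfl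
    have hY : lamDer (kap (n + 1) (d + 1) f) =
        (∑ p ∈ Finset.HasAntidiagonal.antidiagonal d,
          kap n p.2 (fun l => f (sqA (p.1 + 2) :: l)) * lamD (p.1 + 1)) +
        ∑ p ∈ Finset.HasAntidiagonal.antidiagonal d,
          lamDer (kap n (p.2 + 1) (fun l => f (sqA (p.1 + 1) :: l))) * lam p.1 := by
      rw [kap_succ, map_sum]
      simp only [lamDer_mul, lamDer_lam]
      rw [Finset.sum_add_distrib, Finset.Nat.sum_antidiagonal_succ', Finset.Nat.sum_antidiagonal_succ]
      rw [lamDer_kap_zero, zero_mul, zero_add, show lamD 0 = 0 by simp [lamD], mul_zero, zero_add,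
        add_comm]
    rw [hX, hY, add_add_add_comm, ← Finset.sum_add_distrib, ← Finset.sum_add_distrib]
    refine add_mem (Submodule.sum_mem _ fun p _ => adem_lam_duality_succ n p.1 p.2 hf) (Submodule.sum_mem _ fun p _ => ?_)
    rw [← add_mul]
    have := lamIdeal_mul (x := 1) (y := lam p.1) (ih p.2 (hf.cons (sqA (p.1 + 1))))
    rwa [one_mul] at this

theorem kap_extD (n d : ℕ) (f : List A → ZMod 2) : kap (n + 1) d (extD f) = kap (n + 1) d (barAux f) := by
  rw [kap_succ, kap_succ]
  refine Finset.sum_congr rfl fun p _ => ?_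
  congr 2
  funext l
  have : trivRep (sqA (p.1 + 1)) = 0 := by
    simp [trivRep, aug_sqA]
  change trivRep (sqA (p.1 + 1)) (f l) + barAux f (sqA (p.1 + 1) :: l) = _
  rw [this, LinearMap.zero_apply, zero_add]

theorem kap_cocycles {n d : ℕ} {f : List A → ZMod 2} (hf : f ∈ cocycles n (n + d)) :
    kap n d f ∈ lamCycles := by
  change lamDer (kap n d f) ∈ lamIdeal
  cases d with
  | zero => rw [lamDer_kap_zero]; exact zero_mem _
  | succ d =>
    have h := kap_barAux n d hf.1.2.1
    have h0 : extD f = 0 := LinearMap.mem_ker.mp hf.2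
    rwa [← kap_extD, h0, map_zero, zero_add] at h

theorem kap_coboundaries {n d : ℕ} {f : List A → ZMod 2} (hf : f ∈ coboundaries n (n + d)) :
    kap n d f ∈ lamBoundaries := by
  cases n with
  | zero =>
    have : f = 0 := hf
    rw [this, map_zero]; exact zero_mem _
  | succ n =>
    obtain ⟨g, hg, rfl⟩ := hf
    rw [kap_extD]
    have h := kap_barAux n d hg.2.1
    have h2 := ZModModule.add_self (lamDer (kap n (d + 1) g))
    rw [← add_zero (kap (n + 1) d (barAux g)), ← h2, ← add_assoc]
    exact add_mem (Submodule.mem_sup_right h) (Submodule.mem_sup_left ⟨_, rfl⟩)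

/-- The standard identification `Ext_𝒜^{n,n+d}(F_2, F_2) → H^{n,d}(Λ, δ)` induced by the comparison map. -/
def extToLambda (n d : ℕ) : Ext n (n + d) →ₗ[ZMod 2] HLambda :=
  Submodule.mapQ _ _
    ((kap n d).restrict (p := cocycles n (n + d)) (q := lamCycles) fun _ hf => kap_cocycles hf)
    (fun _ hf => kap_coboundaries hf)


theorem choose_odd_even (a b : ℕ) : ((2 * a + 1).choose (2 * b) : ZMod 2) = (a.choose b : ZMod 2) := by
  have := Choose.choose_modEq_choose_mod_mul_choose_div_nat (n := 2 * a + 1) (k := 2 * b) (p := 2)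
  rw [show (2 * a + 1) % 2 = 1 by omega, show (2 * b) % 2 = 0 by omega,
    show (2 * a + 1) / 2 = a by omega, show (2 * b) / 2 = b by omega, Nat.choose_zero_right,
    one_mul] at this
  exact (ZMod.natCast_eq_natCast_iff _ _ 2).mpr this

theorem choose_even_odd (a b : ℕ) : ((2 * a).choose (2 * b + 1) : ZMod 2) = 0 := by
  have := Choose.choose_modEq_choose_mod_mul_choose_div_nat (n := 2 * a) (k := 2 * b + 1) (p := 2)
  rw [show (2 * a) % 2 = 0 by omega, show (2 * b + 1) % 2 = 1 by omega,
    Nat.choose_eq_zero_of_lt (show 0 < 1 by omega), zero_mul] at this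
  simpa using (ZMod.natCast_eq_natCast_iff _ _ 2).mpr this

theorem sum_range_two_mul (m : ℕ) (G : ℕ → T) :
    ∑ ν ∈ Finset.range (2 * m), G ν = ∑ ν ∈ Finset.range m, (G (2 * ν) + G (2 * ν + 1)) := by
  induction m with
  | zero => simp
  | succ m ih =>
    rw [Finset.sum_range_succ, ← ih, show 2 * (m + 1) = 2 * m + 1 + 1 by ring,
      Finset.sum_range_succ, Finset.sum_range_succ]
    abel

theorem sqZero_lam (i : ℕ) : sqZero (lam i) = lam (2 * i + 1) := by simp [sqZero, lam]

theorem sqZero_lamRel (j m : ℕ) : sqZero (lamRel j m) = lamRel (2 * j + 1) (2 * m) := by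
  unfold lamRel
  rw [sum_range_two_mul, map_add, map_mul, map_sum, sqZero_lam, sqZero_lam]
  congr 1
  · congr 2; ring
  · refine Finset.sum_congr rfl fun ν hν => ?_
    simp only [Finset.mem_range] at hν
    rw [map_smul, map_mul, sqZero_lam, sqZero_lam,
      show 2 * m - (2 * ν + 1) - 1 = 2 * (m - ν - 1) by omega, choose_even_odd, zero_smul, add_zero,
      show 2 * m - 2 * ν - 1 = 2 * (m - ν - 1) + 1 by omega, choose_odd_even,
      show 2 * j + 1 + 2 * m - 2 * ν = 2 * (j + m - ν) + 1 by omega,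
      show 2 * (2 * j + 1) + 1 + 2 * ν = 2 * (2 * j + 1 + ν) + 1 by omega]

theorem sqZero_lamD (i : ℕ) : sqZero (lamD i) = lamD (2 * i + 1) := by
  unfold lamD
  rw [Finset.sum_range_succ, sum_range_two_mul, map_sum]
  rw [show 2 * i + 1 - 2 * i - 1 = 0 by omega, Nat.choose_eq_zero_of_lt (by omega), Nat.cast_zero,
    zero_smul, add_zero]
  refine Finset.sum_congr rfl fun ν hν => ?_
  simp only [Finset.mem_range] at hν
  rw [map_smul, map_mul, sqZero_lam, sqZero_lam,
    show 2 * i + 1 - 2 * ν - 1 = 2 * (i - ν) by omega, choose_even_odd, zero_smul, zero_add,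
    show 2 * i + 1 - (2 * ν + 1) - 1 = 2 * (i - ν - 1) + 1 by omega,
    show 2 * ν + 1 + 1 = 2 * (ν + 1) by ring, choose_odd_even]

theorem lamDer_sqZero (x : T) : lamDer (sqZero x) = sqZero (lamDer x) := by
  induction x using FreeAlgebra.induction with
  | grade0 c => rw [AlgHom.commutes, lamDer_algebraMap, map_zero]
  | grade1 i =>
    change lamDer (sqZero (lam i)) = sqZero (lamDer (lam i))
    rw [sqZero_lam, lamDer_lam, lamDer_lam, sqZero_lamD]
  | mul a b ha hb => rw [map_mul, lamDer_mul, lamDer_mul, ha, hb, map_add, map_mul, map_mul]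
  | add a b ha hb => rw [map_add, map_add, map_add, map_add, ha, hb]

theorem sqZero_lamIdeal {z : T} (hz : z ∈ lamIdeal) : sqZero z ∈ lamIdeal := by
  induction hz using Submodule.span_induction with
  | mem z hz =>
    obtain ⟨x, y, j, m, rfl⟩ := hz
    rw [map_mul, map_mul, sqZero_lamRel]
    exact Submodule.subset_span ⟨_, _, _, _, rfl⟩
  | zero => rw [map_zero]; exact zero_mem _
  | add z w _ _ hz hw => rw [map_add]; exact add_mem hz hw
  | smul c z _ hz => rw [map_smul]; exact Submodule.smul_mem _ _ hz

theorem sqZero_lamCycles {z : T} (hz : z ∈ lamCycles) : sqZero z ∈ lamCycles := by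
  change lamDer (sqZero z) ∈ lamIdeal
  rw [lamDer_sqZero]
  exact sqZero_lamIdeal hz

theorem sqZero_lamBoundaries {z : T} (hz : z ∈ lamBoundaries) : sqZero z ∈ lamBoundaries := by
  obtain ⟨_, ⟨y, rfl⟩, w, hw, rfl⟩ := Submodule.mem_sup.mp hz
  rw [map_add, ← lamDer_sqZero]
  exact Submodule.add_mem_sup ⟨_, rfl⟩ (sqZero_lamIdeal hw)

/-- `Sq^0` on `H(Λ) = Ext_𝒜(F_2, F_2)`. -/
def Sq0 : HLambda →ₗ[ZMod 2] HLambda :=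
  Submodule.mapQ _ _
    (sqZero.toLinearMap.restrict (p := lamCycles) (q := lamCycles) fun _ hz => sqZero_lamCycles hz)
    (fun _ hz => sqZero_lamBoundaries hz)

theorem c0_cycle : lam 2 * lam 3 ^ 2 ∈ lamCycles := by
  change lamDer (lam 2 * lam 3 ^ 2) ∈ lamIdeal
  have h2 : lamD 2 = lam 1 * lam 0 := by
    simp [lamD, Finset.sum_range_succ]
  have h3 : lamD 3 = 0 := by
    simp only [lamD, Finset.sum_range_succ, Finset.sum_range_zero, zero_add]
    simp
    exact Or.inl (by decide)
  have hr1 : lamRel 0 2 = lam 0 * lam 3 + lam 2 * lam 1 := by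
    simp [lamRel, Finset.sum_range_succ]
  have hr2 : lamRel 1 0 = lam 1 * lam 3 := by simp [lamRel]
  have hd : lamDer (lam 2 * lam 3 ^ 2) =
      lam 1 * lamRel 0 2 * lam 3 + lam 1 * lam 2 * lamRel 1 0 * 1 := by
    rw [pow_two, lamDer_mul, lamDer_mul, lamDer_lam, lamDer_lam, h2, h3, hr1, hr2]
    have := ZModModule.add_self (lam 1 * lam 2 * (lam 1 * lam 3))
    calc _ = lam 1 * lam 0 * (lam 3 * lam 3) + 0 := by noncomm_ring
      _ = lam 1 * lam 0 * (lam 3 * lam 3) +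
          (lam 1 * lam 2 * (lam 1 * lam 3) + lam 1 * lam 2 * (lam 1 * lam 3)) := by rw [this]
      _ = _ := by noncomm_ring
  rw [hd]
  exact add_mem (Submodule.subset_span ⟨_, _, _, _, rfl⟩) (Submodule.subset_span ⟨_, _, _, _, rfl⟩)

/-- `c_u = (Sq^0)^u(c_0)` with `c_0 = [λ_2 λ_3^2]`. -/
def cClass (u : ℕ) : HLambda := (Sq0 ^ u) (Submodule.Quotient.mk ⟨lam 2 * lam 3 ^ 2, c0_cycle⟩)

/-- The linear map `P_k → P_k` with `y ↦ x_1 ⋯ x_k y^2` on monomials `y` (in characteristic 2 squaring is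
additive), which induces the inverse of Kameko's homomorphism where that is an isomorphism. -/
def kamekoUp {k : ℕ} (f : P k) : P k := (∏ i, MvPolynomial.X i) * f ^ 2

/-- `p̄_0 = x_1 x_2 x_3^6 + x_1 x_2^6 x_3 + x_1^3 x_2 x_3^4 + x_1^3 x_2^4 x_3`. -/
def pBar0 : P 3 :=
  .X 0 * .X 1 * .X 2 ^ 6 + .X 0 * .X 1 ^ 6 * .X 2 + .X 0 ^ 3 * .X 1 * .X 2 ^ 4 + .X 0 ^ 3 * .X 1 ^ 4 * .X 2

end Singer

end

/-!
# Invariants of the hit problem in three variables and the Singer transfer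

The degrees `n = 2^{s+u+1} + 2^{u+1} + 2^u - 3` with fixed `s` satisfy `n_{u+1} = 2 n_u + 3`, and
`n_u + 2` is never a power of `2`. Kameko's homomorphism `kamekoDown`, which sends
`x_1 x_2 x_3 y^2` to `y` and kills the monomials with an even exponent, commutes with linear
substitutions (`kamekoDown_subst`) and halves the Steenrod operations. In degree `n_{u+1}` it is
an isomorphism modulo hit polynomials, with inverse `ψ` (`add_kamekoUp_mem_hit`,
`mem_hit_of_kamekoDown`): the defects are sums of polynomials `x_i w^2 = x_i Sq^d(w)` with
`d = n_u + 1`, and such polynomials are hit unless `d + 1` is a power of `2`. This reduces the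
computation of the invariants to `u = 0`, that is to degree `2^{s+1}`.

In degree `2^r` the derivatives `∂_w f(v)` at the points `v` over `F_2` vanish on hit polynomials
(`dirDeriv_hit`). If the class of `f` is invariant, the functional `w ↦ ∂_w f(v)` is invariant
under the stabilizer of `v`; it kills `v` by Euler's formula, and the stabilizer acts on
`F_2^3 / ⟨v⟩` as `GL_2`, so the functional is zero (`dirDeriv_eq_zero_of_invariant`). Conversely,
a form with vanishing derivatives is hit, up to `p̄_0` in degree `8` (`mem_hit_of_dirDeriv`). Up
to a square, such a form is `x_2 x_3 y_1^2 + x_1 x_3 y_2^2 + x_1 x_2 y_3^2`, and its derivatives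
vanish at `v` if and only if `y(v) = h(v) v` for some `h(v)`. If `h` is given by a form `H`,
subtracting the hit polynomial `Sq^1(x_1 x_2 x_3 H^2)` replaces `y_i` by `y_i - x_i H`, which
vanishes on the points, and it remains to show that such `y_i` are hit, after a change of the
`y_i` that removes a component (`pairForm_normalize`). Every function on the nonzero points is
given by a form of degree at least `3`, but quadratic forms are subject to the condition that the
values sum to zero (`exists_quadratic`). In degree `8`, where `H` is quadratic, this leaves one
more class, that of `p̄_0`. It is invariant because its substitutions have vanishing derivatives
as well (`pBar0_invariant`).

For the transfer, Singer's class satisfies a recursion (`fromLaurent_singerClass`) in which the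
class in one more variable has the values `∑ x_{k+1}^m Sq^j(f)`, `m + j = i`. So the
representative of the transfer of `b` in the lambda algebra is obtained from `b` by iterating
`singerStep` (`transferLam_succ`). Since `kamekoDown` halves exponents and Steenrod operations,
composition of `b` with it replaces `λ_i` by `λ_{2i+1}` in the representative
(`transferLam_kamekoDown`). In the degrees in question every `b` annihilated by the Steenrod
operations is such a composition (`eq_comp_kamekoDown`), which reduces the claim to `u = 0`. In
stem `8` the relations imposed on `b` by `Sq^1` and `Sq^2`, and those in the lambda algebra modulo
boundaries, show that the transfer of `b` is the class of `b(p̄_0) λ_2 λ_3^2`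
(`mkQ_transferLam_eight`). An explicit functional with value `1` on `p̄_0` is `dualEight`.
-/

noncomputable section

namespace Singer

open MvPolynomial (X C eval)

/-! ### Steenrod squares on polynomials -/

theorem totalSq_X {k : ℕ} (i : Fin k) : totalSq k (MvPolynomial.X i) =
    PowerSeries.C (MvPolynomial.X i) + PowerSeries.X * PowerSeries.C (MvPolynomial.X i ^ 2) := by
  simp [totalSq]

theorem Sq_X_mul_zero {k : ℕ} (i : Fin k) (f : P k) :
    Sq 0 (MvPolynomial.X i * f) = MvPolynomial.X i * Sq 0 f := by
  simp only [Sq, LinearMap.comp_apply, AlgHom.toLinearMap_apply, map_mul, totalSq_X, add_mul,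
    map_add, LinearMap.coe_restrictScalars, PowerSeries.coeff_C_mul, mul_assoc,
    PowerSeries.coeff_zero_X_mul, add_zero]

theorem Sq_X_mul {k : ℕ} (i : Fin k) (j : ℕ) (f : P k) : Sq (j + 1) (MvPolynomial.X i * f) =
    MvPolynomial.X i * Sq (j + 1) f + MvPolynomial.X i ^ 2 * Sq j f := by
  simp only [Sq, LinearMap.comp_apply, AlgHom.toLinearMap_apply, map_mul, totalSq_X, add_mul,
    map_add, LinearMap.coe_restrictScalars, PowerSeries.coeff_C_mul, mul_assoc,
    PowerSeries.coeff_succ_X_mul]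

theorem Sq_one_pos {k : ℕ} (j : ℕ) : Sq (j + 1) (1 : P k) = 0 := by
  simp [Sq, PowerSeries.coeff_one]

/-- Induction on polynomials over `F_2`: from `0` and `1`, by sums and multiplication by variables. -/
theorem poly_induction {k : ℕ} {p : P k → Prop} (h0 : p 0) (h1 : p 1)
    (hadd : ∀ f g, p f → p g → p (f + g))
    (hX : ∀ i f, p f → p (MvPolynomial.X i * f)) (f : P k) : p f := by
  induction f using MvPolynomial.induction_on with
  | C c =>
    have hc : c = 0 ∨ c = 1 := by revert c; decide
    rcases hc with rfl | rfl
    · simpa using h0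
    · simpa using h1
  | add f g hf hg => exact hadd f g hf hg
  | mul_X f i hf => rw [mul_comm]; exact hX i f hf

/-- Induction on monomials together with their degrees: from `1` in degree `0`, by multiplication by
variables. -/
theorem monomial_induction {k : ℕ} {p : P k → ℕ → Prop} (h1 : p 1 0)
    (hX : ∀ i f d, f.IsHomogeneous d → p f d → p (MvPolynomial.X i * f) (d + 1))
    (a : Fin k →₀ ℕ) : p (MvPolynomial.monomial a 1) a.degree := by
  obtain ⟨d, hd⟩ : ∃ d, d = a.degree := ⟨_, rfl⟩
  induction d generalizing a with
  | zero =>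
    have : a = 0 := (Finsupp.degree_eq_zero_iff a).mp hd.symm
    subst this
    simpa using h1
  | succ d ih =>
    have ha : a ≠ 0 := by rintro rfl; simp at hd
    obtain ⟨i, hi⟩ := Finsupp.ne_iff.mp ha
    obtain ⟨b, rfl⟩ : ∃ b, a = Finsupp.single i 1 + b := by
      refine ⟨a - Finsupp.single i 1, ?_⟩
      rw [add_tsub_cancel_of_le]
      rw [Finsupp.single_le_iff]
      exact Nat.one_le_iff_ne_zero.mpr hi
    have hb : d = b.degree := by simp at hd; omega
    have := hX i _ b.degree (MvPolynomial.isHomogeneous_monomial 1 rfl) (ih b hb)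
    rw [map_add, Finsupp.degree_single, add_comm 1]
    rwa [MvPolynomial.X, MvPolynomial.monomial_mul, one_mul] at this

/-- A property of homogeneous polynomials over `F_2` that is additive may be checked on monomials. -/
theorem homogeneous_induction {k d : ℕ} {p : P k → Prop} (h0 : p 0)
    (hadd : ∀ f g, p f → p g → p (f + g))
    (hmon : ∀ a : Fin k →₀ ℕ, a.degree = d → p (MvPolynomial.monomial a 1)) {f : P k}
    (hf : f.IsHomogeneous d) : p f := by
  rw [f.as_sum]
  refine Finset.sum_induction _ p hadd h0 fun a ha => ?_
  have hc : ∀ c : ZMod 2, c ≠ 0 → c = 1 := by decide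
  rw [hc _ (MvPolynomial.mem_support_iff.mp ha)]
  refine hmon a ?_
  have := hf (MvPolynomial.mem_support_iff.mp ha)
  rwa [Finsupp.degree_eq_weight_one]

theorem Sq_zero {k : ℕ} (f : P k) : Sq 0 f = f := by
  induction f using poly_induction with
  | h0 => simp
  | h1 => simp [Sq]
  | hadd f g hf hg => rw [map_add, hf, hg]
  | hX i f hf => rw [Sq_X_mul_zero, hf]

theorem Sq_isHomogeneous {k d : ℕ} (j : ℕ) {f : P k} (hf : f.IsHomogeneous d) :
    (Sq j f).IsHomogeneous (d + j) := by
  refine homogeneous_induction (p := fun f => (Sq j f).IsHomogeneous (d + j)) ?_ ?_ ?_ hf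
  · rw [map_zero]; exact MvPolynomial.isHomogeneous_zero _ _ _
  · intro f g hf hg; rw [map_add]; exact hf.add hg
  · rintro a rfl
    refine monomial_induction (p := fun f d => ∀ j, (Sq j f).IsHomogeneous (d + j)) ?_ ?_ a j
    · intro j
      cases j with
      | zero => rw [Sq_zero]; exact MvPolynomial.isHomogeneous_one _ _
      | succ j => rw [Sq_one_pos]; exact MvPolynomial.isHomogeneous_zero _ _ _
    · intro i f d hf ih j
      have hX := MvPolynomial.isHomogeneous_X (ZMod 2) i
      cases j with
      | zero => rw [Sq_zero, add_zero, add_comm]; exact hX.mul hf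
      | succ j =>
        rw [Sq_X_mul]
        refine MvPolynomial.IsHomogeneous.add ?_ ?_
        · have := hX.mul (ih (j + 1))
          rwa [show 1 + (d + (j + 1)) = d + 1 + (j + 1) by ring] at this
        · have := (hX.pow 2).mul (ih j)
          rwa [show 1 * 2 + (d + j) = d + 1 + (j + 1) by ring] at this

/-- `Sq^j` vanishes above the degree and is the squaring map in the degree itself. -/
theorem Sq_unstable {k d : ℕ} {f : P k} (hf : f.IsHomogeneous d) :
    Sq d f = f ^ 2 ∧ ∀ j, d < j → Sq j f = 0 := by
  refine homogeneous_induction (p := fun f => Sq d f = f ^ 2 ∧ ∀ j, d < j → Sq j f = 0) ?_ ?_ ?_ hf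
  · simp
  · rintro f g ⟨hf, hf'⟩ ⟨hg, hg'⟩
    refine ⟨?_, fun j hj => by rw [map_add, hf' j hj, hg' j hj, add_zero]⟩
    rw [map_add, hf, hg, add_pow_char]
  · rintro a rfl
    refine monomial_induction (p := fun f d => Sq d f = f ^ 2 ∧ ∀ j, d < j → Sq j f = 0) ?_ ?_ a
    · refine ⟨by rw [Sq_zero, one_pow], fun j hj => ?_⟩
      obtain ⟨j, rfl⟩ := Nat.exists_eq_succ_of_ne_zero hj.ne'
      exact Sq_one_pos j
    · rintro i f d - ⟨h1, h2⟩
      refine ⟨by rw [Sq_X_mul, h1, h2 _ (Nat.lt_succ_self d)]; ring, fun j hj => ?_⟩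
      obtain ⟨j, rfl⟩ := Nat.exists_eq_succ_of_ne_zero (by omega : j ≠ 0)
      rw [Nat.succ_eq_add_one, Sq_X_mul, h2 _ (by omega), h2 _ (by omega)]
      ring

theorem Sq_X_sq_mul_one {k : ℕ} (i : Fin k) (f : P k) :
    Sq 1 (MvPolynomial.X i ^ 2 * f) = MvPolynomial.X i ^ 2 * Sq 1 f := by
  rw [pow_two, mul_assoc, Sq_X_mul, Sq_X_mul, Sq_X_mul_zero]
  have := ZModModule.add_self (MvPolynomial.X i ^ 3 * Sq 0 f)
  linear_combination this

theorem Sq_X_sq_mul {k : ℕ} (i : Fin k) (j : ℕ) (f : P k) :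
    Sq (j + 2) (MvPolynomial.X i ^ 2 * f) =
      MvPolynomial.X i ^ 2 * Sq (j + 2) f + MvPolynomial.X i ^ 4 * Sq j f := by
  rw [pow_two, mul_assoc, Sq_X_mul, Sq_X_mul, Sq_X_mul]
  have := ZModModule.add_self (MvPolynomial.X i ^ 3 * Sq (j + 1) f)
  linear_combination this

/-- Squaring doubles the Steenrod operations: `Sq^{2j}(f^2) = Sq^j(f)^2`, and `Sq^{2j+1}(f^2) = 0`. -/
theorem Sq_sq {k : ℕ} (f : P k) (j : ℕ) :
    Sq (2 * j) (f ^ 2) = Sq j f ^ 2 ∧ Sq (2 * j + 1) (f ^ 2) = 0 := by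
  induction f using poly_induction generalizing j with
  | h0 => simp
  | h1 =>
    rw [one_pow, Sq_one_pos]
    cases j with
    | zero => simp [Sq_zero]
    | succ j => rw [show 2 * (j + 1) = 2 * j + 1 + 1 by ring, Sq_one_pos, Sq_one_pos]; simp
  | hadd f g hf hg =>
    rw [add_pow_char, map_add, map_add, map_add, (hf j).1, (hg j).1, (hf j).2, (hg j).2,
      add_pow_char, add_zero]
    exact ⟨rfl, rfl⟩
  | hX i f hf =>
    rw [mul_pow]
    cases j with
    | zero =>
      refine ⟨by rw [mul_zero, Sq_zero, Sq_zero, mul_pow], ?_⟩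
      rw [mul_zero, zero_add, Sq_X_sq_mul_one, (hf 0).2, mul_zero]
    | succ j =>
      constructor
      · rw [show 2 * (j + 1) = 2 * j + 2 by ring, Sq_X_sq_mul, (hf j).1,
          show 2 * j + 2 = 2 * (j + 1) by ring, (hf (j + 1)).1, Sq_X_mul, add_pow_char]
        ring
      · rw [show 2 * (j + 1) + 1 = 2 * j + 1 + 2 by ring, Sq_X_sq_mul, (hf j).2,
          show 2 * j + 1 + 2 = 2 * (j + 1) + 1 by ring, (hf (j + 1)).2]
        simp

theorem Sq_even_sq {k : ℕ} (f : P k) (j : ℕ) : Sq (2 * j) (f ^ 2) = Sq j f ^ 2 := (Sq_sq f j).1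

theorem Sq_odd_sq {k : ℕ} (f : P k) (j : ℕ) : Sq (2 * j + 1) (f ^ 2) = 0 := (Sq_sq f j).2

/-! ### Hit polynomials -/

theorem Sq_mem_hit {k : ℕ} (j : ℕ) (f : P k) : Sq (j + 1) f ∈ hit k :=
  Submodule.mem_iSup_of_mem j ⟨f, rfl⟩

theorem Sq_mem_hit' {k j : ℕ} (hj : 0 < j) (f : P k) : Sq j f ∈ hit k := by
  obtain ⟨j, rfl⟩ := Nat.exists_eq_succ_of_ne_zero hj.ne'
  exact Sq_mem_hit j f

/-- An additive condition that holds for all `Sq^{j+1}` of monomials holds for all hit polynomials. -/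
theorem hit_le_of_monomial {k : ℕ} {W : Submodule (ZMod 2) (P k)}
    (h : ∀ (j : ℕ) (a : Fin k →₀ ℕ), Sq (j + 1) (MvPolynomial.monomial a 1) ∈ W) : hit k ≤ W := by
  refine iSup_le fun j => ?_
  rintro _ ⟨f, rfl⟩
  induction f using MvPolynomial.induction_on' with
  | monomial a c =>
    have hc : c = 0 ∨ c = 1 := by revert c; decide
    rcases hc with rfl | rfl
    · simp
    · exact h j a
  | add f g hf hg => rw [map_add]; exact add_mem hf hg

theorem sq_mem_hit {k d : ℕ} (hd : 0 < d) {f : P k} (hf : f.IsHomogeneous d) : f ^ 2 ∈ hit k := by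
  rw [← (Sq_unstable hf).1]
  exact Sq_mem_hit' hd f

theorem X_mul_sq_mem_hit {k : ℕ} (i : Fin k) (f : P k) : (MvPolynomial.X i * f) ^ 2 ∈ hit k := by
  induction f using MvPolynomial.induction_on' with
  | monomial a c =>
    have h := (MvPolynomial.isHomogeneous_X (ZMod 2) i).mul
      (MvPolynomial.isHomogeneous_monomial c (rfl : a.degree = a.degree))
    exact sq_mem_hit (by omega) h
  | add f g hf hg => rw [mul_add, add_pow_char]; exact add_mem hf hg

/-- The set of `y` with `f y^2` hit. -/
def hitOver {k : ℕ} (f : P k) : Submodule (ZMod 2) (P k) where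
  carrier := {y | f * y ^ 2 ∈ hit k}
  zero_mem' := by simp
  add_mem' := by
    intro y z hy hz
    change f * (y + z) ^ 2 ∈ hit k
    rw [add_pow_char, mul_add]
    exact add_mem hy hz
  smul_mem' := by
    intro c y hy
    change f * (c • y) ^ 2 ∈ hit k
    rw [smul_pow, mul_smul_comm]
    exact Submodule.smul_mem _ _ hy

theorem X_mul_sq_of_hit {k : ℕ} (i : Fin k) {y : P k} (hy : y ∈ hit k) :
    MvPolynomial.X i * y ^ 2 ∈ hit k := by
  have : hit k ≤ hitOver (MvPolynomial.X i) := by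
    refine hit_le_of_monomial fun j a => ?_
    change MvPolynomial.X i * _ ^ 2 ∈ hit k
    have h := Sq_X_mul i (2 * j + 1) (MvPolynomial.monomial a 1 ^ 2)
    rw [Sq_odd_sq, mul_zero, add_zero, show 2 * j + 1 + 1 = 2 * (j + 1) by ring, Sq_even_sq] at h
    rw [← h]
    exact Sq_mem_hit' (by omega) _
  exact this hy

/-- `x_i x_j Sq^{m+1}(z)^2` is congruent to `Sq^{2m+2}(x_i x_j z^2)` up to a square, and squares of positive
degree are hit. -/
theorem X_mul_X_mul_sq_of_hit {k : ℕ} (i j : Fin k) {y : P k} (hy : y ∈ hit k) :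
    MvPolynomial.X i * MvPolynomial.X j * y ^ 2 ∈ hit k := by
  have : hit k ≤ hitOver (MvPolynomial.X i * MvPolynomial.X j) := by
    refine hit_le_of_monomial fun m a => ?_
    change MvPolynomial.X i * MvPolynomial.X j * _ ^ 2 ∈ hit k
    set z : P k := MvPolynomial.monomial a 1
    have h : Sq (2 * m + 1 + 1) (MvPolynomial.X i * (MvPolynomial.X j * z ^ 2)) =
        MvPolynomial.X i * MvPolynomial.X j * Sq (m + 1) z ^ 2 +
          (MvPolynomial.X i * (MvPolynomial.X j * Sq m z)) ^ 2 := by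
      rw [Sq_X_mul, Sq_X_mul, Sq_X_mul, Sq_odd_sq, Sq_even_sq,
        show 2 * m + 1 + 1 = 2 * (m + 1) by ring, Sq_even_sq]
      ring
    have h' := add_mem (Sq_mem_hit (2 * m + 1) (MvPolynomial.X i * (MvPolynomial.X j * z ^ 2)))
      (X_mul_sq_mem_hit i (MvPolynomial.X j * Sq m z))
    rwa [h, add_assoc, ZModModule.add_self, add_zero] at h'
  exact this hy

/-- The total square of `x^{2^r}` is `x^{2^r} + x^{2^{r+1}}`; this is the Cartan formula for products with
`x^{2^r}`. -/
theorem Sq_X_pow_mul {k : ℕ} (i : Fin k) (r : ℕ) (f : P k) :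
    (∀ j, j < 2 ^ r → Sq j (MvPolynomial.X i ^ 2 ^ r * f) = MvPolynomial.X i ^ 2 ^ r * Sq j f) ∧
    ∀ j, Sq (j + 2 ^ r) (MvPolynomial.X i ^ 2 ^ r * f) =
      MvPolynomial.X i ^ 2 ^ r * Sq (j + 2 ^ r) f + MvPolynomial.X i ^ 2 ^ (r + 1) * Sq j f := by
  induction r generalizing f with
  | zero =>
    refine ⟨fun j hj => ?_, fun j => ?_⟩
    · obtain rfl : j = 0 := by simpa using hj
      rw [Sq_zero, Sq_zero]
    · simpa using Sq_X_mul i j f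
  | succ r ih =>
    have e1 : ∀ g : P k, MvPolynomial.X i ^ 2 ^ (r + 1) * g =
        MvPolynomial.X i ^ 2 ^ r * (MvPolynomial.X i ^ 2 ^ r * g) := fun g => by ring
    have e2 : (MvPolynomial.X i ^ 2 ^ (r + 1) : P k) =
        MvPolynomial.X i ^ 2 ^ r * MvPolynomial.X i ^ 2 ^ r := by ring
    have e3 : (MvPolynomial.X i ^ 2 ^ (r + 1 + 1) : P k) = MvPolynomial.X i ^ 2 ^ r *
        MvPolynomial.X i ^ 2 ^ r * (MvPolynomial.X i ^ 2 ^ r * MvPolynomial.X i ^ 2 ^ r) := by ring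
    refine ⟨fun j hj => ?_, fun j => ?_⟩
    · rcases lt_or_ge j (2 ^ r) with h | h
      · rw [e1, (ih _).1 j h, (ih _).1 j h, e1]
      · obtain ⟨j, rfl⟩ := Nat.exists_eq_add_of_le' h
        have hj : j < 2 ^ r := by rw [pow_succ] at hj; omega
        rw [e1, (ih _).2 j, (ih _).2 j, (ih _).1 j hj, e1, e1]
        have := ZModModule.add_self (MvPolynomial.X i ^ 2 ^ r * (MvPolynomial.X i ^ 2 ^ r *
          (MvPolynomial.X i ^ 2 ^ r * Sq j f)))
        linear_combination this
    · rw [e1, show j + 2 ^ (r + 1) = j + 2 ^ r + 2 ^ r by ring, (ih _).2, (ih _).2, (ih _).2, e2, e3]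
      have := ZModModule.add_self (MvPolynomial.X i ^ 2 ^ r * (MvPolynomial.X i ^ 2 ^ r *
          (MvPolynomial.X i ^ 2 ^ r * Sq (j + 2 ^ r) f)))
      linear_combination this

/-- Moving `Sq^e` across a power of a variable: `x^{2^r} Sq^e(f)` is congruent modulo hit polynomials to
`x^{2^{r+1}} Sq^{e-2^r}(f)`, so the process ends in `0` unless `e + 2^r` is a power of `2`. -/
theorem X_pow_mul_Sq_mem_hit {k : ℕ} (i : Fin k) (e r : ℕ) (f : P k) (he : 0 < e)
    (h : ∀ m, e + 2 ^ r ≠ 2 ^ m) : MvPolynomial.X i ^ 2 ^ r * Sq e f ∈ hit k := by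
  induction e using Nat.strong_induction_on generalizing r with
  | _ e ih =>
    have hh := Sq_mem_hit' he (MvPolynomial.X i ^ 2 ^ r * f)
    rcases lt_or_ge e (2 ^ r) with hlt | hge
    · rwa [(Sq_X_pow_mul i r f).1 e hlt] at hh
    · obtain ⟨j, rfl⟩ := Nat.exists_eq_add_of_le' hge
      have hr := Nat.two_pow_pos r
      have h2 : ∀ m, j + 2 ^ (r + 1) ≠ 2 ^ m := fun m => by
        have := h m; rw [pow_succ]; omega
      have hj : 0 < j := by
        rcases Nat.eq_zero_or_pos j with rfl | hj
        · exact absurd (zero_add _) (h2 (r + 1))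
        · exact hj
      have h3 := ih j (by omega) (r + 1) hj h2
      rw [(Sq_X_pow_mul i r f).2 j] at hh
      have := sub_mem hh h3
      rwa [add_sub_cancel_right] at this

/-- Since `w^2 = Sq^d(w)`, the polynomial `x_i w^2` is hit unless `d + 1` is a power of `2`. -/
theorem X_mul_sq_mem_hit_of_degree {k d : ℕ} (i : Fin k) {w : P k} (hw : w.IsHomogeneous d)
    (hd : 0 < d) (h : ∀ m, d + 1 ≠ 2 ^ m) : MvPolynomial.X i * w ^ 2 ∈ hit k := by
  rw [← (Sq_unstable hw).1]
  have := X_pow_mul_Sq_mem_hit i d 0 w hd (by simpa using h)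
  simpa using this

/-! ### Square roots of parity components -/

/-- For a set `S` of variables, the square root of the cofactor of `∏_{i ∈ S} x_i` in a polynomial: the
linear map with `(∏_{i ∈ S} x_i) y^2 ↦ y` for monomials `y`, which kills the monomials in which the set
of variables with odd exponent is not `S`. For `S` the set of all variables it is the map underlying
Kameko's homomorphism. -/
def half {k : ℕ} (S : Finset (Fin k)) : P k →ₗ[ZMod 2] P k :=
  (MvPolynomial.basisMonomials (Fin k) (ZMod 2)).constr (ZMod 2) fun a =>
    if ∀ i, a i % 2 = if i ∈ S then 1 else 0 then
      MvPolynomial.monomial (a.mapRange (· / 2) (by simp)) 1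
    else 0

theorem half_monomial {k : ℕ} (S : Finset (Fin k)) (a : Fin k →₀ ℕ) :
    half S (MvPolynomial.monomial a 1) = if ∀ i, a i % 2 = if i ∈ S then 1 else 0 then
      MvPolynomial.monomial (a.mapRange (· / 2) (by simp)) 1 else 0 := by
  have := (MvPolynomial.basisMonomials (Fin k) (ZMod 2)).constr_basis (ZMod 2) (fun a =>
    if ∀ i, a i % 2 = if i ∈ S then 1 else 0 then
      (MvPolynomial.monomial (a.mapRange (· / 2) (by simp)) 1 : P k) else 0) a
  rwa [MvPolynomial.coe_basisMonomials] at this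

/-- An additive property of polynomials over `F_2` may be checked on monomials. -/
theorem additive_induction {k : ℕ} {p : P k → Prop} (h0 : p 0)
    (hadd : ∀ f g, p f → p g → p (f + g)) (hmon : ∀ a, p (MvPolynomial.monomial a 1)) (f : P k) :
    p f := by
  induction f using MvPolynomial.induction_on' with
  | monomial a c =>
    have hc : c = 0 ∨ c = 1 := by revert c; decide
    rcases hc with rfl | rfl
    · simpa using h0
    · exact hmon a
  | add f g hf hg => exact hadd f g hf hg

theorem half_mul_sq {k : ℕ} (S : Finset (Fin k)) (f w : P k) :
    half S (f * w ^ 2) = w * half S f := by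
  induction w using MvPolynomial.induction_on' with
  | monomial b c =>
    have hc : c = 0 ∨ c = 1 := by revert c; decide
    rcases hc with rfl | rfl
    · simp
    refine additive_induction (p := fun f => half S (f * MvPolynomial.monomial b 1 ^ 2) =
      MvPolynomial.monomial b 1 * half S f) (by simp) (fun f g hf hg => ?_) (fun a => ?_) f
    · rw [add_mul, map_add, hf, hg, map_add, mul_add]
    simp only [MvPolynomial.monomial_pow, MvPolynomial.monomial_mul, one_pow, mul_one, half_monomial]
    have hiff : (∀ i, (a + 2 • b) i % 2 = if i ∈ S then 1 else 0) ↔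
        ∀ i, a i % 2 = if i ∈ S then 1 else 0 := by
      refine forall_congr' fun i => ?_
      simp
    rw [if_congr hiff rfl rfl]
    split_ifs
    · rw [MvPolynomial.monomial_mul, one_mul]
      refine congrArg (fun e => MvPolynomial.monomial e 1) (Finsupp.ext fun i => ?_)
      simp only [Finsupp.mapRange_apply, Finsupp.add_apply, Finsupp.smul_apply, smul_eq_mul]
      omega
    · rw [mul_zero]
  | add v w hv hw => rw [add_pow_char, mul_add, map_add, hv, hw, add_mul]

theorem half_X_mul_of_mem {k : ℕ} {S : Finset (Fin k)} {j : Fin k} (hj : j ∈ S) (f : P k) :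
    half S (MvPolynomial.X j * f) = half (S.erase j) f := by
  refine additive_induction (p := fun f => half S (MvPolynomial.X j * f) = half (S.erase j) f)
    (by simp) (fun f g hf hg => ?_) (fun a => ?_) f
  · rw [mul_add, map_add, hf, hg, map_add]
  simp only [MvPolynomial.X, MvPolynomial.monomial_mul, one_mul, half_monomial]
  have hiff : (∀ i, (Finsupp.single j 1 + a : Fin k →₀ ℕ) i % 2 = if i ∈ S then 1 else 0) ↔
      ∀ i, a i % 2 = if i ∈ S.erase j then 1 else 0 := by
    refine forall_congr' fun i => ?_
    by_cases h : i = j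
    · subst h; simp [hj]; omega
    · simp [h]
  rw [if_congr hiff rfl rfl]
  split_ifs with h
  · refine congrArg (fun e => MvPolynomial.monomial e 1) (Finsupp.ext fun i => ?_)
    have := h i
    by_cases hi : i = j
    · subst hi; simp at this ⊢; omega
    · simp [hi]
  · rfl

theorem half_X_mul_of_notMem {k : ℕ} {S : Finset (Fin k)} {j : Fin k} (hj : j ∉ S) (f : P k) :
    half S (MvPolynomial.X j * f) = MvPolynomial.X j * half (insert j S) f := by
  refine additive_induction (p := fun f => half S (MvPolynomial.X j * f) =
    MvPolynomial.X j * half (insert j S) f) (by simp) (fun f g hf hg => ?_) (fun a => ?_) f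
  · rw [mul_add, map_add, hf, hg, map_add, mul_add]
  simp only [MvPolynomial.X, MvPolynomial.monomial_mul, one_mul, half_monomial]
  have hiff : (∀ i, (Finsupp.single j 1 + a : Fin k →₀ ℕ) i % 2 = if i ∈ S then 1 else 0) ↔
      ∀ i, a i % 2 = if i ∈ insert j S then 1 else 0 := by
    refine forall_congr' fun i => ?_
    by_cases h : i = j
    · subst h; simp [hj]; omega
    · simp [h]
  rw [if_congr hiff rfl rfl]
  split_ifs with h
  · rw [MvPolynomial.monomial_mul, one_mul]
    refine congrArg (fun e => MvPolynomial.monomial e 1) (Finsupp.ext fun i => ?_)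
    have := h i
    by_cases hi : i = j
    · subst hi; simp at this ⊢; omega
    · simp [hi]
  · rw [mul_zero]

theorem half_empty_one {k : ℕ} : half (∅ : Finset (Fin k)) 1 = 1 := by
  have := half_monomial (∅ : Finset (Fin k)) 0
  rw [MvPolynomial.monomial_zero', map_one] at this
  rw [this, if_pos (by simp)]
  have h0 : Finsupp.mapRange (· / 2) (by simp) (0 : Fin k →₀ ℕ) = 0 := by ext; simp
  rw [h0, MvPolynomial.monomial_zero', map_one]

theorem half_empty_sq {k : ℕ} (w : P k) : half ∅ (w ^ 2) = w := by
  have := half_mul_sq ∅ 1 w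
  rwa [one_mul, half_empty_one, mul_one] at this

theorem half_prod {k : ℕ} (S : Finset (Fin k)) (f : P k) :
    half S ((∏ i ∈ S, MvPolynomial.X i) * f) = half ∅ f := by
  induction S using Finset.induction_on with
  | empty => rw [Finset.prod_empty, one_mul]
  | insert j S hj ih =>
    rw [Finset.prod_insert hj, mul_assoc, half_X_mul_of_mem (Finset.mem_insert_self j S),
      Finset.erase_insert hj, ih]

/-- Every polynomial is the sum of its parity components `(∏_{i ∈ S} x_i) y_S^2`. -/
theorem sum_parity {k : ℕ} (f : P k) :
    ∑ S : Finset (Fin k), (∏ i ∈ S, MvPolynomial.X i) * half S f ^ 2 = f := by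
  induction f using MvPolynomial.induction_on' with
  | monomial a c =>
    have hc : c = 0 ∨ c = 1 := by revert c; decide
    rcases hc with rfl | rfl
    · simp
    rw [Finset.sum_eq_single (Finset.univ.filter fun i => a i % 2 = 1)]
    · rw [half_monomial, if_pos]
      · rw [MvPolynomial.monomial_eq, MvPolynomial.monomial_eq, map_one, one_mul, one_mul,
          Finsupp.prod_fintype _ _ (by simp), Finsupp.prod_fintype _ _ (by simp),
          ← Finset.prod_pow, Finset.prod_filter, ← Finset.prod_mul_distrib]
        refine Finset.prod_congr rfl fun i _ => ?_
        simp only [Finsupp.mapRange_apply]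
        split_ifs with h
        · rw [← pow_mul, ← pow_succ']; congr 1; omega
        · rw [← pow_mul, one_mul]; congr 1; omega
      · intro i
        simp only [Finset.mem_filter, Finset.mem_univ, true_and]
        split_ifs with h <;> omega
    · intro S _ hS
      rw [half_monomial, if_neg]
      · rw [zero_pow two_ne_zero, mul_zero]
      · intro h
        apply hS
        ext i
        have := h i
        simp only [Finset.mem_filter, Finset.mem_univ, true_and]
        split_ifs at this with hi
        · simp [hi, this]
        · simp [hi, this]
    · simp
  | add f g hf hg =>
    conv_rhs => rw [← hf, ← hg]
    rw [← Finset.sum_add_distrib]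
    refine Finset.sum_congr rfl fun S _ => ?_
    rw [map_add, add_pow_char, mul_add]

theorem degree_of_parity {k : ℕ} {S : Finset (Fin k)} {a : Fin k →₀ ℕ}
    (h : ∀ i, a i % 2 = if i ∈ S then 1 else 0) :
    a.degree = 2 * (a.mapRange (· / 2) (by simp) : Fin k →₀ ℕ).degree + S.card := by
  rw [Finsupp.degree_eq_sum, Finsupp.degree_eq_sum, Finset.mul_sum,
    show S.card = ∑ i, if i ∈ S then 1 else 0 by simp, ← Finset.sum_add_distrib]
  refine Finset.sum_congr rfl fun i _ => ?_
  have := h i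
  simp only [Finsupp.mapRange_apply]
  omega

theorem half_isHomogeneous {k e : ℕ} (S : Finset (Fin k)) {f : P k}
    (hf : f.IsHomogeneous (2 * e + S.card)) : (half S f).IsHomogeneous e := by
  refine homogeneous_induction (p := fun f => (half S f).IsHomogeneous e) ?_ ?_ ?_ hf
  · rw [map_zero]; exact MvPolynomial.isHomogeneous_zero _ _ _
  · intro f g hf hg; rw [map_add]; exact hf.add hg
  · intro a ha
    rw [half_monomial]
    split_ifs with h
    · refine MvPolynomial.isHomogeneous_monomial 1 ?_
      have := degree_of_parity h
      omega
    · exact MvPolynomial.isHomogeneous_zero _ _ _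

theorem half_eq_zero_of_degree {k d : ℕ} (S : Finset (Fin k)) {f : P k} (hf : f.IsHomogeneous d)
    (hd : ∀ e, d ≠ 2 * e + S.card) : half S f = 0 := by
  refine homogeneous_induction (p := fun f => half S f = 0) (map_zero _) ?_ ?_ hf
  · intro f g hf hg; rw [map_add, hf, hg, add_zero]
  · intro a ha
    rw [half_monomial, if_neg]
    intro h
    exact hd _ (ha ▸ degree_of_parity h)

/-- Steenrod squares do not enlarge the set of variables with odd exponent. -/
theorem half_Sq_eq_zero {k : ℕ} (S : Finset (Fin k)) (w : P k) (U : Finset (Fin k)) (n : ℕ)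
    (hU : ¬ U ⊆ S) : half U (Sq n ((∏ i ∈ S, MvPolynomial.X i) * w ^ 2)) = 0 := by
  induction S using Finset.induction_on generalizing U n with
  | empty =>
    rw [Finset.prod_empty, one_mul]
    have hw : ∀ v : P k, half U (v ^ 2) = 0 := by
      intro v
      have h1 : half U (1 : P k) = 0 := by
        refine half_eq_zero_of_degree U (MvPolynomial.isHomogeneous_one _ _) fun e he => ?_
        have : U.card ≠ 0 := by
          rw [Finset.card_ne_zero]
          exact Finset.nonempty_iff_ne_empty.mpr fun h => hU (by rw [h])
        omega
      rw [← one_mul (v ^ 2), half_mul_sq, h1, mul_zero]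
    obtain ⟨m, rfl | rfl⟩ := Nat.even_or_odd' n
    · rw [Sq_even_sq, hw]
    · rw [Sq_odd_sq, map_zero]
  | insert j S hj ih =>
    rw [Finset.prod_insert hj, mul_assoc]
    have hX : ∀ n, half U (MvPolynomial.X j * Sq n ((∏ i ∈ S, MvPolynomial.X i) * w ^ 2)) = 0 := by
      intro n
      by_cases hjU : j ∈ U
      · rw [half_X_mul_of_mem hjU, ih]
        rwa [← Finset.subset_insert_iff]
      · rw [half_X_mul_of_notMem hjU, ih, mul_zero]
        exact fun h => hjU (absurd ((Finset.subset_insert j U).trans h) fun h' =>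
          hU (h'.trans (Finset.subset_insert j S)))
    have hX2 : ∀ n, half U (MvPolynomial.X j ^ 2 * Sq n ((∏ i ∈ S, MvPolynomial.X i) * w ^ 2)) = 0 := by
      intro n
      rw [mul_comm, half_mul_sq, ih, mul_zero]
      exact fun h => hU (h.trans (Finset.subset_insert j S))
    cases n with
    | zero => rw [Sq_X_mul_zero, hX]
    | succ n => rw [Sq_X_mul, map_add, hX, hX2, add_zero]

/-- The component of `Sq^n(x_S w^2)`, `x_S = ∏_{i ∈ S} x_i`, in which all variables of `S` keep an odd exponent
is `x_S Sq^n(w^2)`: a square that acts on a factor `x_i` makes its exponent even. -/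
theorem half_Sq_prod {k : ℕ} (S : Finset (Fin k)) (w : P k) (n : ℕ) :
    half S (Sq n ((∏ i ∈ S, MvPolynomial.X i) * w ^ 2)) = half ∅ (Sq n (w ^ 2)) := by
  induction S using Finset.induction_on generalizing n with
  | empty => rw [Finset.prod_empty, one_mul]
  | insert j S hj ih =>
    have hX : half (insert j S) (MvPolynomial.X j * Sq n ((∏ i ∈ S, MvPolynomial.X i) * w ^ 2)) =
        half ∅ (Sq n (w ^ 2)) := by
      rw [half_X_mul_of_mem (Finset.mem_insert_self j S), Finset.erase_insert hj, ih]
    rw [Finset.prod_insert hj, mul_assoc]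
    cases n with
    | zero => rw [Sq_X_mul_zero, hX]
    | succ n =>
      rw [Sq_X_mul, map_add, hX, mul_comm (MvPolynomial.X j ^ 2), half_mul_sq, half_Sq_eq_zero,
        mul_zero, add_zero]
      exact fun h => hj (h (Finset.mem_insert_self j S))

/-! ### Kameko's homomorphism -/

/-- Kameko's homomorphism `P_k → P_k`, with `x_1 ⋯ x_k y^2 ↦ y` and all other monomials sent to `0`. -/
abbrev kamekoDown {k : ℕ} : P k →ₗ[ZMod 2] P k := half Finset.univ

/-- By `half_Sq_eq_zero` and `half_Sq_prod` only the component `x_1 ⋯ x_k y^2` of `f` contributes to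
`kamekoDown (Sq n f)`. -/
theorem kamekoDown_Sq {k : ℕ} (n : ℕ) (f : P k) :
    kamekoDown (Sq n f) = half ∅ (Sq n (kamekoDown f ^ 2)) := by
  conv_lhs => rw [← sum_parity f]
  rw [map_sum, map_sum, Finset.sum_eq_single Finset.univ]
  · exact half_Sq_prod _ _ _
  · intro S _ hS
    refine half_Sq_eq_zero _ _ _ _ fun h => hS ?_
    exact Finset.univ_subset_iff.mp h
  · simp

theorem kamekoDown_Sq_even {k : ℕ} (j : ℕ) (f : P k) :
    kamekoDown (Sq (2 * j) f) = Sq j (kamekoDown f) := by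
  rw [kamekoDown_Sq, Sq_even_sq, half_empty_sq]

theorem kamekoDown_Sq_odd {k : ℕ} (j : ℕ) (f : P k) : kamekoDown (Sq (2 * j + 1) f) = 0 := by
  rw [kamekoDown_Sq, Sq_odd_sq, map_zero]

theorem kamekoDown_kamekoUp {k : ℕ} (f : P k) : kamekoDown (kamekoUp f) = f := by
  rw [kamekoUp, half_prod, half_empty_sq]

theorem kamekoDown_hit {k : ℕ} {f : P k} (hf : f ∈ hit k) : kamekoDown f ∈ hit k := by
  have : hit k ≤ (hit k).comap kamekoDown := by
    refine iSup_le fun j => ?_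
    rintro _ ⟨f, rfl⟩
    change kamekoDown (Sq (j + 1) f) ∈ hit k
    obtain ⟨m, hm | hm⟩ := Nat.even_or_odd' (j + 1)
    · rw [hm, kamekoDown_Sq_even]
      exact Sq_mem_hit' (by omega) _
    · rw [hm, kamekoDown_Sq_odd]; exact zero_mem _
  exact this hf

theorem kamekoUp_add {k : ℕ} (f g : P k) : kamekoUp (f + g) = kamekoUp f + kamekoUp g := by
  rw [kamekoUp, add_pow_char, mul_add]; rfl

theorem kamekoUp_smul {k : ℕ} (c : ZMod 2) (f : P k) : kamekoUp (c • f) = c • kamekoUp f := by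
  have hc : c ^ 2 = c := by revert c; decide
  rw [kamekoUp, smul_pow, hc, mul_smul_comm]; rfl

theorem kamekoUp_isHomogeneous {k d : ℕ} {f : P k} (hf : f.IsHomogeneous d) :
    (kamekoUp f).IsHomogeneous (2 * d + k) := by
  have h1 : (∏ i : Fin k, MvPolynomial.X i : P k).IsHomogeneous (∑ _i : Fin k, 1) :=
    MvPolynomial.IsHomogeneous.prod _ _ _ fun i _ => MvPolynomial.isHomogeneous_X _ i
  have := h1.mul (hf.pow 2)
  rwa [Finset.sum_const, Finset.card_univ, Fintype.card_fin, smul_eq_mul, mul_one,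
    show k + d * 2 = 2 * d + k by ring] at this

theorem kamekoDown_isHomogeneous {k d : ℕ} {f : P k} (hf : f.IsHomogeneous (2 * d + k)) :
    (kamekoDown f).IsHomogeneous d :=
  half_isHomogeneous _ (by rwa [Finset.card_univ, Fintype.card_fin])

/-! ### Equivariance of Kameko's homomorphism -/

theorem subst_X {k : ℕ} (g : GL (Fin k) (ZMod 2)) (j : Fin k) :
    subst g (MvPolynomial.X j) = ∑ i, MvPolynomial.C (g.1 i j) * MvPolynomial.X i := by
  simp [subst]

theorem subst_isHomogeneous {k d : ℕ} (g : GL (Fin k) (ZMod 2)) {f : P k} (hf : f.IsHomogeneous d) :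
    (subst g f).IsHomogeneous d := by
  have := MvPolynomial.IsHomogeneous.aeval hf (fun j => ∑ i, MvPolynomial.C (g.1 i j) * MvPolynomial.X i)
    (n := 1) (fun j => MvPolynomial.IsHomogeneous.sum _ _ _ fun i _ => by
      have := (MvPolynomial.isHomogeneous_C (Fin k) (g.1 i j)).mul
        (MvPolynomial.isHomogeneous_X (ZMod 2) i)
      rwa [zero_add] at this)
  rwa [one_mul] at this

theorem subst_one {k : ℕ} (f : P k) : subst 1 f = f := by
  have : subst (1 : GL (Fin k) (ZMod 2)) = AlgHom.id (ZMod 2) (P k) := by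
    apply MvPolynomial.algHom_ext
    intro j
    rw [subst_X]
    simp [Matrix.one_apply]
  rw [this]; rfl

theorem subst_mul {k : ℕ} (g h : GL (Fin k) (ZMod 2)) (f : P k) :
    subst (g * h) f = subst g (subst h f) := by
  have : subst (g * h) = (subst g).comp (subst h) := by
    apply MvPolynomial.algHom_ext
    intro j
    rw [AlgHom.comp_apply, subst_X, subst_X, map_sum]
    have hC : ∀ c, subst g (MvPolynomial.C c) = MvPolynomial.C c := fun c => (subst g).commutes c
    simp only [map_mul, subst_X, hC, Finset.mul_sum]
    rw [Finset.sum_comm]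
    refine Finset.sum_congr rfl fun i _ => ?_
    rw [Units.val_mul, Matrix.mul_apply, map_sum, Finset.sum_mul]
    refine Finset.sum_congr rfl fun m _ => ?_
    rw [map_mul]; ring
  rw [this]; rfl

/-- Only `x_1 ⋯ x_k y^2` contributes to the left side: a substitution turns a product of fewer than `k`
variables into a polynomial of degree less than `k`, in which no monomial contains all variables. -/
theorem kamekoDown_subst_aux {k : ℕ} (g : GL (Fin k) (ZMod 2)) (f : P k) :
    kamekoDown (subst g f) =
      kamekoDown (subst g (∏ i, MvPolynomial.X i)) * subst g (kamekoDown f) := by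
  conv_lhs => rw [← sum_parity f]
  rw [map_sum, map_sum, Finset.sum_eq_single Finset.univ]
  · rw [map_mul, map_pow, half_mul_sq, mul_comm]
  · intro S _ hS
    rw [map_mul, map_pow, half_mul_sq]
    have h1 : (∏ i ∈ S, MvPolynomial.X i : P k).IsHomogeneous S.card := by
      have := MvPolynomial.IsHomogeneous.prod S (fun i => (MvPolynomial.X i : P k)) (fun _ => 1)
        fun i _ => MvPolynomial.isHomogeneous_X _ i
      rwa [Finset.sum_const, smul_eq_mul, mul_one] at this
    rw [half_eq_zero_of_degree _ (subst_isHomogeneous g h1), mul_zero]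
    intro e he
    have := (Finset.card_lt_iff_ne_univ S).mpr hS
    rw [Finset.card_univ] at he
    omega
  · simp

/-- Kameko's homomorphism commutes with linear substitutions: the factor by which the two sides could
differ is a homomorphism `GL_k → F_2`, with values in the units. -/
theorem kamekoDown_subst {k : ℕ} (g : GL (Fin k) (ZMod 2)) (f : P k) :
    kamekoDown (subst g f) = subst g (kamekoDown f) := by
  have hc : ∀ g : GL (Fin k) (ZMod 2), ∃ c : ZMod 2,
      kamekoDown (subst g (∏ i, MvPolynomial.X i)) = MvPolynomial.C c := by
    intro g
    have h1 : (∏ i : Fin k, MvPolynomial.X i : P k).IsHomogeneous (2 * 0 + k) := by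
      simpa using MvPolynomial.IsHomogeneous.prod Finset.univ (fun i => (MvPolynomial.X i : P k))
        (fun _ => 1) fun i _ => MvPolynomial.isHomogeneous_X _ i
    have := kamekoDown_isHomogeneous (subst_isHomogeneous g h1)
    rw [← MvPolynomial.totalDegree_zero_iff_isHomogeneous,
      MvPolynomial.totalDegree_eq_zero_iff_eq_C] at this
    exact ⟨_, this⟩
  obtain ⟨c, h⟩ := hc g
  obtain ⟨c', h'⟩ := hc g⁻¹
  have h1 := kamekoDown_subst_aux g (subst g⁻¹ (∏ i, MvPolynomial.X i))
  rw [← subst_mul, mul_inv_cancel, subst_one, h, h'] at h1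
  have h2 : kamekoDown (∏ i : Fin k, MvPolynomial.X i : P k) = 1 := by
    have := half_prod (Finset.univ : Finset (Fin k)) 1
    rwa [mul_one, half_empty_one] at this
  have hC : subst g (MvPolynomial.C c') = MvPolynomial.C c' := (subst g).commutes c'
  rw [h2, hC, ← map_mul] at h1
  have h3 : c * c' = 1 := by
    rw [← map_one MvPolynomial.C] at h1
    exact (MvPolynomial.C_injective _ _ h1).symm
  have h4 : ∀ a b : ZMod 2, a * b = 1 → a = 1 := by decide
  rw [kamekoDown_subst_aux, h, h4 c c' h3, map_one, one_mul]

/-! ### Directional derivatives at points over `F_2` -/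

/-- `f ↦ f(v + ε w)`, with `ε^2 = 0`. -/
def dualEval {k : ℕ} (v w : Fin k → ZMod 2) : P k →ₐ[ZMod 2] DualNumber (ZMod 2) :=
  MvPolynomial.aeval fun i => TrivSqZeroExt.inl (v i) + TrivSqZeroExt.inr (w i)

/-- The derivative of `f` at `v` in the direction `w`. On polynomials of degree `2^r` it is the coefficient
of `s^{2^r - 1} t` in `f(s v + t w)`, a functional that vanishes on hit polynomials. -/
def dirDeriv {k : ℕ} (v w : Fin k → ZMod 2) : P k →ₗ[ZMod 2] ZMod 2 :=
  (TrivSqZeroExt.sndHom (ZMod 2) (ZMod 2)).comp (dualEval v w).toLinearMap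

theorem fst_dualEval {k : ℕ} (v w : Fin k → ZMod 2) (f : P k) :
    (dualEval v w f).fst = MvPolynomial.eval v f := by
  induction f using poly_induction with
  | h0 => simp
  | h1 => simp
  | hadd f g hf hg => simp [hf, hg]
  | hX i f hf => rw [map_mul, TrivSqZeroExt.fst_mul, hf]; simp [dualEval]

theorem dirDeriv_mul {k : ℕ} (v w : Fin k → ZMod 2) (f g : P k) : dirDeriv v w (f * g) =
    MvPolynomial.eval v f * dirDeriv v w g + dirDeriv v w f * MvPolynomial.eval v g := by
  simp only [dirDeriv, LinearMap.comp_apply, AlgHom.toLinearMap_apply, map_mul,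
    TrivSqZeroExt.sndHom_apply, TrivSqZeroExt.snd_mul, fst_dualEval, smul_eq_mul,
    MulOpposite.smul_eq_mul_unop, MulOpposite.unop_op]

theorem dirDeriv_X {k : ℕ} (v w : Fin k → ZMod 2) (i : Fin k) :
    dirDeriv v w (MvPolynomial.X i) = w i := by
  simp [dirDeriv, dualEval]

theorem dirDeriv_one {k : ℕ} (v w : Fin k → ZMod 2) : dirDeriv v w 1 = 0 := by
  simp [dirDeriv]

theorem dirDeriv_sq {k : ℕ} (v w : Fin k → ZMod 2) (f : P k) : dirDeriv v w (f ^ 2) = 0 := by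
  rw [pow_two, dirDeriv_mul, mul_comm]
  exact ZModModule.add_self _

theorem dirDeriv_mul_sq {k : ℕ} (v w : Fin k → ZMod 2) (f g : P k) : dirDeriv v w (f * g ^ 2) =
    dirDeriv v w f * MvPolynomial.eval v g := by
  have hc : ∀ c : ZMod 2, c ^ 2 = c := by decide
  rw [dirDeriv_mul, dirDeriv_sq, mul_zero, zero_add, map_pow, hc]

theorem dirDeriv_X_mul {k : ℕ} (v w : Fin k → ZMod 2) (i : Fin k) (f : P k) :
    dirDeriv v w (MvPolynomial.X i * f) =
      v i * dirDeriv v w f + w i * MvPolynomial.eval v f := by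
  rw [dirDeriv_mul, dirDeriv_X, MvPolynomial.eval_X]

theorem dirDeriv_add_right {k : ℕ} (v w w' : Fin k → ZMod 2) (f : P k) :
    dirDeriv v (w + w') f = dirDeriv v w f + dirDeriv v w' f := by
  induction f using poly_induction with
  | h0 => simp
  | h1 => simp [dirDeriv_one]
  | hadd f g hf hg => rw [map_add, map_add, map_add, hf, hg]; ring
  | hX i f hf => rw [dirDeriv_X_mul, dirDeriv_X_mul, dirDeriv_X_mul, hf, Pi.add_apply]; ring

/-- Euler's formula. -/
theorem dirDeriv_self {k d : ℕ} (v : Fin k → ZMod 2) {f : P k} (hf : f.IsHomogeneous d) :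
    dirDeriv v v f = d * MvPolynomial.eval v f := by
  refine homogeneous_induction (p := fun f => dirDeriv v v f = d * MvPolynomial.eval v f)
    (by simp) ?_ ?_ hf
  · intro f g hf hg; rw [map_add, map_add, hf, hg, mul_add]
  · rintro a rfl
    refine monomial_induction (p := fun f d => dirDeriv v v f = d * MvPolynomial.eval v f)
      (by simp [dirDeriv_one]) ?_ a
    intro i f d _ ih
    rw [dirDeriv_X_mul, ih, map_mul, MvPolynomial.eval_X]
    push_cast; ring

theorem dirDeriv_subst {k : ℕ} (v w : Fin k → ZMod 2) (g : GL (Fin k) (ZMod 2)) (f : P k) :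
    dirDeriv v w (subst g f) = dirDeriv (Matrix.vecMul v g.1) (Matrix.vecMul w g.1) f := by
  have : (dualEval v w).comp (subst g) =
      dualEval (Matrix.vecMul v g.1) (Matrix.vecMul w g.1) := by
    apply MvPolynomial.algHom_ext
    intro j
    rw [AlgHom.comp_apply, subst_X]
    ext <;> simp [dualEval, Matrix.vecMul, dotProduct, mul_comm, TrivSqZeroExt.fst_sum,
      TrivSqZeroExt.snd_sum, TrivSqZeroExt.algebraMap_eq_inl]
  exact congrArg (fun F => (F f).snd) this

/-- On a polynomial of degree `d`, evaluation at points over `F_2` turns `Sq^j` into multiplication by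
`d.choose j`, and directional derivatives turn it into multiplication by `(d - 1).choose j`. -/
theorem eval_dirDeriv_Sq {k d : ℕ} (v w : Fin k → ZMod 2) {f : P k} (hf : f.IsHomogeneous d)
    (j : ℕ) : MvPolynomial.eval v (Sq j f) = d.choose j * MvPolynomial.eval v f ∧
      dirDeriv v w (Sq j f) = (d - 1).choose j * dirDeriv v w f := by
  refine homogeneous_induction (p := fun f => MvPolynomial.eval v (Sq j f) =
    d.choose j * MvPolynomial.eval v f ∧ dirDeriv v w (Sq j f) = (d - 1).choose j * dirDeriv v w f)
    (by simp) ?_ ?_ hf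
  · rintro f g ⟨hf, hf'⟩ ⟨hg, hg'⟩
    simp only [map_add, hf, hf', hg, hg', mul_add, and_self]
  · rintro a rfl
    refine monomial_induction (p := fun f d => ∀ j, MvPolynomial.eval v (Sq j f) =
      d.choose j * MvPolynomial.eval v f ∧
      dirDeriv v w (Sq j f) = (d - 1).choose j * dirDeriv v w f) ?_ ?_ a j
    · intro j
      cases j with
      | zero => simp [Sq_zero]
      | succ j => simp [Sq_one_pos, dirDeriv_one]
    · intro i f d hf ih j
      cases j with
      | zero => simp [Sq_zero]
      | succ j =>
        have hv : v i ^ 2 = v i := by generalize v i = c; revert c; decide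
        have h2 : dirDeriv v w (MvPolynomial.X i ^ 2 * Sq j f) = v i * dirDeriv v w (Sq j f) := by
          rw [mul_comm, dirDeriv_mul_sq, MvPolynomial.eval_X, mul_comm]
        rw [Sq_X_mul, map_add, map_add, h2, dirDeriv_X_mul, dirDeriv_X_mul, (ih j).2, (ih (j + 1)).2,
          map_mul, map_mul, map_mul, map_pow, MvPolynomial.eval_X, hv, (ih j).1, (ih (j + 1)).1,
          Nat.choose_succ_succ]
        refine ⟨by push_cast; ring, ?_⟩
        cases d with
        | zero =>
          have h0 : dirDeriv v w f = 0 := by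
            have : f = MvPolynomial.C (MvPolynomial.coeff 0 f) := by
              rw [← MvPolynomial.totalDegree_eq_zero_iff_eq_C,
                MvPolynomial.totalDegree_zero_iff_isHomogeneous]
              exact hf
            rw [this, ← mul_one (MvPolynomial.C _), MvPolynomial.C_mul', map_smul, dirDeriv_one,
              smul_zero]
          rw [h0]; simp
        | succ d =>
          rw [Nat.add_sub_cancel, Nat.add_sub_cancel, Nat.choose_succ_succ]
          push_cast; ring

/-- The binary digits of `j` and `2^r - 1 - j` are complementary. -/
theorem choose_two_pow_sub_even (r j : ℕ) (hj : 0 < j) : ((2 ^ r - 1 - j).choose j : ZMod 2) = 0 := by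
  induction r generalizing j with
  | zero => rw [Nat.choose_eq_zero_of_lt (by simpa using hj), Nat.cast_zero]
  | succ r ih =>
    obtain ⟨i, rfl | rfl⟩ := Nat.even_or_odd' j
    · rcases le_or_gt (2 ^ r) i with h | h
      · rw [Nat.choose_eq_zero_of_lt (by rw [pow_succ]; omega), Nat.cast_zero]
      · rw [show 2 ^ (r + 1) - 1 - 2 * i = 2 * (2 ^ r - 1 - i) + 1 by rw [pow_succ]; omega,
          choose_odd_even, ih i (by omega)]
    · rw [show 2 ^ (r + 1) - 1 - (2 * i + 1) = 2 * (2 ^ r - 1 - i) by rw [pow_succ]; omega,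
        choose_even_odd]

/-- A homogeneous hit polynomial of degree `n` is a sum of elements `Sq^{j+1}(x^a)` of degree `n`. -/
theorem mem_of_hit_homogeneous {k n : ℕ} {W : Submodule (ZMod 2) (P k)}
    (h : ∀ (j : ℕ) (a : Fin k →₀ ℕ), a.degree + (j + 1) = n →
      Sq (j + 1) (MvPolynomial.monomial a 1) ∈ W) {f : P k} (hf : f ∈ hit k)
    (hn : f.IsHomogeneous n) : f ∈ W := by
  have : hit k ≤ W.comap (MvPolynomial.homogeneousComponent n) := by
    refine hit_le_of_monomial fun j a => ?_
    have ha := Sq_isHomogeneous (j + 1)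
      (MvPolynomial.isHomogeneous_monomial (1 : ZMod 2) (rfl : a.degree = a.degree))
    rw [Submodule.mem_comap, MvPolynomial.homogeneousComponent_of_mem ha]
    split_ifs with hd
    · exact h j a hd.symm
    · exact zero_mem _
  have h2 := this hf
  rwa [Submodule.mem_comap, MvPolynomial.homogeneousComponent_of_mem hn, if_pos rfl] at h2

/-- In degree `2^r` the derivative of `Sq^j(g)` is a multiple of `(2^r - 1 - j).choose j`, which is even for
`0 < j`. -/
theorem dirDeriv_hit {k r : ℕ} (v w : Fin k → ZMod 2) {f : P k} (hf : f ∈ hit k)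
    (hr : f.IsHomogeneous (2 ^ r)) : dirDeriv v w f = 0 := by
  refine mem_of_hit_homogeneous (W := LinearMap.ker (dirDeriv v w)) (fun j a ha => ?_) hf hr
  have h := (eval_dirDeriv_Sq v w
    (MvPolynomial.isHomogeneous_monomial (1 : ZMod 2) (rfl : a.degree = a.degree)) (j + 1)).2
  rw [show a.degree - 1 = 2 ^ r - 1 - (j + 1) by omega, choose_two_pow_sub_even r _ (by omega),
    zero_mul] at h
  exact h

/-! ### Polynomials with prescribed values on points over `F_2` -/

/-- The indicator function of `v` among the points over `F_2` is given by a form of every degree `d ≥ k`: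
if `v_i = 1`, by `x_i^{d-k+1} ∏_{j ≠ i} (x_j + (1 + v_j) x_i)`. -/
theorem exists_indicator {k d : ℕ} (hd : k ≤ d) {v : Fin k → ZMod 2} (hv : v ≠ 0) :
    ∃ f : P k, f.IsHomogeneous d ∧ ∀ u, MvPolynomial.eval u f = if u = v then 1 else 0 := by
  have h01 : ∀ c : ZMod 2, c = 0 ∨ c = 1 := by decide
  obtain ⟨i, hi⟩ : ∃ i, v i ≠ 0 := Function.ne_iff.mp hv
  have hi : v i = 1 := (h01 _).resolve_left hi
  have hk : 0 < k := i.pos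
  refine ⟨MvPolynomial.X i ^ (d - (k - 1)) *
    ∏ j ∈ Finset.univ.erase i, (MvPolynomial.X j + MvPolynomial.C (1 + v j) * MvPolynomial.X i),
    ?_, fun u => ?_⟩
  · have h1 := (MvPolynomial.isHomogeneous_X (ZMod 2) i).pow (d - (k - 1))
    have h2 := MvPolynomial.IsHomogeneous.prod (Finset.univ.erase i)
      (fun j => (MvPolynomial.X j + MvPolynomial.C (1 + v j) * MvPolynomial.X i : P k)) (fun _ => 1)
      fun j _ => (MvPolynomial.isHomogeneous_X _ j).add (by
        have := (MvPolynomial.isHomogeneous_C (Fin k) (1 + v j)).mul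
          (MvPolynomial.isHomogeneous_X (ZMod 2) i)
        rwa [zero_add] at this)
    have h3 := h1.mul h2
    rwa [Finset.sum_const, Finset.card_erase_of_mem (Finset.mem_univ i), Finset.card_univ,
      Fintype.card_fin, smul_eq_mul, mul_one, one_mul,
      show d - (k - 1) + (k - 1) = d by omega] at h3
  · rw [map_mul, map_pow, map_prod, MvPolynomial.eval_X]
    simp only [map_add, map_mul, MvPolynomial.eval_X, MvPolynomial.eval_C]
    rcases h01 (u i) with h | h
    · rw [h, zero_pow (by omega), zero_mul, if_neg]
      rintro rfl
      rw [hi] at h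
      exact one_ne_zero h
    · rw [h, one_pow, one_mul]
      have hc : ∀ a b : ZMod 2, a + (1 + b) * 1 = if a = b then 1 else 0 := by decide
      simp only [hc]
      split_ifs with huv
      · subst huv; simp
      · obtain ⟨j, hj⟩ := Function.ne_iff.mp huv
        refine Finset.prod_eq_zero (i := j) ?_ (if_neg hj)
        rw [Finset.mem_erase]
        refine ⟨?_, Finset.mem_univ j⟩
        rintro rfl
        exact hj (h.trans hi.symm)

/-- Every function on the nonzero points of `F_2^k` is given by a form of degree `d`, if `d ≥ k`. -/
theorem exists_eval_eq {k d : ℕ} (hd : k ≤ d) (h : (Fin k → ZMod 2) → ZMod 2) :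
    ∃ f : P k, f.IsHomogeneous d ∧ ∀ v, v ≠ 0 → MvPolynomial.eval v f = h v := by
  have : ∀ v : Fin k → ZMod 2, ∃ f : P k, f.IsHomogeneous d ∧
      ∀ u, v ≠ 0 → MvPolynomial.eval u f = if u = v then 1 else 0 := by
    intro v
    by_cases hv : v = 0
    · exact ⟨0, MvPolynomial.isHomogeneous_zero _ _ _, fun u h => absurd hv h⟩
    · obtain ⟨f, hf, hf'⟩ := exists_indicator hd hv
      exact ⟨f, hf, fun u _ => hf' u⟩
  choose δ hδ hδ' using this
  refine ⟨∑ v ∈ Finset.univ.erase 0, MvPolynomial.C (h v) * δ v,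
    MvPolynomial.IsHomogeneous.sum _ _ _ fun v _ => ?_, fun v hv => ?_⟩
  · have := (MvPolynomial.isHomogeneous_C (Fin k) (h v)).mul (hδ v)
    rwa [zero_add] at this
  · rw [map_sum, Finset.sum_eq_single v]
    · rw [map_mul, MvPolynomial.eval_C, hδ' v v hv, if_pos rfl, mul_one]
    · intro u hu huv
      rw [map_mul, hδ' u v (Finset.ne_of_mem_erase hu), if_neg huv.symm, mul_zero]
    · intro hv'
      exact absurd (Finset.mem_erase.mpr ⟨hv, Finset.mem_univ v⟩) hv'

theorem forall_points {p : (Fin 3 → ZMod 2) → Prop} (h1 : p ![1, 0, 0]) (h2 : p ![0, 1, 0])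
    (h3 : p ![0, 0, 1]) (h4 : p ![1, 1, 0]) (h5 : p ![1, 0, 1]) (h6 : p ![0, 1, 1])
    (h7 : p ![1, 1, 1]) (v : Fin 3 → ZMod 2) (hv : v ≠ 0) : p v := by
  have h01 : ∀ c : ZMod 2, c = 0 ∨ c = 1 := by decide
  have e : v = ![v 0, v 1, v 2] := by ext i; fin_cases i <;> rfl
  rw [e] at hv ⊢
  rcases h01 (v 0) with a | a <;> rcases h01 (v 1) with b | b <;> rcases h01 (v 2) with c | c <;>
    rw [a, b, c] at hv ⊢ <;> first | assumption | skip
  exact absurd (by ext i; fin_cases i <;> rfl) hv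

/-- The sum of the values of a function on the nonzero points of `F_2^3`. -/
def pointSum (h : (Fin 3 → ZMod 2) → ZMod 2) : ZMod 2 :=
  h ![1, 0, 0] + h ![0, 1, 0] + h ![0, 0, 1] + h ![1, 1, 0] + h ![1, 0, 1] + h ![0, 1, 1] +
    h ![1, 1, 1]

/-- The functions given by quadratic forms are those for which the values on the nonzero points sum to
`0`. -/
theorem exists_quadratic {h : (Fin 3 → ZMod 2) → ZMod 2} (hh : pointSum h = 0) :
    ∃ f : P 3, f.IsHomogeneous 2 ∧ ∀ v, v ≠ 0 → MvPolynomial.eval v f = h v := by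
  have hX := fun i : Fin 3 => MvPolynomial.isHomogeneous_X (ZMod 2) i
  have hC : ∀ (c : ZMod 2) (i j : Fin 3),
      (MvPolynomial.C c * (MvPolynomial.X i * MvPolynomial.X j) : P 3).IsHomogeneous 2 := by
    intro c i j
    have := (MvPolynomial.isHomogeneous_C (Fin 3) c).mul ((hX i).mul (hX j))
    simpa using this
  refine ⟨MvPolynomial.C (h ![1, 0, 0]) * (MvPolynomial.X 0 * MvPolynomial.X 0) +
    MvPolynomial.C (h ![0, 1, 0]) * (MvPolynomial.X 1 * MvPolynomial.X 1) +
    MvPolynomial.C (h ![0, 0, 1]) * (MvPolynomial.X 2 * MvPolynomial.X 2) +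
    MvPolynomial.C (h ![1, 1, 0] + h ![1, 0, 0] + h ![0, 1, 0]) *
      (MvPolynomial.X 0 * MvPolynomial.X 1) +
    MvPolynomial.C (h ![1, 0, 1] + h ![1, 0, 0] + h ![0, 0, 1]) *
      (MvPolynomial.X 0 * MvPolynomial.X 2) +
    MvPolynomial.C (h ![0, 1, 1] + h ![0, 1, 0] + h ![0, 0, 1]) *
      (MvPolynomial.X 1 * MvPolynomial.X 2),
    (((((hC _ 0 0).add (hC _ 1 1)).add (hC _ 2 2)).add (hC _ 0 1)).add (hC _ 0 2)).add (hC _ 1 2),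
    ?_⟩
  unfold pointSum at hh
  apply forall_points
  all_goals
    simp only [map_add, map_mul, MvPolynomial.eval_X, MvPolynomial.eval_C, Matrix.cons_val]
    generalize h ![1, 0, 0] = a1, h ![0, 1, 0] = a2, h ![0, 0, 1] = a3, h ![1, 1, 0] = a4,
      h ![1, 0, 1] = a5, h ![0, 1, 1] = a6, h ![1, 1, 1] = a7 at hh ⊢
    revert a1 a2 a3 a4 a5 a6 a7
    decide

/-! ### Parity components in three variables -/

theorem parity_three (f : P 3) : f = half ∅ f ^ 2 + X 0 * half {0} f ^ 2 + X 1 * half {1} f ^ 2 +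
    X 2 * half {2} f ^ 2 + X 0 * X 1 * half {0, 1} f ^ 2 + X 0 * X 2 * half {0, 2} f ^ 2 +
    X 1 * X 2 * half {1, 2} f ^ 2 + X 0 * X 1 * X 2 * half Finset.univ f ^ 2 := by
  have h := sum_parity f
  rw [show (Finset.univ : Finset (Finset (Fin 3))) =
    {∅, {0}, {1}, {2}, {0, 1}, {0, 2}, {1, 2}, Finset.univ} by decide] at h
  rw [Finset.sum_insert (by decide), Finset.sum_insert (by decide), Finset.sum_insert (by decide),
    Finset.sum_insert (by decide), Finset.sum_insert (by decide), Finset.sum_insert (by decide),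
    Finset.sum_insert (by decide), Finset.sum_singleton] at h
  rw [Finset.prod_pair (by decide), Finset.prod_pair (by decide), Finset.prod_pair (by decide),
    Fin.prod_univ_three] at h
  simp only [Finset.prod_empty, Finset.prod_singleton] at h
  conv_lhs => rw [← h]
  ring

/-- `∑_i x_i z_i^2`. -/
def lineForm (z : Fin 3 → P 3) : P 3 := X 0 * z 0 ^ 2 + X 1 * z 1 ^ 2 + X 2 * z 2 ^ 2

/-- `x_2 x_3 y_1^2 + x_1 x_3 y_2^2 + x_1 x_2 y_3^2`. -/
def pairForm (y : Fin 3 → P 3) : P 3 :=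
  X 1 * X 2 * y 0 ^ 2 + X 0 * X 2 * y 1 ^ 2 + X 0 * X 1 * y 2 ^ 2

/-- In three variables, the parity components of a form of odd degree are the `x_i a_i^2` and
`x_1 x_2 x_3 y^2`. -/
theorem parity_odd_kameko {e : ℕ} {f : P 3} (hf : f.IsHomogeneous (2 * e + 3)) : ∃ a : Fin 3 → P 3,
    (∀ i, (a i).IsHomogeneous (e + 1)) ∧ f = lineForm a + kamekoUp (kamekoDown f) := by
  refine ⟨fun i => half {i} f, fun i => half_isHomogeneous _ (by rwa [Finset.card_singleton]), ?_⟩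
  conv_lhs => rw [parity_three f]
  rw [half_eq_zero_of_degree ∅ hf (by rw [Finset.card_empty]; omega),
    half_eq_zero_of_degree {0, 1} hf (by rw [Finset.card_pair (by decide)]; omega),
    half_eq_zero_of_degree {0, 2} hf (by rw [Finset.card_pair (by decide)]; omega),
    half_eq_zero_of_degree {1, 2} hf (by rw [Finset.card_pair (by decide)]; omega), lineForm,
    kamekoUp, Fin.prod_univ_three]
  ring

theorem parity_odd {e : ℕ} {f : P 3} (hf : f.IsHomogeneous (2 * e + 3)) : ∃ (a : Fin 3 → P 3) (b : P 3),
    (∀ i, (a i).IsHomogeneous (e + 1)) ∧ b.IsHomogeneous e ∧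
      f = lineForm a + X 0 * X 1 * X 2 * b ^ 2 := by
  obtain ⟨a, ha, hf'⟩ := parity_odd_kameko hf
  refine ⟨a, kamekoDown f, ha, kamekoDown_isHomogeneous hf, ?_⟩
  rwa [kamekoUp, Fin.prod_univ_three] at hf'

theorem parity_even {e : ℕ} {f : P 3} (hf : f.IsHomogeneous (2 * e + 2)) : ∃ (y : Fin 3 → P 3) (c : P 3),
    (∀ i, (y i).IsHomogeneous e) ∧ c.IsHomogeneous (e + 1) ∧ f = pairForm y + c ^ 2 := by
  refine ⟨![half {1, 2} f, half {0, 2} f, half {0, 1} f], half ∅ f, ?_, ?_, ?_⟩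
  · intro i
    fin_cases i <;> exact half_isHomogeneous _ (by rwa [Finset.card_pair (by decide)])
  · exact half_isHomogeneous _ (by rwa [Finset.card_empty])
  · conv_lhs => rw [parity_three f]
    rw [half_eq_zero_of_degree {0} hf (by rw [Finset.card_singleton]; omega),
      half_eq_zero_of_degree {1} hf (by rw [Finset.card_singleton]; omega),
      half_eq_zero_of_degree {2} hf (by rw [Finset.card_singleton]; omega),
      half_eq_zero_of_degree Finset.univ hf (by rw [Finset.card_univ, Fintype.card_fin]; omega)]
    simp only [pairForm, Matrix.cons_val]
    ring

theorem parity_linear {f : P 3} (hf : f.IsHomogeneous 1) :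
    ∃ m : Fin 3 → ZMod 2, f = C (m 0) * X 0 + C (m 1) * X 1 + C (m 2) * X 2 := by
  have hc : ∀ c : ZMod 2, c ^ 2 = c := by decide
  have h0 : ∀ i : Fin 3, ∃ c : ZMod 2, half {i} f = C c := by
    intro i
    have h : (half {i} f).IsHomogeneous 0 := half_isHomogeneous _ (by rwa [Finset.card_singleton])
    rw [← MvPolynomial.totalDegree_zero_iff_isHomogeneous,
      MvPolynomial.totalDegree_eq_zero_iff_eq_C] at h
    exact ⟨_, h⟩
  choose m hm using h0
  refine ⟨m, ?_⟩
  conv_lhs => rw [parity_three f]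
  rw [half_eq_zero_of_degree ∅ hf (by rw [Finset.card_empty]; omega),
    half_eq_zero_of_degree {0, 1} hf (by rw [Finset.card_pair (by decide)]; omega),
    half_eq_zero_of_degree {0, 2} hf (by rw [Finset.card_pair (by decide)]; omega),
    half_eq_zero_of_degree {1, 2} hf (by rw [Finset.card_pair (by decide)]; omega),
    half_eq_zero_of_degree Finset.univ hf (by rw [Finset.card_univ, Fintype.card_fin]; omega),
    hm, hm, hm, ← map_pow, ← map_pow, ← map_pow, hc, hc, hc]
  ring

/-! ### Consequences of the action of the first square -/

theorem two_eq_zero_P {k : ℕ} : (2 : P k) = 0 := CharTwo.two_eq_zero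

theorem Sq_one_X_mul {k : ℕ} (i : Fin k) (f : P k) :
    Sq 1 (X i * f) = X i * Sq 1 f + X i ^ 2 * f := by
  have := Sq_X_mul i 0 f
  rwa [Sq_zero] at this

theorem Sq_one_sq {k : ℕ} (f : P k) : Sq 1 (f ^ 2) = 0 := Sq_odd_sq f 0

/-- `Sq^1(x_i x_j c^2)` is hit. -/
theorem Sq_one_pair {k : ℕ} (i j : Fin k) (c : P k) :
    (X i ^ 2 * X j + X i * X j ^ 2) * c ^ 2 ∈ hit k := by
  have h := Sq_mem_hit 0 (X i * (X j * c ^ 2))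
  rw [Sq_one_X_mul, Sq_one_X_mul, Sq_one_sq] at h
  convert h using 1
  ring

/-- `Sq^1(x_i x_j x_l c^2)` is hit. -/
theorem Sq_one_triple {k : ℕ} (i j l : Fin k) (c : P k) :
    (X i ^ 2 * X j * X l + X i * X j ^ 2 * X l + X i * X j * X l ^ 2) * c ^ 2 ∈ hit k := by
  have h := Sq_mem_hit 0 (X i * (X j * (X l * c ^ 2)))
  rw [Sq_one_X_mul, Sq_one_X_mul, Sq_one_X_mul, Sq_one_sq] at h
  convert h using 1
  ring

/-- The vector product of `(x_1, x_2, x_3)` with a vector of polynomials. -/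
def crossX (H : Fin 3 → P 3) : Fin 3 → P 3 :=
  ![X 1 * H 2 + X 2 * H 1, X 2 * H 0 + X 0 * H 2, X 0 * H 1 + X 1 * H 0]

theorem lineForm_crossX (H : Fin 3 → P 3) : lineForm (crossX H) ∈ hit 3 := by
  have h := add_mem (add_mem (Sq_one_pair 0 1 (H 2)) (Sq_one_pair 0 2 (H 1))) (Sq_one_pair 1 2 (H 0))
  convert h using 1
  simp only [lineForm, crossX, Matrix.cons_val]
  linear_combination (X 0 * X 1 * X 2 * (H 0 * H 1 + H 0 * H 2 + H 1 * H 2)) * two_eq_zero_P (k := 3)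

theorem pairForm_X_mul (H : P 3) : pairForm (fun i => X i * H) ∈ hit 3 := by
  convert Sq_one_triple 0 1 2 H using 1
  simp only [pairForm]
  ring

theorem lineForm_add (z z' : Fin 3 → P 3) : lineForm (z + z') = lineForm z + lineForm z' := by
  simp only [lineForm, Pi.add_apply]
  linear_combination (X 0 * z 0 * z' 0 + X 1 * z 1 * z' 1 + X 2 * z 2 * z' 2) *
    two_eq_zero_P (k := 3)

theorem pairForm_add (z z' : Fin 3 → P 3) : pairForm (z + z') = pairForm z + pairForm z' := by
  simp only [pairForm, Pi.add_apply]
  linear_combination (X 1 * X 2 * z 0 * z' 0 + X 0 * X 2 * z 1 * z' 1 + X 0 * X 1 * z 2 * z' 2) *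
    two_eq_zero_P (k := 3)

theorem lineForm_mem_hit {z : Fin 3 → P 3} (h : ∀ i, z i ∈ hit 3) : lineForm z ∈ hit 3 :=
  add_mem (add_mem (X_mul_sq_of_hit 0 (h 0)) (X_mul_sq_of_hit 1 (h 1))) (X_mul_sq_of_hit 2 (h 2))

theorem pairForm_mem_hit {y : Fin 3 → P 3} (h : ∀ i, y i ∈ hit 3) : pairForm y ∈ hit 3 :=
  add_mem (add_mem (X_mul_X_mul_sq_of_hit 1 2 (h 0)) (X_mul_X_mul_sq_of_hit 0 2 (h 1)))
    (X_mul_X_mul_sq_of_hit 0 1 (h 2))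

/-- If `f + g` and `g` are hit, then so is `f`. -/
theorem mem_hit_of_add {k : ℕ} {f g : P k} (h : f + g ∈ hit k) (hg : g ∈ hit k) : f ∈ hit k := by
  have := sub_mem h hg
  rwa [add_sub_cancel_right] at this

/-- Modulo hit polynomials, the components `x_1 x_2 x_3 b_i^2` of the `z_i` in `∑_i x_i z_i^2` can be
absorbed in the others. -/
theorem lineForm_normalize (a : Fin 3 → Fin 3 → P 3) (b : Fin 3 → P 3) :
    ∃ a' : Fin 3 → Fin 3 → P 3,
      a' = ![![a 0 0, a 0 1 + X 2 * b 2, a 0 2], ![a 1 0, a 1 1, a 1 2 + X 0 * b 0],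
        ![a 2 0 + X 1 * b 1, a 2 1, a 2 2]] ∧
      lineForm (fun i => lineForm (a i) + X 0 * X 1 * X 2 * b i ^ 2) +
        lineForm (fun i => lineForm (a' i)) ∈ hit 3 := by
  refine ⟨_, rfl, ?_⟩
  have h := add_mem (add_mem (Sq_one_pair 0 1 (X 0 * X 2 * b 0 ^ 2))
    (Sq_one_pair 1 2 (X 1 * X 0 * b 1 ^ 2))) (Sq_one_pair 2 0 (X 2 * X 1 * b 2 ^ 2))
  convert h using 1
  have e : (fun i => lineForm ((![![a 0 0, a 0 1 + X 2 * b 2, a 0 2],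
      ![a 1 0, a 1 1, a 1 2 + X 0 * b 0], ![a 2 0 + X 1 * b 1, a 2 1, a 2 2]] :
        Fin 3 → Fin 3 → P 3) i)) =
      (fun i => lineForm (a i)) + ![X 1 * (X 2 * b 2) ^ 2, X 2 * (X 0 * b 0) ^ 2,
        X 0 * (X 1 * b 1) ^ 2] := by
    funext i
    fin_cases i <;> simp [lineForm, add_pow_char] <;> ring
  rw [e, lineForm_add, show (fun i => lineForm (a i) + X 0 * X 1 * X 2 * b i ^ 2) =
    (fun i => lineForm (a i)) + fun i => X 0 * X 1 * X 2 * b i ^ 2 from rfl, lineForm_add,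
    add_add_add_comm, ZModModule.add_self, zero_add]
  simp only [lineForm, Matrix.cons_val]
  ring

/-- Modulo hit polynomials, the components `x_1 x_2 x_3 c_i^2` of the `y_i` in
`x_2 x_3 y_1^2 + x_1 x_3 y_2^2 + x_1 x_2 y_3^2` can be absorbed in the others. -/
theorem pairForm_normalize (a : Fin 3 → Fin 3 → P 3) (c : Fin 3 → P 3) :
    ∃ a' : Fin 3 → Fin 3 → P 3,
      a' = ![![a 0 0, a 0 1 + X 0 * c 2, a 0 2 + X 0 * c 1],
        ![a 1 0 + X 1 * c 2, a 1 1, a 1 2 + X 1 * c 0],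
        ![a 2 0 + X 2 * c 1, a 2 1 + X 2 * c 0, a 2 2]] ∧
      pairForm (fun i => lineForm (a i) + X 0 * X 1 * X 2 * c i ^ 2) +
        pairForm (fun i => lineForm (a' i)) ∈ hit 3 := by
  refine ⟨_, rfl, ?_⟩
  have h := add_mem (add_mem (Sq_one_triple 0 1 2 (X 0 * X 1 * c 2 ^ 2))
    (Sq_one_triple 0 1 2 (X 0 * X 2 * c 1 ^ 2))) (Sq_one_triple 0 1 2 (X 1 * X 2 * c 0 ^ 2))
  convert h using 1
  have e : (fun i => lineForm ((![![a 0 0, a 0 1 + X 0 * c 2, a 0 2 + X 0 * c 1],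
      ![a 1 0 + X 1 * c 2, a 1 1, a 1 2 + X 1 * c 0],
      ![a 2 0 + X 2 * c 1, a 2 1 + X 2 * c 0, a 2 2]] : Fin 3 → Fin 3 → P 3) i)) =
      (fun i => lineForm (a i)) + ![X 1 * (X 0 * c 2) ^ 2 + X 2 * (X 0 * c 1) ^ 2,
        X 0 * (X 1 * c 2) ^ 2 + X 2 * (X 1 * c 0) ^ 2,
        X 0 * (X 2 * c 1) ^ 2 + X 1 * (X 2 * c 0) ^ 2] := by
    funext i
    fin_cases i <;> simp [lineForm, add_pow_char] <;> ring
  rw [e, pairForm_add, show (fun i => lineForm (a i) + X 0 * X 1 * X 2 * c i ^ 2) =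
    (fun i => lineForm (a i)) + fun i => X 0 * X 1 * X 2 * c i ^ 2 from rfl, pairForm_add,
    add_add_add_comm, ZModModule.add_self, zero_add]
  simp only [pairForm, Matrix.cons_val, add_pow_char]
  ring

/-! ### Detection of hit polynomials by their values and derivatives -/

theorem eval_lineForm (v : Fin 3 → ZMod 2) (z : Fin 3 → P 3) : eval v (lineForm z) =
    v 0 * eval v (z 0) + v 1 * eval v (z 1) + v 2 * eval v (z 2) := by
  have hc : ∀ c : ZMod 2, c ^ 2 = c := by decide
  simp only [lineForm, map_add, map_mul, map_pow, MvPolynomial.eval_X, hc]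

theorem lineForm_isHomogeneous {e : ℕ} {z : Fin 3 → P 3} (hz : ∀ i, (z i).IsHomogeneous e) :
    (lineForm z).IsHomogeneous (2 * e + 1) := by
  have h : ∀ i : Fin 3, (X i * z i ^ 2).IsHomogeneous (2 * e + 1) := by
    intro i
    have := (MvPolynomial.isHomogeneous_X (ZMod 2) i).mul ((hz i).pow 2)
    rwa [show 1 + e * 2 = 2 * e + 1 by ring] at this
  exact ((h 0).add (h 1)).add (h 2)

theorem crossX_isHomogeneous {e : ℕ} {H : Fin 3 → P 3} (hH : ∀ i, (H i).IsHomogeneous e) (i : Fin 3) :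
    (crossX H i).IsHomogeneous (e + 1) := by
  have h : ∀ i j : Fin 3, (X i * H j).IsHomogeneous (e + 1) := by
    intro i j
    have := (MvPolynomial.isHomogeneous_X (ZMod 2) i).mul (hH j)
    rwa [add_comm] at this
  fin_cases i
  · exact (h 1 2).add (h 2 1)
  · exact (h 2 0).add (h 0 2)
  · exact (h 0 1).add (h 1 0)

/-- In degree `3` a polynomial is hit if it vanishes on the points over `F_2`. -/
theorem mem_hit_of_degree_three {f : P 3} (hf : f.IsHomogeneous 3)
    (h : ∀ v, v ≠ 0 → eval v f = 0) : f ∈ hit 3 := by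
  obtain ⟨a, b, ha, hb, rfl⟩ := parity_odd (e := 0) hf
  choose m hm using fun i => parity_linear (ha i)
  obtain ⟨β, rfl⟩ : ∃ β : ZMod 2, b = C β := by
    rw [← MvPolynomial.totalDegree_zero_iff_isHomogeneous,
      MvPolynomial.totalDegree_eq_zero_iff_eq_C] at hb
    exact ⟨_, hb⟩
  have hc : ∀ c : ZMod 2, c ^ 2 = c := by decide
  have hv : ∀ v : Fin 3 → ZMod 2, v ≠ 0 →
      v 0 * (m 0 0 * v 0 + m 0 1 * v 1 + m 0 2 * v 2) +
      v 1 * (m 1 0 * v 0 + m 1 1 * v 1 + m 1 2 * v 2) +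
      v 2 * (m 2 0 * v 0 + m 2 1 * v 1 + m 2 2 * v 2) + v 0 * v 1 * v 2 * β = 0 := by
    intro v hv
    have := h v hv
    simpa only [hm, map_add, eval_lineForm, map_mul, map_pow, MvPolynomial.eval_X,
      MvPolynomial.eval_C, hc] using this
  have e1 := hv ![1, 0, 0] (by decide)
  have e2 := hv ![0, 1, 0] (by decide)
  have e3 := hv ![0, 0, 1] (by decide)
  have e4 := hv ![1, 1, 0] (by decide)
  have e5 := hv ![1, 0, 1] (by decide)
  have e6 := hv ![0, 1, 1] (by decide)
  have e7 := hv ![1, 1, 1] (by decide)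
  simp only [Matrix.cons_val, mul_zero, zero_mul, mul_one, one_mul, add_zero, zero_add] at e1 e2 e3 e4 e5 e6 e7
  rw [e1, e2, zero_add, add_zero] at e4
  rw [e1, e3, zero_add, add_zero] at e5
  rw [e2, e3, zero_add, add_zero] at e6
  have hs : ∀ a b : ZMod 2, a + b = 0 → b = a := by decide
  have e4 := hs _ _ e4
  have e5 := hs _ _ e5
  have e6 := hs _ _ e6
  have e7 : β = 0 := by
    rw [e1, e2, e3, e4, e5, e6] at e7
    have h7 : ∀ p q r β : ZMod 2, 0 + p + q + (p + 0 + r) + (q + r + 0) + β = 0 → β = 0 := by decide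
    exact h7 _ _ _ _ e7
  have hh := add_mem (add_mem (Sq_one_pair (k := 3) 0 1 (C (m 0 1))) (Sq_one_pair 0 2 (C (m 0 2))))
    (Sq_one_pair 1 2 (C (m 1 2)))
  convert hh using 1
  rw [lineForm, hm, hm, hm, e1, e2, e3, e4, e5, e6, e7]
  simp only [map_zero, add_pow_char]
  ring

/-- A vector orthogonal to `v ≠ 0` over `F_2` is a vector product with `v`. -/
theorem exists_cross : ∀ v z : Fin 3 → ZMod 2, v ≠ 0 → v 0 * z 0 + v 1 * z 1 + v 2 * z 2 = 0 →
    ∃ h : Fin 3 → ZMod 2, z 0 = v 1 * h 2 + v 2 * h 1 ∧ z 1 = v 2 * h 0 + v 0 * h 2 ∧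
      z 2 = v 0 * h 1 + v 1 * h 0 := by
  decide

/-- A vector whose vector product with `v ≠ 0` vanishes is a multiple of `v`. -/
theorem exists_multiple : ∀ v y : Fin 3 → ZMod 2, v ≠ 0 → v 1 * y 2 + v 2 * y 1 = 0 →
    v 2 * y 0 + v 0 * y 2 = 0 → v 0 * y 1 + v 1 * y 0 = 0 →
    ∃ c : ZMod 2, y = fun i => v i * c := by
  decide

/-- If `∑_i x_i z_i` vanishes on the points over `F_2`, there are prescribed values `c` such that `z` and
the vector product of `(x_1, x_2, x_3)` with `H` agree on the points for every `H` with these values. -/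
theorem exists_crossX {z : Fin 3 → P 3}
    (h : ∀ v, v ≠ 0 → v 0 * eval v (z 0) + v 1 * eval v (z 1) + v 2 * eval v (z 2) = 0) :
    ∃ c : Fin 3 → (Fin 3 → ZMod 2) → ZMod 2, ∀ v, v ≠ 0 → ∀ H : Fin 3 → P 3,
      (∀ i, eval v (H i) = c i v) → ∀ i, eval v (z i) = eval v (crossX H i) := by
  have : ∀ v : Fin 3 → ZMod 2, ∃ c : Fin 3 → ZMod 2, v ≠ 0 → ∀ H : Fin 3 → P 3,
      (∀ i, eval v (H i) = c i) → ∀ i, eval v (z i) = eval v (crossX H i) := by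
    intro v
    by_cases hv : v = 0
    · exact ⟨0, fun h => absurd hv h⟩
    · obtain ⟨c, h0, h1, h2⟩ := exists_cross v (fun i => eval v (z i)) hv (h v hv)
      refine ⟨c, fun _ H hH i => ?_⟩
      fin_cases i
      · simpa [crossX, hH] using h0
      · simpa [crossX, hH] using h1
      · simpa [crossX, hH] using h2
  choose c hc using this
  exact ⟨fun i v => c v i, fun v hv H hH => hc v hv H hH⟩

/-- If the `z_i` are congruent modulo hit polynomials to the components of a vector product with
`(x_1, x_2, x_3)`, then `∑_i x_i z_i^2` is hit. -/
theorem lineForm_mem_hit_of_crossX {z H : Fin 3 → P 3} (h : ∀ i, z i + crossX H i ∈ hit 3) :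
    lineForm z ∈ hit 3 := by
  have h1 := lineForm_mem_hit (z := z + crossX H) h
  rw [lineForm_add] at h1
  exact mem_hit_of_add h1 (lineForm_crossX H)

/-- Detection of hit polynomials `∑_i x_i z_i^2` in degree `7`. The vector product has to be formed with
quadratic forms here, which do not take arbitrary values on the points. -/
theorem lineForm_mem_hit_degree_seven {z : Fin 3 → P 3} (hz : ∀ i, (z i).IsHomogeneous 3)
    (h : ∀ v, v ≠ 0 → v 0 * eval v (z 0) + v 1 * eval v (z 1) + v 2 * eval v (z 2) = 0) :
    lineForm z ∈ hit 3 := by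
  obtain ⟨c, hc⟩ := exists_crossX h
  -- adding a multiple of `v` to `c(v)` does not change the vector product; this makes the sums zero
  obtain ⟨g, hg⟩ : ∃ g : (Fin 3 → ZMod 2) → ZMod 2, g = fun v =>
    (if v = ![1, 0, 0] then pointSum (c 0) else 0) + (if v = ![0, 1, 0] then pointSum (c 1) else 0) +
      (if v = ![0, 0, 1] then pointSum (c 2) else 0) := ⟨_, rfl⟩
  let c' : Fin 3 → (Fin 3 → ZMod 2) → ZMod 2 := fun i v => c i v + g v * v i
  have hs : ∀ i, pointSum (c' i) = 0 := by
    intro i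
    have h2 : ∀ i, pointSum (c' i) = pointSum (c i) + pointSum (c i) := by
      intro i
      have : pointSum (c' i) = pointSum (c i) + pointSum (fun v => g v * v i) := by
        simp only [pointSum, c']; ring
      rw [this]
      congr 1
      fin_cases i <;> simp [pointSum, hg]
    rw [h2]
    exact ZModModule.add_self _
  choose H hH hH' using fun i => exists_quadratic (hs i)
  refine lineForm_mem_hit_of_crossX (H := H) fun i => mem_hit_of_degree_three
    ((hz i).add (crossX_isHomogeneous hH i)) fun v hv => ?_
  choose K _ hK' using fun i => exists_eval_eq (le_refl 3) (c i)
  rw [map_add, hc v hv K (fun i => hK' i v hv) i]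
  have e : eval v (crossX K i) = eval v (crossX H i) := by
    have h2 : (2 : ZMod 2) = 0 := rfl
    fin_cases i <;> simp [crossX, hK' _ v hv, hH' _ v hv, c']
    · linear_combination -(v 1 * v 2 * g v) * h2
    · linear_combination -(v 0 * v 2 * g v) * h2
    · linear_combination -(v 0 * v 1 * g v) * h2
  rw [e]
  exact ZModModule.add_self _

/-- A polynomial `∑_i x_i z_i^2` of degree `2^{r+1} - 1` is hit if it vanishes on the points over `F_2`. -/
theorem lineForm_mem_hit_of_eval {r : ℕ} (hr : 2 ≤ r) {z : Fin 3 → P 3}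
    (hz : ∀ i, (z i).IsHomogeneous (2 ^ r - 1))
    (h : ∀ v, v ≠ 0 → v 0 * eval v (z 0) + v 1 * eval v (z 1) + v 2 * eval v (z 2) = 0) :
    lineForm z ∈ hit 3 := by
  induction r, hr using Nat.le_induction generalizing z with
  | base => exact lineForm_mem_hit_degree_seven hz h
  | succ r hr ih =>
    obtain ⟨e, he⟩ : ∃ e, 2 ^ r - 1 = e + 1 := by
      have := Nat.pow_le_pow_right (show 0 < 2 by norm_num) hr
      exact ⟨2 ^ r - 2, by omega⟩
    have he3 : 3 ≤ 2 ^ r - 1 := by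
      have := Nat.pow_le_pow_right (show 0 < 2 by norm_num) hr
      omega
    have hd : 2 ^ (r + 1) - 1 = 2 * e + 3 := by rw [pow_succ]; omega
    rw [hd] at hz
    choose a b ha hb hab using fun i => parity_odd (hz i)
    obtain rfl : z = fun i => lineForm (a i) + X 0 * X 1 * X 2 * b i ^ 2 := funext hab
    obtain ⟨a', ha', hh⟩ := lineForm_normalize a b
    refine mem_hit_of_add hh ?_
    have hXb : ∀ i, (X i * b i).IsHomogeneous (e + 1) := by
      intro i
      have := (MvPolynomial.isHomogeneous_X (ZMod 2) i).mul (hb i)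
      rwa [add_comm] at this
    have hda : ∀ i l, (a' i l).IsHomogeneous (e + 1) := by
      intro i l
      rw [ha']
      fin_cases i <;> fin_cases l
      · exact ha 0 0
      · exact (ha 0 1).add (hXb 2)
      · exact ha 0 2
      · exact ha 1 0
      · exact ha 1 1
      · exact (ha 1 2).add (hXb 0)
      · exact (ha 2 0).add (hXb 1)
      · exact ha 2 1
      · exact ha 2 2
    have h' : ∀ v, v ≠ 0 → v 0 * eval v (lineForm (a' 0)) + v 1 * eval v (lineForm (a' 1)) +
        v 2 * eval v (lineForm (a' 2)) = 0 := by
      intro v hv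
      have hc : ∀ c : ZMod 2, c ^ 2 = c := by decide
      rw [← h v hv, ha']
      simp only [eval_lineForm, map_add, map_mul, map_pow, MvPolynomial.eval_X, Matrix.cons_val,
        hc]
      linear_combination -(v 1 * v 2 * eval v (b 0)) * hc (v 0) -
        (v 0 * v 2 * eval v (b 1)) * hc (v 1) - (v 0 * v 1 * eval v (b 2)) * hc (v 2)
    obtain ⟨c, hc⟩ := exists_crossX (z := fun i => lineForm (a' i)) h'
    choose K hK hK' using fun i => exists_eval_eq he3 (c i)
    refine lineForm_mem_hit_of_crossX (H := fun i => K i ^ 2) fun i => ?_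
    -- the difference is again of the form `∑_l x_l c_l^2`, and vanishes on points
    have hev : ∀ v, v ≠ 0 → eval v (lineForm (a' i) + crossX (fun i => K i ^ 2) i) = 0 := by
      intro v hv
      have h2 : ∀ c : ZMod 2, c ^ 2 = c := by decide
      rw [map_add, hc v hv (fun i => K i ^ 2) (fun i => by rw [map_pow, hK' i v hv, h2]) i]
      exact ZModModule.add_self _
    obtain ⟨k, hk, hk'⟩ : ∃ k : Fin 3 → P 3, (∀ l, (k l).IsHomogeneous (2 ^ r - 1)) ∧
        crossX (fun i => K i ^ 2) i = lineForm k := by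
      have h0 := MvPolynomial.isHomogeneous_zero (Fin 3) (ZMod 2) (2 ^ r - 1)
      fin_cases i
      · refine ⟨![0, K 2, K 1], fun l => ?_, by simp [crossX, lineForm]⟩
        fin_cases l <;> simp [hK, h0]
      · refine ⟨![K 2, 0, K 0], fun l => ?_, by simp [crossX, lineForm]; ring⟩
        fin_cases l <;> simp [hK, h0]
      · refine ⟨![K 1, K 0, 0], fun l => ?_, by simp [crossX, lineForm]⟩
        fin_cases l <;> simp [hK, h0]
    change lineForm (a' i) + crossX (fun i => K i ^ 2) i ∈ hit 3
    rw [hk', ← lineForm_add] at hev ⊢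
    refine ih (fun l => (he ▸ hda i l).add (hk l)) fun v hv => ?_
    rw [← eval_lineForm]
    exact hev v hv

/-- The derivatives of `x_2 x_3 y_1^2 + x_1 x_3 y_2^2 + x_1 x_2 y_3^2` at `v` are the components of the vector
product of `v` with `y(v)`. If they vanish, `y(v)` is a multiple of `v`. -/
theorem pairForm_values {y : Fin 3 → P 3} {c : P 3}
    (h : ∀ v w, v ≠ 0 → dirDeriv v w (pairForm y + c ^ 2) = 0) :
    ∃ h : (Fin 3 → ZMod 2) → ZMod 2, ∀ v, v ≠ 0 → ∀ i, eval v (y i) = v i * h v := by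
  have : ∀ v : Fin 3 → ZMod 2, ∃ c : ZMod 2, v ≠ 0 → ∀ i, eval v (y i) = v i * c := by
    intro v
    by_cases hv : v = 0
    · exact ⟨0, fun h => absurd hv h⟩
    · have e : ∀ w : Fin 3 → ZMod 2, (v 1 * w 2 + w 1 * v 2) * eval v (y 0) +
          (v 0 * w 2 + w 0 * v 2) * eval v (y 1) + (v 0 * w 1 + w 0 * v 1) * eval v (y 2) = 0 := by
        intro w
        have := h v w hv
        rwa [map_add, dirDeriv_sq, add_zero, pairForm, map_add, map_add, dirDeriv_mul_sq,
          dirDeriv_mul_sq, dirDeriv_mul_sq, dirDeriv_mul, dirDeriv_mul, dirDeriv_mul, dirDeriv_X,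
          dirDeriv_X, dirDeriv_X, MvPolynomial.eval_X, MvPolynomial.eval_X,
          MvPolynomial.eval_X] at this
      have e0 := e ![1, 0, 0]
      have e1 := e ![0, 1, 0]
      have e2 := e ![0, 0, 1]
      simp only [Matrix.cons_val, mul_zero, zero_mul, mul_one, one_mul, add_zero, zero_add] at e0 e1 e2
      obtain ⟨c, hc⟩ := exists_multiple v (fun i => eval v (y i)) hv (by linear_combination e0)
        (by linear_combination e1) (by linear_combination e2)
      exact ⟨c, fun _ i => congrFun hc i⟩
  choose c hc using this
  exact ⟨c, fun v hv => hc v hv⟩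

theorem pairForm_mem_hit_of_X_mul {y : Fin 3 → P 3} {H : P 3} (h : ∀ i, y i + X i * H ∈ hit 3) :
    pairForm y ∈ hit 3 := by
  have h1 := pairForm_mem_hit (y := y + fun i => X i * H) h
  rw [pairForm_add] at h1
  exact mem_hit_of_add h1 (pairForm_X_mul H)

/-- Detection in degree `4`: a vector of linear forms which is a multiple of `v` at every point `v` is a
multiple of `(x_1, x_2, x_3)`. -/
theorem pairForm_mem_hit_degree_four {y : Fin 3 → P 3} (hy : ∀ i, (y i).IsHomogeneous 1)
    {h : (Fin 3 → ZMod 2) → ZMod 2} (hh : ∀ v, v ≠ 0 → ∀ i, eval v (y i) = v i * h v) :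
    pairForm y ∈ hit 3 := by
  choose m hm using fun i => parity_linear (hy i)
  have e : ∀ v : Fin 3 → ZMod 2, v ≠ 0 → ∀ i, m i 0 * v 0 + m i 1 * v 1 + m i 2 * v 2 = v i * h v := by
    intro v hv i
    rw [← hh v hv i, hm]
    simp
  have a0 : ∀ i, m i 0 = (![1, 0, 0] : Fin 3 → ZMod 2) i * h ![1, 0, 0] := fun i => by
    simpa using e ![1, 0, 0] (by decide) i
  have a1 : ∀ i, m i 1 = (![0, 1, 0] : Fin 3 → ZMod 2) i * h ![0, 1, 0] := fun i => by
    simpa using e ![0, 1, 0] (by decide) i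
  have a2 : ∀ i, m i 2 = (![0, 0, 1] : Fin 3 → ZMod 2) i * h ![0, 0, 1] := fun i => by
    simpa using e ![0, 0, 1] (by decide) i
  have b1 : h ![1, 0, 0] = h ![0, 1, 0] := by
    have c0 := e ![1, 1, 0] (by decide) 0
    have c1 := e ![1, 1, 0] (by decide) 1
    simp [a0, a1, a2] at c0 c1
    rw [c0, c1]
  have b2 : h ![1, 0, 0] = h ![0, 0, 1] := by
    have c0 := e ![1, 0, 1] (by decide) 0
    have c1 := e ![1, 0, 1] (by decide) 2
    simp [a0, a1, a2] at c0 c1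
    rw [c0, c1]
  refine pairForm_mem_hit_of_X_mul (H := C (h ![1, 0, 0])) fun i => ?_
  have : y i = X i * C (h ![1, 0, 0]) := by
    rw [hm, a0, a1, a2, ← b1, ← b2]
    fin_cases i <;> simp [mul_comm]
  rw [this, ZModModule.add_self]
  exact zero_mem _

/-- `p̄_0` as a pair form; its values at the points are multiples of `(x_1, x_2, x_3)` by the function
`1 + x_1`, which is not given by a quadratic form. -/
theorem pBar0_eq_pairForm : pBar0 =
    pairForm ![0, X 1 ^ 3 + X 0 * X 1 ^ 2, X 2 ^ 3 + X 0 * X 2 ^ 2] := by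
  simp only [pBar0, pairForm, Matrix.cons_val]
  linear_combination -(X 0 ^ 2 * X 1 ^ 5 * X 2 + X 0 ^ 2 * X 1 * X 2 ^ 5) * two_eq_zero_P (k := 3)

/-- In degree `8`: if the factor `h` is given by a quadratic form `H`, then `y` is congruent to
`(x_1, x_2, x_3) H` modulo hit polynomials. -/
theorem pairForm_mem_hit_of_pointSum {y : Fin 3 → P 3} (hy : ∀ i, (y i).IsHomogeneous 3)
    {h : (Fin 3 → ZMod 2) → ZMod 2} (hh : ∀ v, v ≠ 0 → ∀ i, eval v (y i) = v i * h v)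
    (hs : pointSum h = 0) : pairForm y ∈ hit 3 := by
  obtain ⟨H, hH, hH'⟩ := exists_quadratic hs
  refine pairForm_mem_hit_of_X_mul (H := H) fun i => mem_hit_of_degree_three ?_ fun v hv => ?_
  · have := (MvPolynomial.isHomogeneous_X (ZMod 2) i).mul hH
    exact (hy i).add this
  · rw [map_add, map_mul, MvPolynomial.eval_X, hh v hv, hH' v hv]
    exact ZModModule.add_self _

/-- Detection in degree `8`, where the functions not given by quadratic forms account for the class of
`p̄_0`. -/
theorem pairForm_mem_hit_degree_eight {y : Fin 3 → P 3} (hy : ∀ i, (y i).IsHomogeneous 3)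
    {h : (Fin 3 → ZMod 2) → ZMod 2} (hh : ∀ v, v ≠ 0 → ∀ i, eval v (y i) = v i * h v) :
    pairForm y ∈ hit 3 ∨ pairForm y + pBar0 ∈ hit 3 := by
  have h01 : ∀ c : ZMod 2, c = 0 ∨ c = 1 := by decide
  rcases h01 (pointSum h) with hs | hs
  · exact Or.inl (pairForm_mem_hit_of_pointSum hy hh hs)
  · right
    rw [pBar0_eq_pairForm, ← pairForm_add]
    have hX := fun i : Fin 3 => MvPolynomial.isHomogeneous_X (ZMod 2) i
    refine pairForm_mem_hit_of_pointSum (h := fun v => h v + (1 + v 0))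
      (fun i => (hy i).add ?_) (fun v hv i => ?_) ?_
    · fin_cases i
      · exact MvPolynomial.isHomogeneous_zero _ _ _
      · exact ((hX 1).pow 3).add ((hX 0).mul ((hX 1).pow 2))
      · exact ((hX 2).pow 3).add ((hX 0).mul ((hX 2).pow 2))
    · rw [Pi.add_apply, map_add, hh v hv, mul_add]
      congr 1
      have h3 : ∀ a b : ZMod 2, b ^ 3 + a * b ^ 2 = b * (1 + a) ∧ 0 = a * (1 + a) := by decide
      fin_cases i
      · simpa using (h3 (v 0) (v 0)).2
      · simpa using (h3 (v 0) (v 1)).1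
      · simpa using (h3 (v 0) (v 2)).1
    · have : pointSum (fun v => h v + (1 + v 0)) = pointSum h + pointSum (fun v => 1 + v 0) := by
        simp only [pointSum]; ring
      rw [this, hs]
      decide

/-- Detection in degree `2^{r+2}`, `r ≥ 2`, where every function on the points is given by a form of degree
`2^r - 1`. -/
theorem pairForm_mem_hit_of_dirDeriv {r : ℕ} (hr : 2 ≤ r) {y : Fin 3 → P 3} {c : P 3}
    (hy : ∀ i, (y i).IsHomogeneous (2 ^ (r + 1) - 1))
    (h : ∀ v w, v ≠ 0 → dirDeriv v w (pairForm y + c ^ 2) = 0) : pairForm y ∈ hit 3 := by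
  have he3 : 3 ≤ 2 ^ r - 1 := by
    have := Nat.pow_le_pow_right (show 0 < 2 by norm_num) hr
    omega
  obtain ⟨e, he⟩ : ∃ e, 2 ^ r - 1 = e + 1 := ⟨2 ^ r - 2, by omega⟩
  have hd : 2 ^ (r + 1) - 1 = 2 * e + 3 := by rw [pow_succ]; omega
  have hy1 := hy
  rw [hd] at hy
  choose a b ha hb hab using fun i => parity_odd (hy i)
  obtain rfl : y = fun i => lineForm (a i) + X 0 * X 1 * X 2 * b i ^ 2 := funext hab
  obtain ⟨a', ha', hh⟩ := pairForm_normalize a b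
  refine mem_hit_of_add hh ?_
  have hXb : ∀ i j, (X i * b j).IsHomogeneous (e + 1) := by
    intro i j
    have := (MvPolynomial.isHomogeneous_X (ZMod 2) i).mul (hb j)
    rwa [add_comm] at this
  have hda : ∀ i l, (a' i l).IsHomogeneous (e + 1) := by
    intro i l
    rw [ha']
    fin_cases i <;> fin_cases l
    · exact ha 0 0
    · exact (ha 0 1).add (hXb 0 2)
    · exact (ha 0 2).add (hXb 0 1)
    · exact (ha 1 0).add (hXb 1 2)
    · exact ha 1 1
    · exact (ha 1 2).add (hXb 1 0)
    · exact (ha 2 0).add (hXb 2 1)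
    · exact (ha 2 1).add (hXb 2 0)
    · exact ha 2 2
  have hpd : ∀ y : Fin 3 → P 3, (∀ i, (y i).IsHomogeneous (2 * e + 3)) →
      (pairForm y).IsHomogeneous (2 ^ (r + 2)) := by
    intro y hy
    have hX := fun i : Fin 3 => MvPolynomial.isHomogeneous_X (ZMod 2) i
    have : ∀ i j l, (X i * X j * y l ^ 2).IsHomogeneous (2 ^ (r + 2)) := by
      intro i j l
      have := ((hX i).mul (hX j)).mul ((hy l).pow 2)
      rwa [← hd, show 1 + 1 + (2 ^ (r + 1) - 1) * 2 = 2 ^ (r + 2) by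
        rw [pow_succ, pow_succ]; omega] at this
    exact ((this 1 2 0).add (this 0 2 1)).add (this 0 1 2)
  have hda' : ∀ i, (lineForm (a' i)).IsHomogeneous (2 * e + 3) :=
    fun i => lineForm_isHomogeneous (hda i)
  have h' : ∀ v w, v ≠ 0 → dirDeriv v w (pairForm (fun i => lineForm (a' i)) + c ^ 2) = 0 := by
    intro v w hv
    have h1 := h v w hv
    have h2 := dirDeriv_hit v w hh ((hpd _ hy).add (hpd _ hda'))
    rw [map_add, dirDeriv_sq, add_zero] at h1 ⊢
    rwa [map_add, h1, zero_add] at h2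
  obtain ⟨g, hg⟩ := pairForm_values h'
  obtain ⟨K, hK, hK'⟩ := exists_eval_eq he3 g
  refine pairForm_mem_hit_of_X_mul (H := K ^ 2) fun i => ?_
  have hev : ∀ v, v ≠ 0 → eval v (lineForm (a' i) + X i * K ^ 2) = 0 := by
    intro v hv
    have h2 : ∀ c : ZMod 2, c ^ 2 = c := by decide
    rw [map_add, map_mul, map_pow, MvPolynomial.eval_X, hg v hv, hK' v hv, h2]
    exact ZModModule.add_self _
  obtain ⟨k, hk, hk'⟩ : ∃ k : Fin 3 → P 3, (∀ l, (k l).IsHomogeneous (2 ^ r - 1)) ∧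
      X i * K ^ 2 = lineForm k := by
    have h0 := MvPolynomial.isHomogeneous_zero (Fin 3) (ZMod 2) (2 ^ r - 1)
    refine ⟨Pi.single i K, fun l => ?_, ?_⟩
    · by_cases hl : l = i
      · subst hl; simpa using hK
      · simpa [hl] using h0
    · fin_cases i <;> simp [lineForm]
  rw [hk', ← lineForm_add] at hev ⊢
  refine lineForm_mem_hit_of_eval hr (fun l => (he ▸ hda i l).add (hk l)) fun v hv => ?_
  rw [← eval_lineForm]
  exact hev v hv

/-! ### Kameko's isomorphism in three variables -/

theorem lineForm_mem_hit_of_degree {m : ℕ} (hm : ∀ r, m + 2 ≠ 2 ^ r) {a : Fin 3 → P 3}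
    (ha : ∀ i, (a i).IsHomogeneous (m + 1)) : lineForm a ∈ hit 3 := by
  have h := fun i => X_mul_sq_mem_hit_of_degree i (ha i) (Nat.succ_pos m) hm
  exact add_mem (add_mem (h 0) (h 1)) (h 2)

/-- In degree `2m + 3`, if `m + 2` is not a power of `2`, every polynomial is congruent to one in the image
of `kamekoUp`. -/
theorem add_kamekoUp_mem_hit {m : ℕ} (hm : ∀ r, m + 2 ≠ 2 ^ r) {f : P 3}
    (hf : f.IsHomogeneous (2 * m + 3)) : f + kamekoUp (kamekoDown f) ∈ hit 3 := by
  obtain ⟨a, ha, h⟩ := parity_odd_kameko hf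
  have e : f + kamekoUp (kamekoDown f) = lineForm a := by
    nth_rw 1 [h]
    rw [add_assoc, ZModModule.add_self, add_zero]
  rw [e]
  exact lineForm_mem_hit_of_degree hm ha

/-- `kamekoUp` commutes with the Steenrod operations, with `Sq^{2j+2}` in place of `Sq^{j+1}`, up to a sum
of terms `x_i w^2`. -/
theorem kamekoUp_Sq_add (j : ℕ) (z : P 3) : kamekoUp (Sq (j + 1) z) + Sq (2 * (j + 1)) (kamekoUp z) =
    lineForm ![X 1 * X 2 * Sq j z, X 0 * X 2 * Sq j z, X 0 * X 1 * Sq j z] := by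
  have h1 : ∀ i l : Fin 3, ∀ m, Sq (2 * m + 1) (X i * z ^ 2) = X i ^ 2 * Sq m z ^ 2 := by
    intro i l m
    rw [Sq_X_mul, Sq_odd_sq, Sq_even_sq]; ring
  have h2 : ∀ i : Fin 3, ∀ m, Sq (2 * m) (X i * z ^ 2) = X i * Sq m z ^ 2 := by
    intro i m
    cases m with
    | zero => rw [mul_zero, Sq_zero, Sq_zero]
    | succ m =>
      rw [show 2 * (m + 1) = 2 * m + 1 + 1 by ring, Sq_X_mul, Sq_odd_sq,
        show 2 * m + 1 + 1 = 2 * (m + 1) by ring, Sq_even_sq]; ring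
  have h4 : Sq (2 * j + 1) (X 1 * (X 2 * z ^ 2)) = (X 1 * X 2 ^ 2 + X 1 ^ 2 * X 2) * Sq j z ^ 2 := by
    rw [Sq_X_mul, h1 2 2, h2]; ring
  have h5 : Sq (2 * (j + 1)) (X 1 * (X 2 * z ^ 2)) = X 1 * X 2 * Sq (j + 1) z ^ 2 +
      X 1 ^ 2 * X 2 ^ 2 * Sq j z ^ 2 := by
    rw [show 2 * (j + 1) = 2 * j + 1 + 1 by ring, Sq_X_mul, h1 2 2,
        show 2 * j + 1 + 1 = 2 * (j + 1) by ring, h2]; ring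
  have h6 : ∀ w : P 3, kamekoUp w = X 0 * (X 1 * (X 2 * w ^ 2)) := by
    intro w
    rw [kamekoUp, Fin.prod_univ_three]; ring
  have h7 : Sq (2 * (j + 1)) (kamekoUp z) = X 0 * Sq (2 * (j + 1)) (X 1 * (X 2 * z ^ 2)) +
      X 0 ^ 2 * Sq (2 * j + 1) (X 1 * (X 2 * z ^ 2)) := by
    rw [h6]
    exact Sq_X_mul 0 (2 * j + 1) _
  rw [h7, h4, h5, h6]
  simp only [lineForm, Matrix.cons_val]
  linear_combination (X 0 * X 1 * X 2 * Sq (j + 1) z ^ 2) * two_eq_zero_P (k := 3)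

/-- The error terms in `kamekoUp_Sq_add` have `w` of degree `m + 1`, so they are hit. -/
theorem kamekoUp_mem_hit {m : ℕ} (hm : ∀ r, m + 2 ≠ 2 ^ r) {f : P 3}
    (hf : f.IsHomogeneous m) (h : f ∈ hit 3) : kamekoUp f ∈ hit 3 := by
  refine mem_of_hit_homogeneous (W := hitOver (∏ i, X i)) (fun j a ha => ?_) h hf
  set z : P 3 := MvPolynomial.monomial a 1
  have hz : z.IsHomogeneous a.degree := MvPolynomial.isHomogeneous_monomial _ rfl
  change kamekoUp (Sq (j + 1) z) ∈ hit 3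
  refine mem_hit_of_add (g := Sq (2 * (j + 1)) (kamekoUp z)) ?_ (Sq_mem_hit' (by omega) _)
  rw [kamekoUp_Sq_add]
  have hX := fun i : Fin 3 => MvPolynomial.isHomogeneous_X (ZMod 2) i
  have h1 : ∀ i l : Fin 3, (X i * X l * Sq j z).IsHomogeneous (m + 1) := by
    intro i l
    have := ((hX i).mul (hX l)).mul (Sq_isHomogeneous j hz)
    rwa [show 1 + 1 + (a.degree + j) = m + 1 by omega] at this
  refine lineForm_mem_hit_of_degree hm fun i => ?_
  fin_cases i
  · exact h1 1 2
  · exact h1 0 2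
  · exact h1 0 1

/-- Kameko's theorem: in degree `2m + 3`, if `m + 2` is not a power of `2`, Kameko's homomorphism is
injective modulo hit polynomials. -/
theorem mem_hit_of_kamekoDown {m : ℕ} (hm : ∀ r, m + 2 ≠ 2 ^ r) {f : P 3}
    (hf : f.IsHomogeneous (2 * m + 3)) (h : kamekoDown f ∈ hit 3) : f ∈ hit 3 :=
  mem_hit_of_add (add_kamekoUp_mem_hit hm hf)
    (kamekoUp_mem_hit hm (kamekoDown_isHomogeneous hf) h)

/-- The degrees `2^{s+u+1} + 2^{u+1} + 2^u - 3`, by the recursion `n ↦ 2n + 3`, which is the effect of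
`kamekoUp` on degrees. -/
def kamekoDegree (s : ℕ) : ℕ → ℕ
  | 0 => 2 ^ (s + 1)
  | u + 1 => 2 * kamekoDegree s u + 3

theorem kamekoDegree_add (s u : ℕ) :
    kamekoDegree s u + 3 = 2 ^ (s + u + 1) + 2 ^ (u + 1) + 2 ^ u := by
  induction u with
  | zero => simp [kamekoDegree]
  | succ u ih =>
    rw [kamekoDegree, show 2 * kamekoDegree s u + 3 + 3 = 2 * (kamekoDegree s u + 3) by ring, ih]
    ring

/-- The condition of Kameko's theorem holds in the degrees `kamekoDegree s u`. -/
theorem kamekoDegree_ne {s : ℕ} (hs : 0 < s) (u r : ℕ) : kamekoDegree s u + 2 ≠ 2 ^ r := by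
  intro h
  have h1 := kamekoDegree_add s u
  cases u with
  | zero =>
    rw [kamekoDegree] at h
    have h4 : 2 ^ 2 ≤ 2 ^ (s + 1) := Nat.pow_le_pow_right (by norm_num) (by omega)
    rcases le_or_gt r (s + 1) with hr | hr
    · have := Nat.pow_le_pow_right (show 0 < 2 by norm_num) hr
      omega
    · have := Nat.pow_le_pow_right (show 0 < 2 by norm_num) hr
      rw [Nat.succ_eq_add_one, pow_succ] at this
      omega
  | succ u =>
    rw [kamekoDegree] at h
    cases r with
    | zero => omega
    | succ r => rw [pow_succ] at h; omega

/-! ### Invariant classes -/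

theorem mem_invariants_iff {k d : ℕ} {x : QP k} : x ∈ invariants k d ↔
    ∃ f : P k, f.IsHomogeneous d ∧ (∀ g, subst g f + f ∈ hit k) ∧ (hit k).mkQ f = x := by
  have key : ∀ (f : P k) (g : GL (Fin k) (ZMod 2)),
      QPact g ((hit k).mkQ f) = (hit k).mkQ f ↔ subst g f + f ∈ hit k := by
    intro f g
    rw [← ZModModule.sub_eq_add (subst g f) f]
    exact Submodule.Quotient.eq (hit k)
  constructor
  · rintro ⟨⟨f, hf, rfl⟩, hx⟩
    refine ⟨f, hf, fun g => (key f g).mp ?_, rfl⟩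
    exact (Submodule.mem_iInf _).mp hx g
  · rintro ⟨f, hf, hg, rfl⟩
    refine ⟨⟨f, hf, rfl⟩, (Submodule.mem_iInf _).mpr fun g => ?_⟩
    exact (key f g).mpr (hg g)

/-- Every nonzero vector is the image of the first basis vector under an invertible matrix. -/
theorem exists_GL_row (v : Fin 3 → ZMod 2) (hv : v ≠ 0) :
    ∃ g : GL (Fin 3) (ZMod 2), Matrix.vecMul ![1, 0, 0] g.1 = v := by
  have key : ∀ M : Matrix (Fin 3) (Fin 3) (ZMod 2), M.det ≠ 0 → ∀ v, Matrix.vecMul ![1, 0, 0] M = v →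
      ∃ g : GL (Fin 3) (ZMod 2), Matrix.vecMul ![1, 0, 0] g.1 = v :=
    fun M hM v hv => ⟨Matrix.GeneralLinearGroup.mkOfDetNeZero M hM, hv⟩
  revert v
  apply forall_points
  · exact key !![1, 0, 0; 0, 1, 0; 0, 0, 1] (by decide) _ (by decide)
  · exact key !![0, 1, 0; 1, 0, 0; 0, 0, 1] (by decide) _ (by decide)
  · exact key !![0, 0, 1; 1, 0, 0; 0, 1, 0] (by decide) _ (by decide)
  · exact key !![1, 1, 0; 0, 1, 0; 0, 0, 1] (by decide) _ (by decide)
  · exact key !![1, 0, 1; 0, 1, 0; 0, 0, 1] (by decide) _ (by decide)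
  · exact key !![0, 1, 1; 1, 0, 0; 0, 0, 1] (by decide) _ (by decide)
  · exact key !![1, 1, 1; 0, 1, 0; 0, 0, 1] (by decide) _ (by decide)

/-- The derivatives of a polynomial whose class is invariant vanish: the functional `w ↦ ∂_w f(v)` on
`F_2^3 / ⟨v⟩` is invariant under the stabilizer of `v`, which acts as `GL_2`. -/
theorem dirDeriv_eq_zero_of_invariant {s : ℕ} {f : P 3} (hf : f.IsHomogeneous (2 ^ (s + 1)))
    (h : ∀ g, subst g f + f ∈ hit 3) (v w : Fin 3 → ZMod 2) (hv : v ≠ 0) : dirDeriv v w f = 0 := by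
  have hs : ∀ a b : ZMod 2, a + b = 0 → a = b := by decide
  have hg : ∀ (g : GL (Fin 3) (ZMod 2)) (v w : Fin 3 → ZMod 2),
      dirDeriv (Matrix.vecMul v g.1) (Matrix.vecMul w g.1) f = dirDeriv v w f := by
    intro g v w
    rw [← dirDeriv_subst]
    refine hs _ _ ?_
    rw [← map_add]
    exact dirDeriv_hit v w (h g) ((subst_isHomogeneous g hf).add hf)
  have h0 : dirDeriv ![1, 0, 0] ![1, 0, 0] f = 0 := by
    rw [dirDeriv_self _ hf]
    have : ((2 ^ (s + 1) : ℕ) : ZMod 2) = 0 := by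
      rw [pow_succ, Nat.cast_mul, show ((2 : ℕ) : ZMod 2) = 0 from rfl, mul_zero]
    rw [this, zero_mul]
  have h12 := hg (Matrix.GeneralLinearGroup.mkOfDetNeZero !![1, 0, 0; 0, 0, 1; 0, 1, 0] (by decide))
    ![1, 0, 0] ![0, 1, 0]
  have h13 := hg (Matrix.GeneralLinearGroup.mkOfDetNeZero !![1, 0, 0; 0, 1, 1; 0, 1, 0] (by decide))
    ![1, 0, 0] ![0, 1, 0]
  rw [show Matrix.vecMul ![1, 0, 0] (Matrix.GeneralLinearGroup.mkOfDetNeZero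
      (!![1, 0, 0; 0, 0, 1; 0, 1, 0] : Matrix (Fin 3) (Fin 3) (ZMod 2)) (by decide)).1 = ![1, 0, 0] by decide,
    show Matrix.vecMul ![0, 1, 0] (Matrix.GeneralLinearGroup.mkOfDetNeZero
      (!![1, 0, 0; 0, 0, 1; 0, 1, 0] : Matrix (Fin 3) (Fin 3) (ZMod 2)) (by decide)).1 = ![0, 0, 1] by decide]
    at h12
  rw [show Matrix.vecMul ![1, 0, 0] (Matrix.GeneralLinearGroup.mkOfDetNeZero
      (!![1, 0, 0; 0, 1, 1; 0, 1, 0] : Matrix (Fin 3) (Fin 3) (ZMod 2)) (by decide)).1 = ![1, 0, 0] by decide,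
    show Matrix.vecMul ![0, 1, 0] (Matrix.GeneralLinearGroup.mkOfDetNeZero
      (!![1, 0, 0; 0, 1, 1; 0, 1, 0] : Matrix (Fin 3) (Fin 3) (ZMod 2)) (by decide)).1 =
        ![0, 1, 0] + ![0, 0, 1] by decide, dirDeriv_add_right] at h13
  have h2 : dirDeriv ![1, 0, 0] ![0, 0, 1] f = 0 := left_eq_add.mp h13.symm
  have h1 : dirDeriv ![1, 0, 0] ![0, 1, 0] f = 0 := h12.symm.trans h2
  have hall : ∀ w, dirDeriv ![1, 0, 0] w f = 0 := by
    intro w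
    by_cases hw : w = 0
    · have := dirDeriv_add_right ![1, 0, 0] 0 0 f
      rw [add_zero] at this
      rw [hw]
      exact left_eq_add.mp this
    revert w
    apply forall_points
    · exact h0
    · exact h1
    · exact h2
    · rw [show (![1, 1, 0] : Fin 3 → ZMod 2) = ![1, 0, 0] + ![0, 1, 0] by decide, dirDeriv_add_right,
        h0, h1, add_zero]
    · rw [show (![1, 0, 1] : Fin 3 → ZMod 2) = ![1, 0, 0] + ![0, 0, 1] by decide, dirDeriv_add_right,
        h0, h2, add_zero]
    · rw [show (![0, 1, 1] : Fin 3 → ZMod 2) = ![0, 1, 0] + ![0, 0, 1] by decide, dirDeriv_add_right,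
        h1, h2, add_zero]
    · rw [show (![1, 1, 1] : Fin 3 → ZMod 2) = ![1, 0, 0] + ![0, 1, 0] + ![0, 0, 1] by decide,
        dirDeriv_add_right, dirDeriv_add_right, h0, h1, h2, add_zero, add_zero]
  obtain ⟨g, rfl⟩ := exists_GL_row v hv
  have := hg g ![1, 0, 0] (Matrix.vecMul w g⁻¹.1)
  rw [hall, Matrix.vecMul_vecMul, ← Units.val_mul, inv_mul_cancel, Units.val_one,
    Matrix.vecMul_one] at this
  exact this

/-- In degree `2^{s+1}`, the derivatives at the points over `F_2` detect the hit polynomials, up to `p̄_0` in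
degree `8`. -/
theorem mem_hit_of_dirDeriv {s : ℕ} (hs : 0 < s) {f : P 3} (hf : f.IsHomogeneous (2 ^ (s + 1)))
    (h : ∀ v w, v ≠ 0 → dirDeriv v w f = 0) : f ∈ hit 3 ∨ s = 2 ∧ f + pBar0 ∈ hit 3 := by
  have h1 := Nat.one_le_two_pow (n := s)
  rw [show 2 ^ (s + 1) = 2 * (2 ^ s - 1) + 2 by rw [pow_succ]; omega] at hf
  obtain ⟨y, c, hy, hc, rfl⟩ := parity_even hf
  have hc2 := sq_mem_hit (Nat.succ_pos _) hc
  obtain ⟨g, hg⟩ := pairForm_values h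
  rcases (by omega : s = 1 ∨ s = 2 ∨ 3 ≤ s) with rfl | rfl | hs3
  · exact Or.inl (add_mem (pairForm_mem_hit_degree_four hy hg) hc2)
  · rcases pairForm_mem_hit_degree_eight hy hg with h8 | h8
    · exact Or.inl (add_mem h8 hc2)
    · right
      refine ⟨rfl, ?_⟩
      rw [add_right_comm]
      exact add_mem h8 hc2
  · obtain ⟨r, rfl⟩ : ∃ r, s = r + 1 := ⟨s - 1, by omega⟩
    exact Or.inl (add_mem (pairForm_mem_hit_of_dirDeriv (by omega) hy h) hc2)

theorem pBar0_isHomogeneous : pBar0.IsHomogeneous 8 := by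
  have hX := fun i : Fin 3 => MvPolynomial.isHomogeneous_X (ZMod 2) i
  exact (((((hX 0).mul (hX 1)).mul ((hX 2).pow 6)).add
    (((hX 0).mul ((hX 1).pow 6)).mul (hX 2))).add
    ((((hX 0).pow 3).mul (hX 1)).mul ((hX 2).pow 4))).add
    ((((hX 0).pow 3).mul ((hX 1).pow 4)).mul (hX 2))

theorem dirDeriv_pBar0 (v w : Fin 3 → ZMod 2) : dirDeriv v w pBar0 = 0 := by
  rw [pBar0_eq_pairForm, pairForm, map_add, map_add, dirDeriv_mul_sq, dirDeriv_mul_sq, dirDeriv_mul_sq,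
    dirDeriv_mul, dirDeriv_mul, dirDeriv_mul]
  simp only [dirDeriv_X, MvPolynomial.eval_X, Matrix.cons_val, map_add, map_mul, map_pow, map_zero]
  generalize v 0 = a, v 1 = b, v 2 = c, w 0 = p, w 1 = q, w 2 = r
  revert a b c p q r
  decide

theorem mem_hit_of_subst {k : ℕ} (g : GL (Fin k) (ZMod 2)) {f : P k} (h : subst g f ∈ hit k) :
    f ∈ hit k := by
  have h2 := Submodule.mem_comap.mp (hit_le_comap g⁻¹ h)
  rwa [AlgHom.toLinearMap_apply, ← subst_mul, inv_mul_cancel, subst_one] at h2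

theorem dirDeriv_subst_pBar0 (g : GL (Fin 3) (ZMod 2)) (v w : Fin 3 → ZMod 2) :
    dirDeriv v w (subst g pBar0) = 0 := by
  rw [dirDeriv_subst, dirDeriv_pBar0]

theorem mem_hit_of_degree_eight {f : P 3} (hf : f.IsHomogeneous 8)
    (h : ∀ v w, v ≠ 0 → dirDeriv v w f = 0) : f ∈ hit 3 ∨ f + pBar0 ∈ hit 3 :=
  (mem_hit_of_dirDeriv (s := 2) two_pos (by norm_num; exact hf) h).imp_right And.right

/-- The derivatives of `subst g p̄_0` vanish, so it is hit or congruent to `p̄_0`. In the first case `p̄_0` would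
be hit as well, and the class of `p̄_0` is invariant in either case. -/
theorem pBar0_invariant (g : GL (Fin 3) (ZMod 2)) : subst g pBar0 + pBar0 ∈ hit 3 := by
  rcases mem_hit_of_degree_eight (subst_isHomogeneous g pBar0_isHomogeneous)
    fun v w _ => dirDeriv_subst_pBar0 g v w with h | h
  · exact add_mem h (mem_hit_of_subst g h)
  · exact h

theorem iterate_kamekoUp_isHomogeneous (u : ℕ) :
    (kamekoUp^[u] pBar0).IsHomogeneous (kamekoDegree 2 u) := by
  induction u with
  | zero => rw [show kamekoDegree 2 0 = 8 by simp [kamekoDegree]]; exact pBar0_isHomogeneous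
  | succ u ih => rw [Function.iterate_succ_apply']; exact kamekoUp_isHomogeneous ih

theorem iterate_kamekoUp_invariant (u : ℕ) (g : GL (Fin 3) (ZMod 2)) :
    subst g (kamekoUp^[u] pBar0) + kamekoUp^[u] pBar0 ∈ hit 3 := by
  induction u with
  | zero => exact pBar0_invariant g
  | succ u ih =>
    have hd := iterate_kamekoUp_isHomogeneous (u + 1)
    refine mem_hit_of_kamekoDown (kamekoDegree_ne (by norm_num) u)
      ((subst_isHomogeneous g hd).add hd) ?_
    rwa [Function.iterate_succ_apply', map_add, kamekoDown_subst, kamekoDown_kamekoUp]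

/-- Induction on `u`: Kameko's homomorphism preserves invariance and is injective modulo hit polynomials. -/
theorem mem_hit_of_invariant {s : ℕ} (hs : 0 < s) (u : ℕ) {f : P 3}
    (hf : f.IsHomogeneous (kamekoDegree s u)) (h : ∀ g, subst g f + f ∈ hit 3) :
    f ∈ hit 3 ∨ s = 2 ∧ f + kamekoUp^[u] pBar0 ∈ hit 3 := by
  induction u generalizing f with
  | zero => exact mem_hit_of_dirDeriv hs hf (dirDeriv_eq_zero_of_invariant hf h)
  | succ u ih =>
    have hm := kamekoDegree_ne hs u
    rcases ih (kamekoDown_isHomogeneous hf) (fun g => by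
      rw [← kamekoDown_subst, ← map_add]; exact kamekoDown_hit (h g)) with h1 | ⟨rfl, h1⟩
    · exact Or.inl (mem_hit_of_kamekoDown hm hf h1)
    · refine Or.inr ⟨rfl, mem_hit_of_kamekoDown hm
        (hf.add (iterate_kamekoUp_isHomogeneous (u + 1))) ?_⟩
      rwa [Function.iterate_succ_apply', map_add, kamekoDown_kamekoUp]

theorem invariants_two (u : ℕ) : invariants 3 (kamekoDegree 2 u) =
    Submodule.span (ZMod 2) {(hit 3).mkQ (kamekoUp^[u] pBar0)} := by
  refine le_antisymm (fun x hx => ?_) ?_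
  · obtain ⟨f, hf, hg, rfl⟩ := mem_invariants_iff.mp hx
    rcases mem_hit_of_invariant (by norm_num) u hf hg with h | ⟨-, h⟩
    · rw [(Submodule.Quotient.mk_eq_zero (hit 3)).mpr h |> (fun h => (h : (hit 3).mkQ f = 0))]
      exact zero_mem _
    · have : (hit 3).mkQ f = (hit 3).mkQ (kamekoUp^[u] pBar0) := by
        rw [← ZModModule.sub_eq_add] at h
        exact (Submodule.Quotient.eq (hit 3)).mpr h
      rw [this]
      exact Submodule.mem_span_singleton_self _
  · rw [Submodule.span_singleton_le_iff_mem]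
    exact mem_invariants_iff.mpr
      ⟨_, iterate_kamekoUp_isHomogeneous u, iterate_kamekoUp_invariant u, rfl⟩

theorem invariants_eq_bot {s : ℕ} (hs : 0 < s) (hs2 : s ≠ 2) (u : ℕ) :
    invariants 3 (kamekoDegree s u) = ⊥ := by
  rw [eq_bot_iff]
  intro x hx
  obtain ⟨f, hf, hg, rfl⟩ := mem_invariants_iff.mp hx
  rcases mem_hit_of_invariant hs u hf hg with h | ⟨h, -⟩
  · exact (Submodule.Quotient.mk_eq_zero (hit 3)).mpr h
  · exact absurd h hs2

/-! ### A recursion for the Singer transfer -/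

/-- The map `P_k → P_{k+1}`, `f ↦ x_{k+1}^m f`. -/
def lastMul {k : ℕ} (m : ℕ) : P k →ₗ[ZMod 2] P (k + 1) :=
  (LinearMap.mulLeft (ZMod 2) (X (Fin.last k) ^ m)).comp
    (MvPolynomial.rename (R := ZMod 2) Fin.castSucc).toLinearMap

theorem lastMul_apply {k : ℕ} (m : ℕ) (f : P k) :
    lastMul m f = X (Fin.last k) ^ m * MvPolynomial.rename Fin.castSucc f := rfl

theorem lastMul_succ {k : ℕ} (m : ℕ) (f : P k) :
    lastMul (m + 1) f = X (Fin.last k) * lastMul m f := by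
  rw [lastMul_apply, lastMul_apply, pow_succ', mul_assoc]

theorem toLaurent_X {k : ℕ} (i : Fin k) : toLaurent k (X i) = lmon (Pi.single i 1) := by
  simp [toLaurent]

theorem toLaurent_lastMul_zero {k : ℕ} (f : P k) :
    toLaurent (k + 1) (lastMul 0 f) = incl k (toLaurent k f) := by
  have : (incl k).comp (toLaurent k) =
      (toLaurent (k + 1)).comp (MvPolynomial.rename (R := ZMod 2) Fin.castSucc) := by
    apply MvPolynomial.algHom_ext
    intro i
    simp [toLaurent, incl_var]
  rw [lastMul_apply, pow_zero, one_mul]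
  exact (congrArg (fun F => F f) this).symm

/-- The values of Singer's class in one more variable: `f ↦ ∑_{m + j = i} x_{k+1}^m Sq^j(f)`. -/
def singerStep {k : ℕ} (i : ℕ) : P k →ₗ[ZMod 2] P (k + 1) :=
  ∑ q ∈ Finset.HasAntidiagonal.antidiagonal i, (lastMul q.1).comp (Sq q.2)

theorem singerStep_apply {k : ℕ} (i : ℕ) (f : P k) : singerStep i f =
    ∑ q ∈ Finset.HasAntidiagonal.antidiagonal i, lastMul q.1 (Sq q.2 f) := by
  rw [singerStep, LinearMap.sum_apply]; rfl

theorem singerStep_succ {k : ℕ} (i : ℕ) (f : P k) :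
    singerStep (i + 1) f = X (Fin.last k) * singerStep i f + lastMul 0 (Sq (i + 1) f) := by
  rw [singerStep_apply, singerStep_apply, Finset.Nat.sum_antidiagonal_succ, Finset.mul_sum]
  simp only [lastMul_succ]
  exact add_comm _ _

/-- The lift of `f` is `x_{k+1}^{-1} f`. The difference between `Sq^{i+1}` of the lift and the lift of
`Sq^{i+1}(f)` is the polynomial `singerStep i f`. -/
theorem SqL_lift {k : ℕ} (i : ℕ) (f : P k) :
    SqL (i + 1) (lift k (toLaurent k f)) + lift k (SqL (i + 1) (toLaurent k f)) =
      toLaurent (k + 1) (singerStep i f) := by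
  have step : ∀ j, SqL (j + 1) (lift k (toLaurent k f)) + lift k (SqL (j + 1) (toLaurent k f)) =
      lmon (Pi.single (Fin.last k) 1) *
        (SqL j (lift k (toLaurent k f)) + lift k (SqL j (toLaurent k f))) +
          incl k (SqL j (toLaurent k f)) := by
    intro j
    have h1 := SqL_var_mul (Fin.last k) j (lift k (toLaurent k f))
    rw [var_mul_lift, SqL_incl, ← var_mul_lift] at h1
    rw [mul_add, var_mul_lift, add_assoc, ZModModule.add_self, add_zero]
    apply lmon_mul_cancel (Fin.last k)
    rw [mul_add, h1, ← mul_assoc, ← pow_two, ← add_assoc, ZModModule.add_self, zero_add]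
  induction i with
  | zero =>
    rw [step, SqL_zero, SqL_zero, ZModModule.add_self, mul_zero, zero_add, singerStep_apply]
    simp [Sq_zero, toLaurent_lastMul_zero]
  | succ i ih =>
    rw [step, ih, singerStep_succ, map_add, map_mul, toLaurent_X, toLaurent_lastMul_zero, SqL_toLaurent]

/-- Singer's class in `k + 1` variables is the image of the class in `k` variables under a connecting
homomorphism. Since the latter is a cocycle, only the first entry of the bar enters. -/
theorem singerClass_cons (k : ℕ) (a : A) (l : List A) : singerClass (k + 1) (a :: l) =
    lact (k + 1) a (lift k (singerClass k l)) + lift k (lact k a (singerClass k l)) := by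
  have h := congrFun (singerClass_cocycle k) (a :: l)
  simp only [barD, Pi.zero_apply] at h
  have h' : lact k a (singerClass k l) = barAux (singerClass k) (a :: l) := by
    rw [← sub_eq_zero, ZModModule.sub_eq_add]
    exact h
  simp only [singerClass, barD]
  rw [barAux_map, h']

theorem fromLaurent_singerClass (k i : ℕ) (l : List A) :
    fromLaurent (k + 1) (singerClass (k + 1) (sqA (i + 1) :: l)) =
      singerStep i (fromLaurent k (singerClass k l)) := by
  obtain ⟨p, hp⟩ := singerClass_polys k l
  rw [AlgHom.toLinearMap_apply] at hp
  rw [singerClass_cons, lact_sqA, lact_sqA, ← hp, SqL_lift, fromLaurent_toLaurent, fromLaurent_toLaurent]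

/-- The cycle in the lambda algebra which represents the Singer transfer of `b`, in stem `d`. -/
def transferLam (k d : ℕ) : Module.Dual (ZMod 2) (P k) →ₗ[ZMod 2] T :=
  (kap k d).comp
    ({ toFun := transferCochain k
       map_add' := fun _ _ => rfl
       map_smul' := fun _ _ => rfl } :
      Module.Dual (ZMod 2) (P k) →ₗ[ZMod 2] (List A → ZMod 2))

theorem transferLam_apply (k d : ℕ) (b : Module.Dual (ZMod 2) (P k)) :
    transferLam k d b = kap k d (transferCochain k b) := rfl

theorem transferLam_zero (d : ℕ) (b : Module.Dual (ZMod 2) (P 0)) :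
    transferLam 0 d b = if d = 0 then algebraMap (ZMod 2) T (b 1) else 0 := by
  rw [transferLam_apply, kap]
  split_ifs with hd
  · change algebraMap (ZMod 2) T (b (fromLaurent 0 1)) = _
    rw [← map_one (toLaurent 0), fromLaurent_toLaurent]
  · rfl

/-- The transfer of `b` by recursion on the number of variables: the coefficient of `λ_{a_1} ⋯ λ_{a_k}` is the
value of `b` on `singerStep a_k (⋯ (singerStep a_1 1))`. -/
theorem transferLam_succ (k d : ℕ) (b : Module.Dual (ZMod 2) (P (k + 1))) :
    transferLam (k + 1) d b = ∑ p ∈ Finset.HasAntidiagonal.antidiagonal d,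
      transferLam k p.2 (b.comp (singerStep p.1)) * lam p.1 := by
  rw [transferLam_apply, kap_succ]
  refine Finset.sum_congr rfl fun p _ => ?_
  have : (fun l => transferCochain (k + 1) b (sqA (p.1 + 1) :: l)) =
      transferCochain k (b.comp (singerStep p.1)) := by
    funext l
    simp only [transferCochain]
    rw [fromLaurent_singerClass]
    rfl
  rw [this, transferLam_apply]

/-! ### Kameko's homomorphism and the transfer -/

theorem kamekoDown_prod_mul_sq {k : ℕ} (S : Finset (Fin k)) (hS : S ≠ Finset.univ) (w : P k) :
    kamekoDown ((∏ i ∈ S, X i) * w ^ 2) = 0 := by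
  have := half_Sq_eq_zero S w Finset.univ 0 fun h => hS (Finset.univ_subset_iff.mp h)
  rwa [Sq_zero] at this

/-- The decomposition into parity components, in one more variable. -/
theorem rename_eq_sum {k : ℕ} (f : P k) : MvPolynomial.rename Fin.castSucc f =
    ∑ S : Finset (Fin k), (∏ i ∈ S.map Fin.castSuccEmb, X i) *
      MvPolynomial.rename Fin.castSucc (half S f) ^ 2 := by
  conv_lhs => rw [← sum_parity f]
  rw [map_sum]
  refine Finset.sum_congr rfl fun S _ => ?_
  rw [map_mul, map_pow, map_prod, Finset.prod_map]
  simp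

theorem last_notMem {k : ℕ} (S : Finset (Fin k)) : Fin.last k ∉ S.map Fin.castSuccEmb := by
  simp [Finset.mem_map, Fin.castSucc_ne_last]

theorem kamekoDown_lastMul_even {k : ℕ} (m : ℕ) (f : P k) : kamekoDown (lastMul (2 * m) f) = 0 := by
  rw [lastMul_apply, mul_comm, mul_comm 2 m, pow_mul, half_mul_sq, rename_eq_sum, map_sum,
    Finset.sum_eq_zero, mul_zero]
  intro S _
  refine kamekoDown_prod_mul_sq _ (fun h => last_notMem S ?_) _
  rw [h]; exact Finset.mem_univ _

theorem kamekoDown_lastMul_odd {k : ℕ} (m : ℕ) (f : P k) :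
    kamekoDown (lastMul (2 * m + 1) f) = lastMul m (kamekoDown f) := by
  have h1 : lastMul (2 * m + 1) f =
      X (Fin.last k) * MvPolynomial.rename Fin.castSucc f * (X (Fin.last k) ^ m) ^ 2 := by
    rw [lastMul_apply]; ring
  have h2 : ∀ S : Finset (Fin k), ∏ i ∈ insert (Fin.last k) (S.map Fin.castSuccEmb), (X i : P (k + 1)) =
      X (Fin.last k) * ∏ i ∈ S.map Fin.castSuccEmb, X i :=
    fun S => Finset.prod_insert (last_notMem S)
  have h3 : insert (Fin.last k) ((Finset.univ : Finset (Fin k)).map Fin.castSuccEmb) =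
      Finset.univ := by
    ext i
    refine Fin.lastCases ?_ (fun i => ?_) i <;> simp
  rw [h1, half_mul_sq, lastMul_apply]
  congr 1
  rw [rename_eq_sum, Finset.mul_sum, map_sum, Finset.sum_eq_single Finset.univ]
  · rw [← mul_assoc, ← h2, h3]
    exact kamekoDown_kamekoUp _
  · intro S _ hS
    rw [← mul_assoc, ← h2]
    refine kamekoDown_prod_mul_sq _ (fun h => hS ?_) _
    ext i
    have : Fin.castSucc i ∈ insert (Fin.last k) (S.map Fin.castSuccEmb) := by
      rw [h]; exact Finset.mem_univ _
    simpa [Fin.castSucc_ne_last] using this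
  · simp

/-- Kameko's homomorphism needs an odd exponent of `x_{k+1}` and an even square. -/
theorem kamekoDown_singerStep_even {k : ℕ} (i : ℕ) (f : P k) :
    kamekoDown (singerStep (2 * i) f) = 0 := by
  rw [singerStep_apply, map_sum]
  refine Finset.sum_eq_zero fun q hq => ?_
  rw [Finset.HasAntidiagonal.mem_antidiagonal] at hq
  obtain ⟨m, hm | hm⟩ := Nat.even_or_odd' q.1
  · rw [hm, kamekoDown_lastMul_even]
  · obtain ⟨j, hj⟩ : ∃ j, q.2 = 2 * j + 1 := ⟨i - m - 1, by omega⟩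
    rw [hm, hj, kamekoDown_lastMul_odd, kamekoDown_Sq_odd, map_zero]

theorem kamekoDown_singerStep_odd {k : ℕ} (i : ℕ) (f : P k) :
    kamekoDown (singerStep (2 * i + 1) f) = singerStep i (kamekoDown f) := by
  rw [singerStep_apply, singerStep_apply, map_sum]
  refine (Finset.sum_of_injOn (fun q => (2 * q.1 + 1, 2 * q.2)) ?_ ?_ ?_ ?_).symm
  · rintro ⟨a, b⟩ _ ⟨c, d⟩ _ h
    simp only [Prod.mk.injEq] at h ⊢
    omega
  · rintro ⟨a, b⟩ h
    simp only [Finset.mem_coe, Finset.HasAntidiagonal.mem_antidiagonal] at h ⊢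
    omega
  · rintro ⟨a, b⟩ h hn
    rw [Finset.HasAntidiagonal.mem_antidiagonal] at h
    obtain ⟨m, hm | hm⟩ := Nat.even_or_odd' a
    · rw [hm, kamekoDown_lastMul_even]
    · refine absurd ⟨(m, i - m), ?_, ?_⟩ hn
      · simp only [Finset.mem_coe, Finset.HasAntidiagonal.mem_antidiagonal] at h ⊢
        omega
      · simp only [Prod.mk.injEq] at h ⊢
        omega
  · rintro ⟨a, b⟩ _
    rw [kamekoDown_lastMul_odd, kamekoDown_Sq_even]

/-- Composition with Kameko's homomorphism corresponds to `Sq^0`, on the level of representatives. -/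
theorem transferLam_kamekoDown (k : ℕ) (b : Module.Dual (ZMod 2) (P k)) :
    (∀ d, transferLam k (2 * d + k) (b.comp kamekoDown) = sqZero (transferLam k d b)) ∧
    ∀ e, (∀ d, e ≠ 2 * d + k) → transferLam k e (b.comp kamekoDown) = 0 := by
  induction k with
  | zero =>
    have h1 : kamekoDown (1 : P 0) = 1 := half_empty_one
    constructor
    · intro d
      rw [transferLam_zero, transferLam_zero, LinearMap.comp_apply, h1]
      by_cases hd : d = 0
      · rw [if_pos (by omega), if_pos hd, AlgHom.commutes]
      · rw [if_neg (by omega), if_neg hd, map_zero]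
    · intro e he
      rw [transferLam_zero, if_neg]
      intro h
      exact he 0 (by omega)
  | succ k ih =>
    have heven : ∀ i e, transferLam k e ((b.comp kamekoDown).comp (singerStep (2 * i))) = 0 := by
      intro i e
      have : (b.comp kamekoDown).comp (singerStep (2 * i)) = 0 :=
        LinearMap.ext fun f => by
          rw [LinearMap.comp_apply, LinearMap.comp_apply, kamekoDown_singerStep_even, map_zero]; rfl
      rw [this, map_zero]
    have hodd : ∀ i, (b.comp kamekoDown).comp (singerStep (2 * i + 1)) =
        (b.comp (singerStep i)).comp kamekoDown := fun i => LinearMap.ext fun f => by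
      rw [LinearMap.comp_apply, LinearMap.comp_apply, kamekoDown_singerStep_odd]; rfl
    constructor
    · intro d
      rw [transferLam_succ, transferLam_succ, map_sum]
      refine (Finset.sum_of_injOn (fun q => (2 * q.1 + 1, 2 * q.2 + k)) ?_ ?_ ?_ ?_).symm
      · rintro ⟨a, c⟩ _ ⟨a', c'⟩ _ h
        simp only [Prod.mk.injEq] at h ⊢
        omega
      · rintro ⟨a, c⟩ h
        simp only [Finset.mem_coe, Finset.HasAntidiagonal.mem_antidiagonal] at h ⊢
        omega
      · rintro ⟨a, c⟩ h hn
        rw [Finset.HasAntidiagonal.mem_antidiagonal] at h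
        obtain ⟨i, hi | hi⟩ := Nat.even_or_odd' a
        · rw [hi, heven, zero_mul]
        · rw [hi, hodd, (ih _).2, zero_mul]
          intro d' hd'
          refine hn ⟨(i, d'), ?_, ?_⟩
          · simp only [Finset.mem_coe, Finset.HasAntidiagonal.mem_antidiagonal] at h ⊢
            omega
          · simp only [Prod.mk.injEq] at h ⊢
            omega
      · rintro ⟨a, c⟩ _
        rw [hodd, (ih _).1, map_mul, sqZero_lam]
    · intro e he
      rw [transferLam_succ]
      refine Finset.sum_eq_zero ?_
      rintro ⟨a, c⟩ h
      rw [Finset.HasAntidiagonal.mem_antidiagonal] at h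
      obtain ⟨i, hi | hi⟩ := Nat.even_or_odd' a
      · rw [hi, heven, zero_mul]
      · rw [hi, hodd, (ih _).2, zero_mul]
        intro d' hd'
        refine he (i + d') ?_
        simp only at h
        omega

/-! ### Kameko's isomorphism on the duals -/

theorem comp_kamekoDown_mem {k d : ℕ} {b : Module.Dual (ZMod 2) (P k)} (hb : b ∈ Prim k d) :
    b.comp kamekoDown ∈ Prim k (2 * d + k) := by
  refine ⟨fun m hm f hf => ?_, fun j f => ?_⟩
  · rw [LinearMap.comp_apply]
    by_cases he : ∃ e, m = 2 * e + k
    · obtain ⟨e, rfl⟩ := he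
      exact hb.1 e (by omega) _ (kamekoDown_isHomogeneous hf)
    · push Not at he
      rw [half_eq_zero_of_degree _ hf (by simpa using he), map_zero]
  · rw [LinearMap.comp_apply]
    obtain ⟨m, hm | hm⟩ := Nat.even_or_odd' (j + 1)
    · obtain ⟨m, rfl⟩ : ∃ r, m = r + 1 := ⟨m - 1, by omega⟩
      rw [hm, kamekoDown_Sq_even, hb.2]
    · rw [hm, kamekoDown_Sq_odd, map_zero]

theorem prim_hit {k d : ℕ} {b : Module.Dual (ZMod 2) (P k)} (hb : b ∈ Prim k d) {f : P k}
    (hf : f ∈ hit k) : b f = 0 := by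
  have : hit k ≤ LinearMap.ker b := by
    refine iSup_le fun j => ?_
    rintro _ ⟨f, rfl⟩
    exact hb.2 j f
  exact this hf

/-- A functional annihilated by the Steenrod operations takes the same value on congruent polynomials. -/
theorem prim_congr {k d : ℕ} {b : Module.Dual (ZMod 2) (P k)} (hb : b ∈ Prim k d) {f g : P k}
    (h : f + g ∈ hit k) : b f = b g := by
  have := prim_hit hb h
  rwa [map_add, ← ZModModule.sub_eq_add, sub_eq_zero] at this

/-- The map `b ↦ b ∘ kamekoUp`. -/
def compKamekoUp {k : ℕ} (b : Module.Dual (ZMod 2) (P k)) : Module.Dual (ZMod 2) (P k) :=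
  b.comp ({ toFun := kamekoUp, map_add' := kamekoUp_add, map_smul' := kamekoUp_smul } :
    P k →ₗ[ZMod 2] P k)

theorem compKamekoUp_mem {m : ℕ} (hm : ∀ r, m + 2 ≠ 2 ^ r) {b : Module.Dual (ZMod 2) (P 3)}
    (hb : b ∈ Prim 3 (2 * m + 3)) : compKamekoUp b ∈ Prim 3 m := by
  have h1 : ∀ d, d ≠ m → ∀ f ∈ MvPolynomial.homogeneousSubmodule (Fin 3) (ZMod 2) d,
      compKamekoUp b f = 0 :=
    fun d hd f hf => hb.1 (2 * d + 3) (by omega) _ (kamekoUp_isHomogeneous hf)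
  refine ⟨h1, fun j f => ?_⟩
  refine additive_induction (p := fun f => compKamekoUp b (Sq (j + 1) f) = 0) ?_ ?_ ?_ f
  · rw [map_zero, map_zero]
  · intro f g hf hg; rw [map_add, map_add, hf, hg, add_zero]
  · intro a
    have ha := Sq_isHomogeneous (j + 1) (MvPolynomial.isHomogeneous_monomial (1 : ZMod 2) (rfl : a.degree = a.degree))
    by_cases hd : a.degree + (j + 1) = m
    · rw [hd] at ha
      exact prim_hit hb (kamekoUp_mem_hit hm ha (Sq_mem_hit j _))
    · exact h1 _ hd _ ha

/-- Kameko's isomorphism on the duals: in degree `2m + 3`, if `m + 2` is not a power of `2`, a functional that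
vanishes on hit polynomials factors through `kamekoDown`. -/
theorem eq_comp_kamekoDown {m : ℕ} (hm : ∀ r, m + 2 ≠ 2 ^ r) {b : Module.Dual (ZMod 2) (P 3)}
    (hb : b ∈ Prim 3 (2 * m + 3)) : b = (compKamekoUp b).comp kamekoDown := by
  refine LinearMap.ext fun f => ?_
  refine additive_induction (p := fun f => b f = (compKamekoUp b).comp kamekoDown f) ?_ ?_ ?_ f
  · rw [map_zero, map_zero]
  · intro f g hf hg; rw [map_add, map_add, hf, hg]
  · intro a
    have ha := MvPolynomial.isHomogeneous_monomial (1 : ZMod 2) (rfl : a.degree = a.degree)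
    by_cases hd : a.degree = 2 * m + 3
    · rw [hd] at ha
      exact prim_congr hb (add_kamekoUp_mem_hit hm ha)
    · rw [hb.1 _ hd _ ha, (comp_kamekoDown_mem (compKamekoUp_mem hm hb)).1 _ hd _ ha]

/-! ### Steenrod squares of monomials -/

/-- The Cartan formula. -/
theorem Sq_mul {k : ℕ} (j : ℕ) (f g : P k) :
    Sq j (f * g) = ∑ q ∈ Finset.HasAntidiagonal.antidiagonal j, Sq q.1 f * Sq q.2 g := by
  simp only [Sq, LinearMap.comp_apply, AlgHom.toLinearMap_apply, map_mul,
    LinearMap.coe_restrictScalars, PowerSeries.coeff_mul]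

theorem Sq_one {k : ℕ} (j : ℕ) : Sq j (1 : P k) = if j = 0 then 1 else 0 := by
  cases j with
  | zero => rw [Sq_zero, if_pos rfl]
  | succ j => rw [Sq_one_pos, if_neg (Nat.succ_ne_zero j)]

theorem Sq_X_pow {k : ℕ} (i : Fin k) (m j : ℕ) :
    Sq j (X i ^ m : P k) = (m.choose j : ZMod 2) • X i ^ (m + j) := by
  induction m generalizing j with
  | zero =>
    rw [pow_zero, Sq_one]
    cases j <;> simp
  | succ m ih =>
    rw [pow_succ']
    cases j with
    | zero => rw [Sq_X_mul_zero, ih]; simp [pow_succ']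
    | succ j =>
      rw [Sq_X_mul, ih, ih, Nat.choose_succ_succ, Nat.cast_add, add_smul, mul_smul_comm, mul_smul_comm,
        ← pow_succ', ← pow_add, add_comm, show 2 + (m + j) = m + 1 + (j + 1) by ring,
        show m + (j + 1) + 1 = m + 1 + (j + 1) by ring]

theorem Sq_rename {k : ℕ} (j : ℕ) (f : P k) :
    Sq j (MvPolynomial.rename Fin.castSucc f) = MvPolynomial.rename Fin.castSucc (Sq j f) := by
  induction f using poly_induction generalizing j with
  | h0 => simp
  | h1 => rw [map_one, Sq_one, Sq_one]; split_ifs <;> simp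
  | hadd f g hf hg => rw [map_add, map_add, hf, hg, map_add, map_add]
  | hX i f hf =>
    rw [map_mul, MvPolynomial.rename_X]
    cases j with
    | zero => rw [Sq_zero, Sq_zero, map_mul, MvPolynomial.rename_X]
    | succ j => rw [Sq_X_mul, Sq_X_mul, hf, hf]; simp

theorem Sq_lastMul {k : ℕ} (j m : ℕ) (f : P k) : Sq j (lastMul m f) =
    ∑ q ∈ Finset.HasAntidiagonal.antidiagonal j,
      (m.choose q.1 : ZMod 2) • lastMul (m + q.1) (Sq q.2 f) := by
  rw [lastMul_apply, Sq_mul]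
  refine Finset.sum_congr rfl fun q _ => ?_
  rw [Sq_X_pow, Sq_rename, lastMul_apply, smul_mul_assoc]

/-- The monomial `x_1^a x_2^b x_3^c`. -/
def mon (a b c : ℕ) : P 3 := lastMul c (lastMul b (lastMul a (1 : P 0)))

theorem Sq_lastMul_one (j a : ℕ) : Sq j (lastMul a (1 : P 0)) =
    (a.choose j : ZMod 2) • lastMul (a + j) (1 : P 0) := by
  rw [Sq_lastMul, Finset.sum_eq_single (j, 0)]
  · rw [Sq_zero]
  · rintro ⟨u, v⟩ h hne
    rw [Finset.HasAntidiagonal.mem_antidiagonal] at h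
    rw [Sq_one, if_neg, map_zero, smul_zero]
    rintro rfl
    exact hne (by simpa using h)
  · intro h
    exact absurd (Finset.HasAntidiagonal.mem_antidiagonal.mpr (add_zero j)) h

theorem Sq_lastMul_lastMul_one (j b a : ℕ) : Sq j (lastMul b (lastMul a (1 : P 0))) =
    ∑ q ∈ Finset.HasAntidiagonal.antidiagonal j,
      (b.choose q.1 * a.choose q.2 : ZMod 2) • lastMul (b + q.1) (lastMul (a + q.2) (1 : P 0)) := by
  rw [Sq_lastMul]
  refine Finset.sum_congr rfl fun q _ => ?_
  rw [Sq_lastMul_one, map_smul, smul_smul]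

theorem Sq_mon (j a b c : ℕ) : Sq j (mon a b c) =
    ∑ q ∈ Finset.HasAntidiagonal.antidiagonal j, ∑ r ∈ Finset.HasAntidiagonal.antidiagonal q.2,
      (c.choose q.1 * (b.choose r.1 * a.choose r.2) : ZMod 2) • mon (a + r.2) (b + r.1) (c + q.1) := by
  rw [mon, Sq_lastMul]
  refine Finset.sum_congr rfl fun q _ => ?_
  rw [Sq_lastMul_lastMul_one, map_sum, Finset.smul_sum]
  refine Finset.sum_congr rfl fun r _ => ?_
  rw [map_smul, smul_smul, mon]

theorem singerStep_one (a : ℕ) : singerStep a (1 : P 0) = lastMul a 1 := by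
  rw [singerStep_apply, Finset.sum_eq_single (a, 0)]
  · rw [Sq_zero]
  · rintro ⟨u, v⟩ h hne
    rw [Finset.HasAntidiagonal.mem_antidiagonal] at h
    rw [Sq_one, if_neg, map_zero]
    rintro rfl
    exact hne (by simpa using h)
  · intro h
    exact absurd (Finset.HasAntidiagonal.mem_antidiagonal.mpr (add_zero a)) h

/-- The coefficient of `λ_a λ_b λ_c` in the universal transfer, as a sum of monomials. -/
theorem singerStep_three (c b a : ℕ) : singerStep c (singerStep b (singerStep a (1 : P 0))) =
    ∑ s ∈ Finset.HasAntidiagonal.antidiagonal c, ∑ t ∈ Finset.HasAntidiagonal.antidiagonal b,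
      ∑ v ∈ Finset.HasAntidiagonal.antidiagonal s.2,
        (a.choose t.2 * (t.1.choose v.1 * (a + t.2).choose v.2) : ZMod 2) •
          mon (a + t.2 + v.2) (t.1 + v.1) s.1 := by
  rw [singerStep_one, singerStep_apply]
  refine Finset.sum_congr rfl fun s _ => ?_
  rw [singerStep_apply, map_sum, map_sum]
  refine Finset.sum_congr rfl fun t _ => ?_
  rw [Sq_lastMul_one, map_smul, map_smul, map_smul, Sq_lastMul_lastMul_one, map_sum, Finset.smul_sum]
  refine Finset.sum_congr rfl fun v _ => ?_
  rw [map_smul, smul_smul, mon]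

theorem mon_sq (a b c : ℕ) : mon (2 * a) (2 * b) (2 * c) = mon a b c ^ 2 := by
  simp only [mon, lastMul_apply, map_mul, map_pow, map_one, mul_one]
  ring

theorem lastMul_isHomogeneous {k d : ℕ} (m : ℕ) {f : P k} (hf : f.IsHomogeneous d) :
    (lastMul m f).IsHomogeneous (m + d) := by
  rw [lastMul_apply]
  exact ((MvPolynomial.isHomogeneous_X_pow (Fin.last k) m).mul hf.rename_isHomogeneous)

theorem mon_isHomogeneous (a b c : ℕ) : (mon a b c).IsHomogeneous (a + b + c) := by
  have := lastMul_isHomogeneous c (lastMul_isHomogeneous b (lastMul_isHomogeneous a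
    (MvPolynomial.isHomogeneous_one (Fin 0) (ZMod 2))))
  rwa [show c + (b + (a + 0)) = a + b + c by ring] at this

theorem mon_even_mem_hit {a b c : ℕ} (h : 0 < a + b + c) : mon (2 * a) (2 * b) (2 * c) ∈ hit 3 := by
  rw [mon_sq]
  exact sq_mem_hit h (mon_isHomogeneous a b c)

theorem prim_mon_even {d : ℕ} {b : Module.Dual (ZMod 2) (P 3)} (hb : b ∈ Prim 3 d) (h : 0 < d) (x y z : ℕ) :
    b (mon (2 * x) (2 * y) (2 * z)) = 0 := by
  by_cases hd : 2 * x + 2 * y + 2 * z = d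
  · exact prim_hit hb (mon_even_mem_hit (by omega))
  · exact hb.1 _ hd _ (mon_isHomogeneous _ _ _)

theorem prim_Sq_one {d : ℕ} {b : Module.Dual (ZMod 2) (P 3)} (hb : b ∈ Prim 3 d) (x y z : ℕ) :
    x * b (mon (x + 1) y z) + y * b (mon x (y + 1) z) + z * b (mon x y (z + 1)) = 0 := by
  have := hb.2 0 (mon x y z)
  simpa [Sq_mon, Finset.Nat.antidiagonal_succ] using this

theorem prim_Sq_two {d : ℕ} {b : Module.Dual (ZMod 2) (P 3)} (hb : b ∈ Prim 3 d) (x y z : ℕ) :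
    x.choose 2 * b (mon (x + 2) y z) + (y * x * b (mon (x + 1) (y + 1) z) +
      y.choose 2 * b (mon x (y + 2) z)) + (z * x * b (mon (x + 1) y (z + 1)) +
      z * y * b (mon x (y + 1) (z + 1)) + z.choose 2 * b (mon x y (z + 2))) = 0 := by
  have := hb.2 1 (mon x y z)
  simpa [Sq_mon, Finset.Nat.antidiagonal_succ] using this

/-- The linear relations between the values of a functional annihilated by `Sq^1` and `Sq^2` on the
monomials of degree `8`. They express all values by those on fifteen monomials. -/
theorem prim_eight_relations {b : Module.Dual (ZMod 2) (P 3)} (hb : b ∈ Prim 3 8) :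
    b (mon 0 5 3) = b (mon 0 3 5) ∧
    b (mon 1 4 3) = b (mon 1 2 5) ∧
    b (mon 1 5 2) = b (mon 1 3 4) ∧
    b (mon 4 1 3) = b (mon 2 1 5) ∧
    b (mon 4 3 1) = b (mon 2 5 1) ∧
    b (mon 5 0 3) = b (mon 3 0 5) ∧
    b (mon 5 1 2) = b (mon 3 1 4) ∧
    b (mon 5 2 1) = b (mon 3 4 1) ∧
    b (mon 5 3 0) = b (mon 3 5 0) ∧
    b (mon 1 1 6) = b (mon 2 1 5) + b (mon 1 2 5) ∧
    b (mon 2 3 3) = b (mon 1 3 4) + b (mon 1 2 5) ∧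
    b (mon 1 6 1) = b (mon 1 3 4) + b (mon 2 5 1) ∧
    b (mon 3 2 3) = b (mon 3 1 4) + b (mon 2 1 5) ∧
    b (mon 3 3 2) = b (mon 3 4 1) + b (mon 2 5 1) ∧
    b (mon 6 1 1) = b (mon 3 1 4) + b (mon 3 4 1) := by
  have h1 := prim_Sq_one hb
  have h2 := prim_Sq_two hb
  have he := prim_mon_even hb (by norm_num)
  have e1 := he 1 1 2
  have e2 := he 1 2 1
  have e3 := he 2 1 1
  have e4 := he 0 2 2
  have e5 := he 2 0 2
  have e6 := he 2 2 0
  -- `Sq^2` on monomials of degree `6`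
  have a1 := h2 0 3 3
  have a2 := h2 1 2 3
  have a3 := h2 1 3 2
  have a4 := h2 2 1 3
  have a5 := h2 2 3 1
  have a6 := h2 3 0 3
  have a7 := h2 3 1 2
  have a8 := h2 3 2 1
  have a9 := h2 3 3 0
  -- `Sq^1` on monomials of degree `7`
  have c1 := h1 1 1 5
  have c2 := h1 1 3 3
  have c3 := h1 1 5 1
  have c4 := h1 3 1 3
  have c5 := h1 3 3 1
  have c6 := h1 5 1 1
  clear h1 h2 he hb
  simp [Nat.choose] at *
  reduce_mod_char at *
  grind

set_option maxHeartbeats 4000000 in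
/-- The words `λ_a λ_b λ_c` of stem `8` whose coefficient in the transfer is zero for every `b`. -/
theorem singerStep_vanish {b : Module.Dual (ZMod 2) (P 3)} (hb : b ∈ Prim 3 8) :
    ∀ w ∈ ([(0, 0, 8), (0, 2, 6), (0, 3, 5), (0, 4, 4), (0, 6, 2), (0, 8, 0),
        (1, 1, 6), (1, 2, 5), (1, 3, 4), (1, 5, 2), (2, 0, 6), (2, 1, 5), (2, 2, 4), (2, 4, 2),
        (2, 5, 1), (2, 6, 0), (3, 0, 5), (3, 1, 4), (3, 3, 2), (3, 5, 0), (4, 0, 4),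
        (4, 2, 2), (4, 4, 0), (5, 1, 2), (6, 0, 2), (6, 2, 0), (8, 0, 0)] : List (ℕ × ℕ × ℕ)),
      b (singerStep w.2.2 (singerStep w.2.1 (singerStep w.1 1))) = 0 := by
  obtain ⟨r1, r2, r3, r4, r5, r6, r7, r8, r9, r10, r11, r12, r13, r14, r15⟩ := prim_eight_relations hb
  have he := prim_mon_even hb (by norm_num)
  have e1 := he 1 1 2
  have e2 := he 1 2 1
  have e3 := he 2 1 1
  have e4 := he 0 2 2
  have e5 := he 2 0 2
  have e6 := he 2 2 0
  have e7 := he 4 0 0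
  have e8 := he 0 4 0
  have e9 := he 0 0 4
  have e10 := he 3 1 0
  have e11 := he 3 0 1
  have e12 := he 1 3 0
  have e13 := he 0 3 1
  have e14 := he 0 1 3
  have e15 := he 1 0 3
  clear hb he
  simp only [Nat.reduceMul] at *
  simp only [List.forall_mem_cons, List.not_mem_nil, false_imp_iff, implies_true, and_true,
    singerStep_three, map_sum, map_smul, smul_eq_mul]
  refine ⟨?_, ?_, ?_, ?_, ?_, ?_, ?_, ?_, ?_, ?_, ?_, ?_, ?_, ?_, ?_, ?_, ?_, ?_, ?_, ?_, ?_, ?_,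
    ?_, ?_, ?_, ?_, ?_⟩ <;>
    (simp [Finset.Nat.antidiagonal_succ, Nat.choose, *] <;> reduce_mod_char <;> grind)

set_option maxHeartbeats 4000000 in
/-- The coefficients in the transfer of `b` of the other eighteen words of stem `8`, in terms of the values
of `b` on the monomials to which `prim_eight_relations` reduces. -/
theorem singerStep_values {b : Module.Dual (ZMod 2) (P 3)} (hb : b ∈ Prim 3 8) :
    b (singerStep 7 (singerStep 1 (singerStep 0 1))) = b (mon 0 1 7) ∧
    b (singerStep 3 (singerStep 5 (singerStep 0 1))) = b (mon 0 3 5) ∧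
    b (singerStep 1 (singerStep 7 (singerStep 0 1))) = b (mon 0 7 1) ∧
    b (singerStep 7 (singerStep 0 (singerStep 1 1))) = b (mon 1 0 7) ∧
    b (singerStep 3 (singerStep 4 (singerStep 1 1))) = b (mon 1 3 4) ∧
    b (singerStep 1 (singerStep 6 (singerStep 1 1))) = b (mon 1 3 4) ∧
    b (singerStep 0 (singerStep 7 (singerStep 1 1))) = b (mon 1 7 0) ∧
    b (singerStep 3 (singerStep 3 (singerStep 2 1))) = b (mon 1 2 5) + b (mon 1 3 4) + b (mon 2 1 5) ∧
    b (singerStep 3 (singerStep 2 (singerStep 3 1))) = b (mon 3 0 5) + b (mon 3 1 4) ∧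
    b (singerStep 1 (singerStep 4 (singerStep 3 1))) = b (mon 2 5 1) + b (mon 3 1 4) + b (mon 3 4 1) ∧
    b (singerStep 3 (singerStep 1 (singerStep 4 1))) = b (mon 2 1 5) ∧
    b (singerStep 1 (singerStep 3 (singerStep 4 1))) = b (mon 2 5 1) ∧
    b (singerStep 3 (singerStep 0 (singerStep 5 1))) = b (mon 3 0 5) ∧
    b (singerStep 1 (singerStep 2 (singerStep 5 1))) = b (mon 3 1 4) ∧
    b (singerStep 0 (singerStep 3 (singerStep 5 1))) = b (mon 3 5 0) ∧
    b (singerStep 1 (singerStep 1 (singerStep 6 1))) = b (mon 3 1 4) + b (mon 3 4 1) ∧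
    b (singerStep 1 (singerStep 0 (singerStep 7 1))) = b (mon 7 0 1) ∧
    b (singerStep 0 (singerStep 1 (singerStep 7 1))) = b (mon 7 1 0) := by
  obtain ⟨r1, r2, r3, r4, r5, r6, r7, r8, r9, r10, r11, r12, r13, r14, r15⟩ := prim_eight_relations hb
  have he := prim_mon_even hb (by norm_num)
  have e1 := he 1 1 2
  have e2 := he 1 2 1
  have e3 := he 2 1 1
  have e4 := he 0 2 2
  have e5 := he 2 0 2
  have e6 := he 2 2 0
  have e7 := he 4 0 0
  have e8 := he 0 4 0
  have e9 := he 0 0 4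
  have e10 := he 3 1 0
  have e11 := he 3 0 1
  have e12 := he 1 3 0
  have e13 := he 0 3 1
  have e14 := he 0 1 3
  have e15 := he 1 0 3
  clear hb he
  simp only [Nat.reduceMul] at *
  simp only [singerStep_three, map_sum, map_smul, smul_eq_mul]
  refine ⟨?_, ?_, ?_, ?_, ?_, ?_, ?_, ?_, ?_, ?_, ?_, ?_, ?_, ?_, ?_, ?_, ?_, ?_⟩ <;>
    (simp [Finset.Nat.antidiagonal_succ, Nat.choose, *] <;> reduce_mod_char <;> grind)

/-! ### The lambda algebra in stem eight -/

/-- The class of `λ_a λ_b λ_c` in the lambda algebra modulo boundaries. -/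
def word (a b c : ℕ) : T ⧸ lamBoundaries := lamBoundaries.mkQ (lam a * lam b * lam c)

theorem mkQ_eq_zero {x : T} (h : x ∈ lamBoundaries) : lamBoundaries.mkQ x = 0 :=
  (Submodule.Quotient.mk_eq_zero lamBoundaries).mpr h

theorem mkQ_lamRel_mul (j m c : ℕ) : lamBoundaries.mkQ (lamRel j m * lam c) = 0 :=
  mkQ_eq_zero (Submodule.mem_sup_right (Submodule.subset_span ⟨1, lam c, j, m, by rw [one_mul]⟩))

theorem mkQ_mul_lamRel (a j m : ℕ) : lamBoundaries.mkQ (lam a * lamRel j m) = 0 :=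
  mkQ_eq_zero (Submodule.mem_sup_right (Submodule.subset_span ⟨lam a, 1, j, m, by rw [mul_one]⟩))

theorem mkQ_lamDer (a b : ℕ) : lamBoundaries.mkQ (lamD a * lam b + lam a * lamD b) = 0 := by
  rw [← lamDer_lam, ← lamDer_lam, ← lamDer_mul]
  exact mkQ_eq_zero (Submodule.mem_sup_left ⟨_, rfl⟩)

theorem mkQ_word_left (a b c : ℕ) : lamBoundaries.mkQ (lam a * lam b * lam c) = word a b c := rfl

theorem mkQ_word_right (a b c : ℕ) : lamBoundaries.mkQ (lam a * (lam b * lam c)) = word a b c := by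
  rw [← mul_assoc]; rfl

theorem eq_of_add_eq_zero {a b : T ⧸ lamBoundaries} (h : a + b = 0) : a = b := by
  rwa [← ZModModule.sub_eq_add, sub_eq_zero] at h

/-- The words of stem `8` that occur in the transfer, modulo boundaries and relations of the lambda
algebra. -/
theorem word_relations :
    word 0 1 7 = 0 ∧ word 0 5 3 = 0 ∧ word 0 7 1 = 0 ∧ word 1 0 7 = 0 ∧ word 1 7 0 = 0 ∧
    word 4 1 3 = 0 ∧ word 5 3 0 = 0 ∧ word 7 0 1 = 0 ∧ word 7 1 0 = 0 ∧
    word 1 4 3 = word 2 3 3 ∧ word 1 6 1 = word 2 3 3 ∧ word 5 0 3 = word 5 2 1 ∧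
    word 3 2 3 = word 5 2 1 ∧ word 4 3 1 = word 6 1 1 ∧ word 3 4 1 = word 2 3 3 + word 6 1 1 := by
  -- defining relations times a generator, and boundaries of products `λ_a λ_b`
  have h017 := mkQ_lamRel_mul 0 0 7
  have h053 := mkQ_mul_lamRel 0 1 4
  have h071 := mkQ_lamDer 0 9
  have h107 := mkQ_lamDer 2 7
  have h161 := mkQ_mul_lamRel 1 0 6
  have h143 := mkQ_lamRel_mul 1 1 3
  have h170 := mkQ_lamDer 1 8
  have h413 := mkQ_mul_lamRel 4 1 0
  have h710 := mkQ_lamDer 7 2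
  have h530 := mkQ_lamDer 9 0
  have h701 := mkQ_mul_lamRel 7 0 0
  have h503 := mkQ_mul_lamRel 5 0 2
  have h323 := mkQ_lamDer 6 3
  have h431 := mkQ_lamDer 8 1
  have h341 := mkQ_mul_lamRel 3 0 4
  have h215 := mkQ_mul_lamRel 2 1 2
  have h305 := mkQ_lamDer 4 5
  simp [lamRel, lamD, Finset.sum_range_succ, Nat.choose, mul_add, add_mul, mkQ_word_left, mkQ_word_right,
    -Submodule.mkQ_apply] at *
  reduce_mod_char at *
  simp only [zero_smul, one_smul, add_zero, zero_add] at *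
  have e305 : word 3 0 5 = word 3 4 1 := eq_of_add_eq_zero h341
  rw [h017, zero_add] at h053
  rw [h053, add_zero] at h071
  rw [h107, zero_add] at h161
  rw [add_assoc, h161, add_zero] at h170
  rw [h710, zero_add] at h530
  have e503 := eq_of_add_eq_zero h503
  have e143 := eq_of_add_eq_zero h143
  have e161 := eq_of_add_eq_zero h161
  have e323 := eq_of_add_eq_zero h323
  rw [h701, zero_add] at h431
  have e431 := eq_of_add_eq_zero h431
  have e215 := eq_of_add_eq_zero h215
  rw [e305, add_assoc, e215, ← e431] at h305
  exact ⟨h017, h053, h071, h107, h170, h413, h530, h701, h710, e143, e161.trans e143, e503,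
    e323.symm.trans e503, e431.symm, eq_of_add_eq_zero h305⟩

theorem transferLam_three (d : ℕ) (b : Module.Dual (ZMod 2) (P 3)) : transferLam 3 d b =
    ∑ p ∈ Finset.HasAntidiagonal.antidiagonal d, ∑ q ∈ Finset.HasAntidiagonal.antidiagonal p.2,
      b (singerStep p.1 (singerStep q.1 (singerStep q.2 1))) • (lam q.2 * lam q.1 * lam p.1) := by
  have h1 : ∀ (e : ℕ) (c : Module.Dual (ZMod 2) (P 1)),
      transferLam 1 e c = c (singerStep e 1) • lam e := by
    intro e c
    rw [transferLam_succ, Finset.sum_eq_single (e, 0)]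
    · rw [transferLam_zero, if_pos rfl, Algebra.smul_def]; rfl
    · rintro ⟨u, v⟩ h hne
      rw [Finset.HasAntidiagonal.mem_antidiagonal] at h
      rw [transferLam_zero, if_neg, zero_mul]
      rintro rfl
      exact hne (by simpa using h)
    · intro h
      exact absurd (Finset.HasAntidiagonal.mem_antidiagonal.mpr (add_zero e)) h
  rw [transferLam_succ]
  refine Finset.sum_congr rfl fun p _ => ?_
  rw [transferLam_succ, Finset.sum_mul]
  refine Finset.sum_congr rfl fun q _ => ?_
  rw [h1, smul_mul_assoc, smul_mul_assoc]
  rfl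

theorem mon_eq (a b c : ℕ) : mon a b c = X 0 ^ a * X 1 ^ b * X 2 ^ c := by
  have h0 : (Fin.castSucc (Fin.castSucc (Fin.last 0)) : Fin 3) = 0 := rfl
  have h1 : (Fin.castSucc (Fin.last 1) : Fin 3) = 1 := rfl
  have h2 : Fin.last 2 = 2 := rfl
  simp only [mon, lastMul_apply, map_mul, map_pow, map_one, mul_one, MvPolynomial.rename_X, h0, h1, h2]
  ring

theorem pBar0_eq_mon : pBar0 = mon 1 1 6 + mon 1 6 1 + mon 3 1 4 + mon 3 4 1 := by
  simp only [mon_eq, pBar0, pow_one]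

/-- In stem `8`, the transfer of `b` is represented by `b(p̄_0) λ_2 λ_3^2`. -/
theorem mkQ_transferLam_eight {b : Module.Dual (ZMod 2) (P 3)} (hb : b ∈ Prim 3 8) :
    lamBoundaries.mkQ (transferLam 3 8 b) = b pBar0 • word 2 3 3 := by
  obtain ⟨-, -, -, -, -, -, -, -, -, r1, -, r2, -, -, -⟩ := prim_eight_relations hb
  have h1 := singerStep_vanish hb
  have h2 := singerStep_values hb
  obtain ⟨w1, w2, w3, w4, w5, w6, w7, w8, w9, w10, w11, w12, w13, w14, w15⟩ := word_relations
  rw [pBar0_eq_mon, map_add, map_add, map_add, r1, r2, transferLam_three]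
  simp only [List.forall_mem_cons, List.not_mem_nil, false_imp_iff, implies_true, and_true] at h1
  simp only [Finset.Nat.antidiagonal_succ, Finset.Nat.antidiagonal_zero, Finset.sum_cons,
    Finset.map_singleton, Finset.sum_singleton, Finset.map_cons, Function.Embedding.prodMap,
    Function.Embedding.coeFn_mk, Prod.map, Nat.succ_eq_add_one, Function.Embedding.refl_apply,
    Nat.reduceAdd, map_add, map_smul, mkQ_word_left, h1, h2, zero_smul, add_zero, zero_add, w1,
    w2, w3, w4, w5, w6, w7, w8, w9, w10, w11, w12, w13, w14, w15, smul_zero]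
  -- all remaining words other than `λ_2 λ_3^2` occur with even multiplicity
  linear_combination (norm := module) (b (mon 1 3 4)) • ZModModule.add_self (word 2 3 3) +
    (b (mon 3 1 4) + b (mon 3 0 5)) • ZModModule.add_self (word 5 2 1) +
    (b (mon 3 1 4) + b (mon 3 4 1) + b (mon 2 5 1)) • ZModModule.add_self (word 6 1 1)

/-! ### The transfer of the duals -/

theorem transferLam_mem {k d : ℕ} {b : Module.Dual (ZMod 2) (P k)} (hb : b ∈ Prim k d) :
    transferLam k d b ∈ lamCycles := kap_cocycles (transferCochain_mem hb)

theorem extToLambda_transfer (k d : ℕ) (b : Prim k d) : extToLambda k d (transfer k d b) =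
    Submodule.Quotient.mk ⟨transferLam k d b.1, transferLam_mem b.2⟩ := rfl

theorem extToLambda_transfer_comp {k d : ℕ} {b : Module.Dual (ZMod 2) (P k)} (hb : b ∈ Prim k d) :
    extToLambda k (2 * d + k) (transfer k (2 * d + k) ⟨b.comp kamekoDown, comp_kamekoDown_mem hb⟩) =
      Sq0 (extToLambda k d (transfer k d ⟨b, hb⟩)) := by
  rw [extToLambda_transfer, extToLambda_transfer]
  refine congrArg Submodule.Quotient.mk (Subtype.ext ?_)
  exact (transferLam_kamekoDown k b).1 d

theorem transfer_eight {b : Module.Dual (ZMod 2) (P 3)} (hb : b ∈ Prim 3 8) (h1 : b pBar0 = 1) :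
    extToLambda 3 8 (transfer 3 8 ⟨b, hb⟩) = cClass 0 := by
  have h := mkQ_transferLam_eight hb
  rw [h1, one_smul, word, mul_assoc, ← pow_two] at h
  have h2 : transferLam 3 8 b - lam 2 * lam 3 ^ 2 ∈ lamBoundaries := (Submodule.Quotient.eq _).mp h
  rw [extToLambda_transfer, cClass, pow_zero]
  exact (Submodule.Quotient.eq _).mpr h2

/-- Induction on `u`: every `b` in question is the composition of such a functional in the previous degree
with Kameko's homomorphism, which corresponds to `Sq^0`. -/
theorem transfer_iterate (u : ℕ) {b : Module.Dual (ZMod 2) (P 3)} (hb : b ∈ Prim 3 (kamekoDegree 2 u))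
    (h1 : b (kamekoUp^[u] pBar0) = 1) :
    extToLambda 3 (kamekoDegree 2 u) (transfer 3 (kamekoDegree 2 u) ⟨b, hb⟩) = cClass u := by
  induction u generalizing b with
  | zero => exact transfer_eight hb h1
  | succ u ih =>
    have hm := kamekoDegree_ne (show 0 < 2 by norm_num) u
    have hb' := compKamekoUp_mem hm hb
    rw [Function.iterate_succ_apply'] at h1
    have h2 := ih hb' h1
    have h3 : cClass (u + 1) = Sq0 (cClass u) := by
      rw [cClass, pow_succ']; rfl
    rw [h3, ← h2, ← extToLambda_transfer_comp hb']
    congr 2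
    exact Subtype.ext (eq_comp_kamekoDown hm hb)

/-! ### A functional detecting the invariant -/

/-- The functional of degree `8` which is the sum of the elements dual to the monomials
`x_1^3 x_2 x_3^4`, `x_1^5 x_2 x_3^2`, `x_1^3 x_2^2 x_3^3`, `x_1^6 x_2 x_3`. -/
def dualEight : Module.Dual (ZMod 2) (P 3) :=
  (MvPolynomial.basisMonomials (Fin 3) (ZMod 2)).constr (ZMod 2) fun a =>
    if (a 0, a 1, a 2) ∈ [(3, 1, 4), (5, 1, 2), (3, 2, 3), (6, 1, 1)] then 1 else 0

theorem monomial_eq_mon (a : Fin 3 →₀ ℕ) : MvPolynomial.monomial a 1 = mon (a 0) (a 1) (a 2) := by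
  rw [mon_eq, MvPolynomial.monomial_eq, map_one, one_mul, Finsupp.prod_fintype _ _ (by simp),
    Fin.prod_univ_three]

theorem dualEight_mon (x y z : ℕ) : dualEight (mon x y z) =
    if (x, y, z) ∈ [(3, 1, 4), (5, 1, 2), (3, 2, 3), (6, 1, 1)] then 1 else 0 := by
  have h := (MvPolynomial.basisMonomials (Fin 3) (ZMod 2)).constr_basis (ZMod 2) (fun a =>
    (if (a 0, a 1, a 2) ∈ [(3, 1, 4), (5, 1, 2), (3, 2, 3), (6, 1, 1)] then 1 else 0 : ZMod 2))
    (Finsupp.equivFunOnFinite.symm ![x, y, z])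
  rw [MvPolynomial.coe_basisMonomials] at h
  beta_reduce at h
  rw [monomial_eq_mon] at h
  exact h

theorem dualEight_degree {x y z : ℕ} (h : x + y + z ≠ 8) : dualEight (mon x y z) = 0 := by
  rw [dualEight_mon, if_neg]
  intro hm
  simp only [List.mem_cons, Prod.mk.injEq, List.not_mem_nil, or_false] at hm
  rcases hm with hm | hm | hm | hm <;> omega

theorem dualEight_mem : dualEight ∈ Prim 3 8 := by
  refine ⟨fun m hm f hf => ?_, fun j f => ?_⟩
  · refine homogeneous_induction (p := fun f => dualEight f = 0) (map_zero _) ?_ ?_ hf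
    · intro f g hf hg; rw [map_add, hf, hg, add_zero]
    · intro a ha
      rw [monomial_eq_mon]
      refine dualEight_degree ?_
      rw [← Fin.sum_univ_three, ← Finsupp.degree_eq_sum, ha]
      exact hm
  · refine additive_induction (p := fun f => dualEight (Sq (j + 1) f) = 0) ?_ ?_ ?_ f
    · rw [map_zero, map_zero]
    · intro f g hf hg; rw [map_add, map_add, hf, hg, add_zero]
    · intro a
      rw [monomial_eq_mon, Sq_mon]
      simp only [map_sum, map_smul, smul_eq_mul]
      generalize a 0 = x, a 1 = y, a 2 = z
      -- a finite check in degree `8`; in the other degrees all terms vanish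
      by_cases hd : x + y + z + (j + 1) = 8
      · have key : ∀ x < 8, ∀ y < 8 - x, ∀ z < 8 - x - y,
            ∑ q ∈ Finset.HasAntidiagonal.antidiagonal (8 - x - y - z),
              ∑ r ∈ Finset.HasAntidiagonal.antidiagonal q.2,
                (z.choose q.1 * (y.choose r.1 * x.choose r.2) : ZMod 2) *
                  (if (x + r.2, y + r.1, z + q.1) ∈ [(3, 1, 4), (5, 1, 2), (3, 2, 3), (6, 1, 1)]
                    then 1 else 0) = 0 := by
          decide +kernel
        have := key x (by omega) y (by omega) z (by omega)
        rw [show 8 - x - y - z = j + 1 by omega] at this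
        simpa only [dualEight_mon] using this
      · refine Finset.sum_eq_zero fun q hq => Finset.sum_eq_zero fun r hr => ?_
        rw [Finset.HasAntidiagonal.mem_antidiagonal] at hq hr
        rw [dualEight_degree (by omega), mul_zero]

theorem dualEight_pBar0 : dualEight pBar0 = 1 := by
  rw [pBar0_eq_mon, map_add, map_add, map_add]
  simp only [dualEight_mon]
  decide

theorem exists_prim_eq_one (u : ℕ) :
    ∃ b : Prim 3 (kamekoDegree 2 u), b.1 (kamekoUp^[u] pBar0) = 1 := by
  induction u with
  | zero => exact ⟨⟨dualEight, dualEight_mem⟩, dualEight_pBar0⟩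
  | succ u ih =>
    obtain ⟨b, hb⟩ := ih
    refine ⟨⟨b.1.comp kamekoDown, comp_kamekoDown_mem b.2⟩, ?_⟩
    rw [Function.iterate_succ_apply']
    change b.1 (kamekoDown (kamekoUp _)) = 1
    rw [kamekoDown_kamekoUp, hb]

end Singer

end

theorem proposition3p6 (s u n : ℕ) (hs : 0 < s)
    (hn : n = 2 ^ (s + u + 1) + 2 ^ (u + 1) + 2 ^ u - 3) :
    (s = 2 → Singer.invariants 3 n =
      Submodule.span (ZMod 2) {(Singer.hit 3).mkQ (Singer.kamekoUp^[u] Singer.pBar0)}) ∧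
    (s ≠ 2 → Singer.invariants 3 n = ⊥) ∧
    (s = 2 →
      (∃ b : Singer.Prim 3 n, b.1 (Singer.kamekoUp^[u] Singer.pBar0) = 1) ∧
      ∀ b : Singer.Prim 3 n, b.1 (Singer.kamekoUp^[u] Singer.pBar0) = 1 →
        Singer.extToLambda 3 n (Singer.transfer 3 n b) = Singer.cClass u) := by
  have hd : n = Singer.kamekoDegree s u := by
    have := Singer.kamekoDegree_add s u
    omega
  clear hn
  subst hd
  refine ⟨?_, fun h2 => Singer.invariants_eq_bot hs h2 u, ?_⟩
  · rintro rfl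
    exact Singer.invariants_two u
  · rintro rfl
    exact ⟨Singer.exists_prim_eq_one u, fun b hb => Singer.transfer_iterate u b.2 hb⟩
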